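/- **Setting.** Let $n\ge 0$, $L\ge 1$, $M\ge 1$, $n_t\ge 0$ be integers, $t_0<t$, $\Delta t=t-t_0$. Let $H(\tau)=\sum_{j=1}^{L}\alpha_j(\tau)H_j$ on $[t_0,t]$, with $H_j\in\mathbb C^{2^n\times 2^n}$ Hermitian and $\alpha_j:[t_0,t]\to\mathbb R$ of class $C^\infty$, and let $U(t,t_0)$ be the propagator of $i\,\partial_\tau U(\tau,t_0)=H(\tau)U(\tau,t_0)$, $U(t_0,t_0)=1$. Let $\Lambda:[t_0,t]\to(0,\infty)$ be continuous with $\Lambda(\tau)\ge\sup_{p\ge 0}\|\partial_\tau^pH(\tau)\|^{1/(p+1)}$ (spectral norm). Let $\kappa\ge1$ be a number with $\|H_j\|\le\kappa$ for all $j$ and $$\sum_{j}|\partial_\tau^p\alpha_j(\tau)|\,\|H_j\|\le\bigl(\kappa\max_{[t_0,t]}\Lambda\bigr)^{p+1}\qquad(0\le p\le 2M+1,\ \tau\in[t_0,t]);$$ such a $\kappa$ always exists. **Oracles.** Put $t_q=t_0+q\,\Delta t/(2^{n_t}-1)$ for $0\le q<2^{n_t}$ ($t_0$ if $n_t=0$).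 $U_\alpha$ is a self-inverse unitary with $U_\alpha|j\rangle|q\rangle|\tau\rangle|0\rangle=|j\rangle|q\rangle|\tau\rangle|\alpha_j(t_q)\tau\rangle$ and $U_H$ is a unitary with $U_H|j\rangle|v\rangle|\psi\rangle=|j\rangle|v\rangle e^{-iH_jv}|\psi\rangle$ for all $|\psi\rangle\in\mathbb C^{2^n}$ and all values $v=\alpha_j(t_q)\tau$. Here $\tau$ runs over finitely many step lengths in $[0,\Delta t]$ chosen by the algorithm, and the values $v$ are assumed to be exactly encoded by the bit strings of the value register. A query circuit is a product of oracle-independent unitaries on these registers, the system and any number of work qubits, and of applications of $U_\alpha$, $U_H$ and $U_H^{-1}$, each of which counts as one query. **Lemma.** There are absolute constants $c_1,c_2,e$ and, for every $M\ge1$, integers $1\le k_1,\dots,k_M\le 3M^2$, weights $a\in\mathbb R^M$ with $\sum_ja_j=1$, $\sum_ja_jk_j^{-2i}=0$ for $1\le i<M$ and $\|a\|_1\le c_1(1+\log M)$, and a constant $C_M$ such that the following holds. For all $n,L,n_t,t_0,t$ (and every length of the value register) there is a query circuit, which does not depend on the $H_j$, the $\alpha_j$, $\Lambda$, $\kappa$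 or the behaviour of the oracles, that makes at most $$c_2\,M^2L\,\bigl(1+\log(M^2L)\bigr)^{e},\qquad\text{that is, }\widetilde O(M^2L),$$ queries to $U_H$ and $U_\alpha$, and for which the operator $\widetilde W(t,t_0)=(\langle0|\otimes1)\,\mathrm{Circ}^{U_\alpha,U_H}\,(|0\rangle\otimes1)$ satisfies $$\bigl\|\widetilde W(t,t_0)-U(t,t_0)\bigr\|\le C_M\,\|a\|_1\Bigl(\kappa\max_{\tau\in[t_0,t]}\Lambda(\tau)\,\Delta t\Bigr)^{2M+1}$$ for all $H_j,\alpha_j,\Lambda,\kappa$ and oracles as above, whenever $$n_t\ \ge\ \log_2\!\left(\frac{10M^2L\,\max_{j,\tau}|\partial_\tau\alpha_j(\tau)|\,\Delta t^2}{\bigl(41\max_{\tau\in[t_0,t]}\Lambda(\tau)\,\Delta t\bigr)^{2M+1}}\right)$$ (no condition if all $\alpha_j$ are constant). In particular, for fixed $M$ and a fixed Hamiltonian $\sum_j\alpha_jH_j$ the error is in $O\bigl(\|a\|_1(\max\Lambda\,\Delta t)^{2M+1}\bigr)$. -/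

import Mathlib

open scoped Matrix.Norms.L2Operator ContDiff

noncomputable section

namespace TDMPF

/-- Operators on `n` qubits. Their norm is the spectral norm (the scoped `L2Operator` instances). -/
abbrev QOp (n : ℕ) := Matrix (Fin (2 ^ n)) (Fin (2 ^ n)) ℂ

/-! ### The Hamiltonian, its propagator and the `Λ` bound -/

/-- `H(τ) = ∑ j, α j τ • H j`. -/
def hamiltonian {n L : ℕ} (Hs : Fin L → QOp n) (α : Fin L → ℝ → ℝ) (τ : ℝ) : QOp n :=
  ∑ j, ((α j τ : ℝ) : ℂ) • Hs j

/-- `U τ` is the propagator `U(τ, t₀)` for `τ ∈ [t₀, t]`: the solution of the Schrödinger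
equation `∂_τ U = - i H(τ) U`, `U(t₀, t₀) = 1`. -/
def IsPropagator {n : ℕ} (H : ℝ → QOp n) (t₀ t : ℝ) (U : ℝ → QOp n) : Prop :=
  U t₀ = 1 ∧
    ∀ τ ∈ Set.Icc t₀ t, HasDerivWithinAt U (-(Complex.I • (H τ * U τ))) (Set.Icc t₀ t) τ

/-- `Λ` is a positive continuous function on `[t₀, t]` dominating
`sup_p ‖H^(p)(τ)‖ ^ (1 / (p + 1))`. -/
def IsLambdaBound {n : ℕ} (H : ℝ → QOp n) (t₀ t : ℝ) (Λ : ℝ → ℝ) : Prop :=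
  ContinuousOn Λ (Set.Icc t₀ t) ∧ ∀ τ ∈ Set.Icc t₀ t, 0 < Λ τ ∧
    ∀ p : ℕ, ‖iteratedDerivWithin p H (Set.Icc t₀ t) τ‖ ^ (1 / ((p : ℝ) + 1)) ≤ Λ τ

/-- `max_{τ ∈ [t₀, t]} Λ(τ)`; used for continuous `Λ` and `t₀ < t`, so that it is a maximum. -/
def lambdaMax (Λ : ℝ → ℝ) (t₀ t : ℝ) : ℝ := sSup (Λ '' Set.Icc t₀ t)

/-- `max_{j, τ} |∂_τ α j τ|` over all `j` and `τ ∈ [t₀, t]`; used for smooth `α j`, `t₀ < t` and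
`L ≥ 1`, so that it is a maximum. -/
def maxDeriv {L : ℕ} (α : Fin L → ℝ → ℝ) (t₀ t : ℝ) : ℝ :=
  sSup {x | ∃ j, ∃ τ ∈ Set.Icc t₀ t, x = |derivWithin (α j) (Set.Icc t₀ t) τ|}

/-- `κ ≥ 1` compares the individual terms `α j • H j` with the bound `Λ` on their sum: the terms
satisfy the derivative bounds up to order `2 M + 1` with `κ * max Λ` in place of `Λ`, and
`‖H j‖ ≤ κ`. -/
def IsTermRatio {n L : ℕ} (M : ℕ) (Hs : Fin L → QOp n) (α : Fin L → ℝ → ℝ) (Λ : ℝ → ℝ)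
    (t₀ t κ : ℝ) : Prop :=
  1 ≤ κ ∧ (∀ j, ‖Hs j‖ ≤ κ) ∧
    ∀ p ≤ 2 * M + 1, ∀ τ ∈ Set.Icc t₀ t,
      ∑ j, |iteratedDerivWithin p (α j) (Set.Icc t₀ t) τ| * ‖Hs j‖
        ≤ (κ * lambdaMax Λ t₀ t) ^ (p + 1)

/-! ### Coefficients of a multiproduct formula -/

/-- `k` and `a` are the step numbers and weights of a multiproduct formula of order `2 M`:
`∑ j, a j = 1` and `∑ j, a j / k j ^ (2 i) = 0` for `0 < i < M`. -/
def IsMPF {M : ℕ} (k : Fin M → ℕ) (a : Fin M → ℝ) : Prop :=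
  (∀ j, 0 < k j) ∧
    ∀ i < M, ∑ j, a j * (((k j : ℝ) ^ (2 * i))⁻¹) = if i = 0 then 1 else 0

/-- `‖a‖₁`. -/
def l1norm {M : ℕ} (a : Fin M → ℝ) : ℝ := ∑ j, |a j|

/-! ### The oracles -/

/-- Mesh point `t_q = t₀ + q (t - t₀) / (2 ^ n_t - 1)`. -/
def meshPoint (t₀ t : ℝ) (nt : ℕ) (q : Fin (2 ^ nt)) : ℝ :=
  t₀ + (q : ℝ) * ((t - t₀) / ((2 : ℝ) ^ nt - 1))

/-- Basis labels `|j⟩|q⟩|τ⟩|v⟩`: term, mesh point, encoded time step, `b`-bit encoded value. -/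
abbrev CoeffIdx (L nt m b : ℕ) := Fin L × Fin (2 ^ nt) × Fin (2 ^ m) × Fin (2 ^ b)

/-- Basis labels `|j⟩|v⟩|x⟩`: term, encoded value, system. -/
abbrev HamIdx (L b n : ℕ) := Fin L × Fin (2 ^ b) × Fin (2 ^ n)

/-- In the value register the code `enc j q s` stands for the real number `α j (t_q) * τ`, where
`τ = dur s` is the time step with code `s` and `val` decodes the value register. -/
def IsEncoding {L nt m b : ℕ} (α : Fin L → ℝ → ℝ) (t₀ t : ℝ) (dur : Fin (2 ^ m) → ℝ)
    (val : Fin (2 ^ b) → ℝ) (enc : Fin L → Fin (2 ^ nt) → Fin (2 ^ m) → Fin (2 ^ b)) : Prop :=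
  ∀ j q s, val (enc j q s) = α j (meshPoint t₀ t nt q) * dur s

/-- `U_α` is a self-inverse unitary with `U_α |j⟩|q⟩|τ⟩|0⟩ = |j⟩|q⟩|τ⟩|α j (t_q) τ⟩`. -/
def IsCoeffOracle {L nt m b : ℕ} (enc : Fin L → Fin (2 ^ nt) → Fin (2 ^ m) → Fin (2 ^ b))
    (Uα : Matrix (CoeffIdx L nt m b) (CoeffIdx L nt m b) ℂ) : Prop :=
  Uα ∈ Matrix.unitaryGroup (CoeffIdx L nt m b) ℂ ∧ Uα * Uα = 1 ∧
    ∀ j q s, Uα.mulVec (Pi.single (j, q, s, 0) 1) = Pi.single (j, q, s, enc j q s) 1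

/-- The vector `|j⟩|v⟩|ψ⟩`. -/
def tensorState {L b n : ℕ} (j : Fin L) (v : Fin (2 ^ b)) (ψ : Fin (2 ^ n) → ℂ) :
    HamIdx L b n → ℂ :=
  fun r => if r.1 = j ∧ r.2.1 = v then ψ r.2.2 else 0

/-- `U_H` is a unitary with `U_H |j⟩|v⟩|ψ⟩ = |j⟩|v⟩ e^{-i H_j v}|ψ⟩` for all encoded values
`v = α j (t_q) τ` and all `ψ`. -/
def IsHamOracle {n L nt m b : ℕ} (Hs : Fin L → QOp n) (val : Fin (2 ^ b) → ℝ)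
    (enc : Fin L → Fin (2 ^ nt) → Fin (2 ^ m) → Fin (2 ^ b))
    (UH : Matrix (HamIdx L b n) (HamIdx L b n) ℂ) : Prop :=
  UH ∈ Matrix.unitaryGroup (HamIdx L b n) ℂ ∧
    ∀ j q s (ψ : Fin (2 ^ n) → ℂ),
      UH.mulVec (tensorState j (enc j q s) ψ) =
        tensorState j (enc j q s)
          ((NormedSpace.exp ((-(Complex.I * (val (enc j q s) : ℂ))) • Hs j) : QOp n).mulVec ψ)

/-! ### Query circuits -/

/-- Basis labels of the whole machine: `w` work qubits, the oracle registers `|j⟩|q⟩|τ⟩|v⟩`, and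
the `n` system qubits. -/
abbrev FullIdx (w L nt m b n : ℕ) :=
  Fin (2 ^ w) × Fin L × Fin (2 ^ nt) × Fin (2 ^ m) × Fin (2 ^ b) × Fin (2 ^ n)

/-- A shortcut for instance search on the long product type. -/
instance instDecidableEqFullIdx (w L nt m b n : ℕ) : DecidableEq (FullIdx w L nt m b n) :=
  instDecidableEqProd

/-- A shortcut for instance search on the long product type. -/
instance instFintypeFullIdx (w L nt m b n : ℕ) : Fintype (FullIdx w L nt m b n) :=
  instFintypeProd _ _

/-- A gate is an oracle-independent unitary, or one application of `U_α` (which is its own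
inverse), of `U_H`, or of `U_H⁻¹`. -/
inductive Gate (w L nt m b n : ℕ) where
  | free (G : Matrix.unitaryGroup (FullIdx w L nt m b n) ℂ)
  | coeff
  | ham
  | hamInv

/-- A query circuit: the gates in their order of application. -/
abbrev Circuit (w L nt m b n : ℕ) := List (Gate w L nt m b n)

/-- Number of oracle queries made by a gate. -/
def Gate.queries {w L nt m b n : ℕ} : Gate w L nt m b n → ℕ
  | .free _ => 0
  | .coeff => 1
  | .ham => 1
  | .hamInv => 1

/-- Number of queries to `U_α` and `U_H` made by a circuit. -/
def Circuit.queries {w L nt m b n : ℕ} (c : Circuit w L nt m b n) : ℕ :=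
  (c.map Gate.queries).sum

/-- `U_α` acting on the whole machine. -/
def liftCoeff (w n : ℕ) {L nt m b : ℕ} (U : Matrix (CoeffIdx L nt m b) (CoeffIdx L nt m b) ℂ) :
    Matrix (FullIdx w L nt m b n) (FullIdx w L nt m b n) ℂ :=
  Matrix.of fun (w₁, j, q, s, v, x) (w₂, j', q', s', v', x') =>
    if w₁ = w₂ ∧ x = x' then U (j, q, s, v) (j', q', s', v') else 0

/-- `U_H` acting on the whole machine. -/
def liftHam (w nt m : ℕ) {L b n : ℕ} (U : Matrix (HamIdx L b n) (HamIdx L b n) ℂ) :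
    Matrix (FullIdx w L nt m b n) (FullIdx w L nt m b n) ℂ :=
  Matrix.of fun (w₁, j, q, s, v, x) (w₂, j', q', s', v', x') =>
    if w₁ = w₂ ∧ q = q' ∧ s = s' then U (j, v, x) (j', v', x') else 0

/-- The operator of a gate for given oracles. -/
def Gate.eval {w L nt m b n : ℕ} (Uα : Matrix (CoeffIdx L nt m b) (CoeffIdx L nt m b) ℂ)
    (UH : Matrix (HamIdx L b n) (HamIdx L b n) ℂ) :
    Gate w L nt m b n → Matrix (FullIdx w L nt m b n) (FullIdx w L nt m b n) ℂ
  | .free G => (G : Matrix (FullIdx w L nt m b n) (FullIdx w L nt m b n) ℂ)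
  | .coeff => liftCoeff w n Uα
  | .ham => liftHam w nt m UH
  | .hamInv => liftHam w nt m UH.conjTranspose

/-- The operator of a circuit for given oracles (the head of the list is applied first). -/
def Circuit.eval {w L nt m b n : ℕ} (Uα : Matrix (CoeffIdx L nt m b) (CoeffIdx L nt m b) ℂ)
    (UH : Matrix (HamIdx L b n) (HamIdx L b n) ℂ) :
    Circuit w L nt m b n → Matrix (FullIdx w L nt m b n) (FullIdx w L nt m b n) ℂ
  | [] => 1
  | g :: c => Circuit.eval Uα UH c * g.eval Uα UH

/-- The operator `(⟨0| ⊗ 1) A (|0⟩ ⊗ 1)` on the system, where `|0⟩` is the all-zero state of all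
other registers. -/
def block {w L nt m b n : ℕ} [NeZero L]
    (A : Matrix (FullIdx w L nt m b n) (FullIdx w L nt m b n) ℂ) : QOp n :=
  Matrix.of fun x x' => A (0, 0, 0, 0, 0, x) (0, 0, 0, 0, 0, x')

end TDMPF

end

/-!
Rescale time to `[0, 1]` and replace each coefficient by its Taylor polynomial of degree `< 2 M`.
The Taylor coefficient of order `p` in `z` of the symmetric product formula with `k` midpoint steps
of size `z` is then a polynomial in `k` of degree `p`, whose leading coefficient is the Taylor
coefficient of the propagator. Reversing time maps `k` to `-k`, so that this polynomial has the
parity of `p`. After the substitution `z / k` only even powers of `1 / k` remain; the moment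
conditions cancel all of them up to order `2 M`, and Cauchy's estimates bound the rest.

Step numbers close to `3 M ^ 2 / (2 j + 1)` keep the extrapolation weights of logarithmic size.
A linear combination of unitaries implements the combination of product formulas scaled by
`sin (π / (2 * 3 ^ d)) ≈ 1 / ‖a‖₁`. It is a scaled unitary up to the error, and each round of
oblivious amplitude amplification multiplies the angle by `3` and the error by a constant.
-/

noncomputable section

namespace TDMPF

section PolynomialFunctions

open Polynomial

variable {V : Type*} [Ring V] {d e : ℕ} {c c' : V} {f g : ℤ → V}

/-- `f` is a polynomial function of degree at most `d`, and its coefficient of degree `d`, which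
may vanish, is `c`. -/
def HasTopCoeff (d : ℕ) (c : V) (f : ℤ → V) : Prop :=
  ∃ P : V[X], P.natDegree ≤ d ∧ P.coeff d = c ∧ ∀ k : ℤ, f k = P.eval (k : V)

namespace HasTopCoeff

lemma congr (hf : HasTopCoeff d c f) (hc : c = c') (hfg : ∀ k, g k = f k) :
    HasTopCoeff d c' g := by
  obtain rfl : g = f := funext hfg
  exact hc ▸ hf

lemma const (c : V) : HasTopCoeff 0 c fun _ => c :=
  ⟨C c, (natDegree_C c).le, coeff_C_zero, fun k => by rw [eval_C]⟩

lemma zero (d : ℕ) : HasTopCoeff d (0 : V) fun _ => 0 :=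
  ⟨0, by simp, by simp, fun k => by simp⟩

lemma succ (hf : HasTopCoeff d c f) : HasTopCoeff (d + 1) 0 f := by
  obtain ⟨P, hP, -, hfP⟩ := hf
  exact ⟨P, hP.trans d.le_succ, coeff_eq_zero_of_natDegree_lt (by lia), hfP⟩

lemma exists_of_succ (hf : HasTopCoeff (d + 1) 0 f) : ∃ c, HasTopCoeff d c f := by
  obtain ⟨P, hP, hP0, hfP⟩ := hf
  exact ⟨P.coeff d, P, natDegree_le_pred hP hP0, rfl, hfP⟩

lemma add (hf : HasTopCoeff d c f) (hg : HasTopCoeff d c' g) :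
    HasTopCoeff d (c + c') (f + g) := by
  obtain ⟨P, hP, rfl, hfP⟩ := hf
  obtain ⟨Q, hQ, rfl, hgQ⟩ := hg
  exact ⟨P + Q, natDegree_add_le_of_degree_le hP hQ, coeff_add P Q d,
    fun k => by rw [Pi.add_apply, hfP, hgQ, eval_add]⟩

lemma sum {ι : Type*} {s : Finset ι} {c : ι → V} {f : ι → ℤ → V}
    (h : ∀ i ∈ s, HasTopCoeff d (c i) (f i)) : HasTopCoeff d (∑ i ∈ s, c i) (∑ i ∈ s, f i) := by
  classical
  induction s using Finset.induction_on with
  | empty => exact zero d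
  | insert i s hi ih =>
    rw [Finset.sum_insert hi, Finset.sum_insert hi]
    exact (h i (Finset.mem_insert_self i s)).add
      (ih fun j hj => h j (Finset.mem_insert_of_mem hj))

lemma mul (hf : HasTopCoeff d c f) (hg : HasTopCoeff e c' g) :
    HasTopCoeff (d + e) (c * c') (f * g) := by
  obtain ⟨P, hP, rfl, hfP⟩ := hf
  obtain ⟨Q, hQ, rfl, hgQ⟩ := hg
  refine ⟨P * Q, natDegree_mul_le_of_le hP hQ, coeff_mul_add_eq_of_natDegree_le hP hQ,
    fun k => ?_⟩
  rw [Pi.mul_apply, hfP, hgQ]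
  exact (eval₂_mul_noncomm _ _ fun i => Int.commute_cast (Q.coeff i) k).symm

lemma sum_mul_of_lt {p : ℕ} {A B : ℕ → V} {f g : ℕ → ℤ → V}
    (hf : ∀ i < p, HasTopCoeff i (A i) (f i)) (hg : ∀ i < p, HasTopCoeff i (B i) (g (i + 1))) :
    HasTopCoeff p 0 (∑ i ∈ Finset.range p, f i * g (p - i)) := by
  rw [← Finset.sum_const_zero (ι := ℕ) (s := Finset.range p)]
  refine sum fun i hi => ?_
  obtain ⟨q, rfl⟩ := Nat.exists_eq_add_of_lt (Finset.mem_range.1 hi)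
  rw [show i + q + 1 - i = q + 1 by lia]
  exact ((hf i (by lia)).mul (hg q (by lia))).succ

section Algebra

variable {𝕜 : Type*} [Field 𝕜] [Algebra 𝕜 V]

lemma smul (a : 𝕜) (hf : HasTopCoeff d c f) : HasTopCoeff d (a • c) (a • f) :=
  ((const (algebraMap 𝕜 V a)).mul hf).congr (Algebra.smul_def a c).symm
    (fun k => Algebra.smul_def a (f k)) |> (zero_add d ▸ ·)

variable (𝕜) in
lemma exists_eq_sum (hf : HasTopCoeff d c f) :
    ∃ b : ℕ → V, b d = c ∧ ∀ k : ℤ, f k = ∑ i ∈ Finset.range (d + 1), (k : 𝕜) ^ i • b i := by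
  obtain ⟨P, hP, hPc, hfP⟩ := hf
  refine ⟨P.coeff, hPc, fun k => ?_⟩
  rw [hfP, eval_eq_sum_range' (Nat.lt_succ_of_le hP)]
  refine Finset.sum_congr rfl fun i _ => ?_
  rw [Algebra.smul_def, map_pow, map_intCast]
  exact (((Int.commute_cast (P.coeff i) k).pow_right i)).eq

lemma linear (x : 𝕜) : HasTopCoeff 1 (1 : V) fun k : ℤ => ((k : 𝕜) + x) • (1 : V) := by
  refine ⟨X + C (algebraMap 𝕜 V x), natDegree_add_C.trans_le natDegree_X_le, by simp, fun k => ?_⟩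
  beta_reduce
  rw [eval_add, eval_X, eval_C, ← Algebra.algebraMap_eq_smul_one, map_add, map_intCast]

lemma add_pow_smul (i : ℕ) (x : 𝕜) (v : V) :
    HasTopCoeff i v fun k : ℤ => ((k : 𝕜) + x) ^ i • v := by
  induction i with
  | zero => exact (const v).congr rfl fun k => by rw [pow_zero, one_smul]
  | succ i ih =>
    rw [add_comm]
    refine ((linear x).mul ih).congr (one_mul v) fun k => ?_
    rw [Pi.mul_apply, smul_one_mul, smul_smul, ← pow_succ', add_comm i]

lemma add_one_pow_sub_pow_smul (d : ℕ) (v : V) :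
    HasTopCoeff d (((d : 𝕜) + 1) • v)
      fun k : ℤ => ((k : 𝕜) + 1) ^ (d + 1) • v - (k : 𝕜) ^ (d + 1) • v := by
  induction d with
  | zero => exact (const v).congr (by simp) fun k => by simp [← sub_smul]
  | succ d ih =>
    have h := ((linear (0 : 𝕜)).mul ih).add (add_comm 1 d ▸ add_pow_smul (d + 1) (1 : 𝕜) v)
    rw [add_comm 1 d] at h
    refine h.congr (by push_cast; rw [one_mul]; module) fun k => ?_
    simp only [Pi.add_apply, Pi.mul_apply, smul_one_mul]
    module

variable [CharZero 𝕜]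

variable (𝕜) in
lemma of_diff (h : HasTopCoeff d (((d : 𝕜) + 1) • c) fun k => f (k + 1) - f k) :
    HasTopCoeff (d + 1) c f := by
  induction d generalizing f c with
  | zero =>
    obtain ⟨b, hb, hfb⟩ := h.exists_eq_sum 𝕜
    have step (k : ℤ) : f (k + 1) = f k + c := by simpa [hb, sub_eq_iff_eq_add'] using hfb k
    have affine (k : ℤ) : f k = (k : 𝕜) • c + f 0 := by
      induction k using Int.induction_on with
      | zero => simp
      | succ k ih => rw [step, ih]; push_cast; module
      | pred k ih =>
        rw [← sub_add_cancel (-(k : ℤ)) 1, step] at ih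
        rw [eq_sub_of_add_eq ih]; push_cast; module
    refine ((add_pow_smul 1 (0 : 𝕜) c).add (const (f 0)).succ).congr (add_zero c) fun k => ?_
    rw [affine k, Pi.add_apply, add_zero, pow_one]
  | succ d ih =>
    have hd : (d : 𝕜) + 1 ≠ 0 := by exact_mod_cast d.succ_ne_zero
    set g : ℤ → V := fun k => f k - (k : 𝕜) ^ (d + 2) • c
    have diff_g : HasTopCoeff (d + 1) 0 fun k => g (k + 1) - g k := by
      refine (h.add ((add_one_pow_sub_pow_smul (𝕜 := 𝕜) (d + 1) c).smul (-1 : 𝕜))).congr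
        (by module) fun k => ?_
      simp only [g, Pi.add_apply, Pi.smul_apply]
      push_cast
      module
    obtain ⟨c', hc'⟩ := diff_g.exists_of_succ
    have hg : HasTopCoeff (d + 1) (((d : 𝕜) + 1)⁻¹ • c') g :=
      ih (by rwa [smul_inv_smul₀ hd])
    refine ((add_pow_smul (d + 2) (0 : 𝕜) c).add hg.succ).congr (add_zero c) fun k => ?_
    simp only [g, Pi.add_apply, add_zero]
    module

variable (𝕜) in
lemma exists_eq_sum_of_parity (hf : HasTopCoeff d c f)
    (parity : ∀ k, f (-k) = (-1 : 𝕜) ^ d • f k) :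
    ∃ b : ℕ → V, b d = c ∧ (∀ i, Odd (d + i) → b i = 0) ∧
      ∀ k : ℤ, f k = ∑ i ∈ Finset.range (d + 1), (k : 𝕜) ^ i • b i := by
  obtain ⟨b, hbd, hfb⟩ := hf.exists_eq_sum 𝕜
  refine ⟨fun i => ((1 + (-1) ^ (d + i)) / 2 : 𝕜) • b i, ?_, fun i hi => ?_, fun k => ?_⟩
  · beta_reduce
    rw [Even.neg_one_pow ⟨d, rfl⟩, one_add_one_eq_two, div_self two_ne_zero, one_smul, hbd]
  · beta_reduce
    rw [hi.neg_one_pow, add_neg_cancel, zero_div, zero_smul]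
  · have symmetrize : f k = (1 / 2 : 𝕜) • (f k + (-1 : 𝕜) ^ d • f (-k)) := by
      rw [parity, smul_smul, ← mul_pow, neg_mul_neg, one_mul, one_pow]
      module
    rw [symmetrize, hfb, hfb, Finset.smul_sum, ← Finset.sum_add_distrib, Finset.smul_sum]
    refine Finset.sum_congr rfl fun i _ => ?_
    rw [Int.cast_neg, neg_pow (k : 𝕜) i]
    beta_reduce
    rw [pow_add]
    module

/-- By parity only the powers `k ^ (p - 2 * i)` occur in `g`, and the weights annihilate all of
them except the leading one. -/
lemma sum_weights_smul {ι : Type*} [Fintype ι] {M p : ℕ} (hM : 0 < M) (hp : p ≤ 2 * M)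
    {k : ι → ℕ} (hk : ∀ j, (k j : 𝕜) ≠ 0) {w : ι → 𝕜}
    (moment : ∀ i < M, ∑ j, w j * ((k j : 𝕜)⁻¹) ^ (2 * i) = if i = 0 then 1 else 0)
    (hg : HasTopCoeff p c g) (parity : ∀ r, g (-r) = (-1 : 𝕜) ^ p • g r)
    (g_zero : 0 < p → g 0 = 0) :
    ∑ j, (w j * ((k j : 𝕜)⁻¹) ^ p) • g (k j) = c := by
  obtain ⟨b, rfl, b_odd, hgb⟩ := hg.exists_eq_sum_of_parity 𝕜 parity
  have expand (j : ι) : (w j * ((k j : 𝕜)⁻¹) ^ p) • g (k j)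
      = ∑ i ∈ Finset.range (p + 1), (w j * ((k j : 𝕜)⁻¹) ^ (p - i)) • b i := by
    rw [hgb, Finset.smul_sum]
    refine Finset.sum_congr rfl fun i hi => ?_
    rw [smul_smul, Int.cast_natCast, mul_assoc,
      ← pow_sub_mul_pow _ (Nat.lt_succ_iff.1 (Finset.mem_range.1 hi)), mul_assoc, ← mul_pow,
      inv_mul_cancel₀ (hk j), one_pow, mul_one]
  have lower {i : ℕ} (hi : i < p) : (∑ j, w j * ((k j : 𝕜)⁻¹) ^ (p - i)) • b i = 0 := by
    rcases Nat.even_or_odd' (p + i) with ⟨s, hs | hs⟩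
    · rcases i.eq_zero_or_pos with rfl | hi0
      · have hb0 : g 0 = b 0 := by simp [hgb, Finset.sum_range_succ']
        rw [← hb0, g_zero hi, smul_zero]
      · rw [show p - i = 2 * (s - i) by lia, moment _ (by lia), if_neg (by lia), zero_smul]
    · rw [b_odd i ⟨s, hs⟩, smul_zero]
  simp only [expand]
  rw [Finset.sum_comm]
  simp only [← Finset.sum_smul]
  rw [Finset.sum_range_succ, Finset.sum_eq_zero fun i hi => lower (Finset.mem_range.1 hi),
    zero_add, Nat.sub_self]
  simpa using congrArg (· • b p) (moment 0 hM)

end Algebra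

end HasTopCoeff

end PolynomialFunctions

section TaylorCoefficients

variable {E V : Type*} [NormedAddCommGroup E] [NormedSpace ℂ E] [NormedRing V] [NormedAlgebra ℂ V]

/-- The `p`-th Taylor coefficient of `f` at `0`. -/
def taylorCoeff (p : ℕ) (f : ℂ → E) : E := ((p.factorial : ℂ)⁻¹) • iteratedDeriv p f 0

lemma taylorCoeff_zero (f : ℂ → E) : taylorCoeff 0 f = f 0 := by
  simp [taylorCoeff]

lemma succ_smul_taylorCoeff_succ (p : ℕ) (f : ℂ → E) :
    ((p : ℂ) + 1) • taylorCoeff (p + 1) f = taylorCoeff p (deriv f) := by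
  have hp : (p : ℂ) + 1 ≠ 0 := by exact_mod_cast p.succ_ne_zero
  rw [taylorCoeff, taylorCoeff, iteratedDeriv_succ', smul_smul, Nat.factorial_succ, Nat.cast_mul,
    mul_inv, Nat.cast_succ, mul_inv_cancel_left₀ hp]

lemma taylorCoeff_comp_neg (p : ℕ) (f : ℂ → E) :
    taylorCoeff p (fun z => f (-z)) = (-1 : ℂ) ^ p • taylorCoeff p f := by
  rw [taylorCoeff, iteratedDeriv_comp_neg, taylorCoeff, neg_zero, smul_comm]

lemma iteratedDeriv_smul_const (p : ℕ) {φ : ℂ → ℂ} (hφ : Differentiable ℂ φ) (v : E) (z : ℂ) :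
    iteratedDeriv p (fun z => φ z • v) z = iteratedDeriv p φ z • v := by
  induction p generalizing φ with
  | zero => simp
  | succ p ih =>
    have hderiv : deriv (fun z => φ z • v) = fun z => deriv φ z • v :=
      funext fun z => ((hφ z).hasDerivAt.smul_const v).deriv
    rw [iteratedDeriv_succ', iteratedDeriv_succ', hderiv, ih hφ.contDiff.differentiable_deriv_two]

lemma taylorCoeff_pow_smul (p i : ℕ) (v : E) :
    taylorCoeff p (fun z : ℂ => z ^ i • v) = if p = i then v else 0 := by
  rw [taylorCoeff, iteratedDeriv_smul_const p (by fun_prop), iteratedDeriv_fun_pow_zero]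
  split_ifs with h
  · subst h
    rw [inv_smul_smul₀ (by exact_mod_cast p.factorial_ne_zero)]
  · simp

lemma taylorCoeff_const_succ (p : ℕ) (v : E) : taylorCoeff (p + 1) (fun _ : ℂ => v) = 0 := by
  simpa using taylorCoeff_pow_smul (p + 1) 0 v

section Complete

variable [CompleteSpace E] [CompleteSpace V]

lemma taylorCoeff_sum_smul {ι : Type*} (s : Finset ι) (p : ℕ) (c : ι → ℂ) {f : ι → ℂ → E}
    (hf : ∀ i ∈ s, Differentiable ℂ (f i)) :
    taylorCoeff p (fun z => ∑ i ∈ s, c i • f i z) = ∑ i ∈ s, c i • taylorCoeff p (f i) := by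
  have hsum : (fun z => ∑ i ∈ s, c i • f i z) = ∑ i ∈ s, c i • f i := by
    ext z
    simp
  rw [taylorCoeff, hsum,
    iteratedDeriv_sum fun i hi => ((hf i hi).const_smul (c i)).contDiff.contDiffAt,
    Finset.smul_sum]
  refine Finset.sum_congr rfl fun i hi => ?_
  rw [iteratedDeriv_const_smul (hf i hi).contDiff.contDiffAt, smul_comm, taylorCoeff]

lemma taylorCoeff_sum_pow_smul (p n : ℕ) (v : ℕ → E) :
    taylorCoeff p (fun z : ℂ => ∑ i ∈ Finset.range n, z ^ i • v i)
      = if p < n then v p else 0 := by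
  have h := taylorCoeff_sum_smul (Finset.range n) p (fun _ => 1) (f := fun i z => z ^ i • v i)
    fun i _ => by fun_prop
  simp only [one_smul, taylorCoeff_pow_smul] at h
  simp [h]

lemma taylorCoeff_comp_const_mul (p : ℕ) {f : ℂ → E} (hf : Differentiable ℂ f) (c : ℂ) :
    taylorCoeff p (fun z => f (c * z)) = c ^ p • taylorCoeff p f := by
  rw [taylorCoeff, iteratedDeriv_comp_const_smul hf.contDiff, taylorCoeff]
  beta_reduce
  rw [mul_zero, smul_comm]

lemma taylorCoeff_mul (p : ℕ) {f g : ℂ → V} (hf : Differentiable ℂ f)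
    (hg : Differentiable ℂ g) :
    taylorCoeff p (f * g)
      = ∑ i ∈ Finset.range (p + 1), taylorCoeff i f * taylorCoeff (p - i) g := by
  have hp : (p.factorial : ℂ) ≠ 0 := by exact_mod_cast p.factorial_ne_zero
  rw [taylorCoeff, iteratedDeriv_mul hf.contDiff.contDiffAt hg.contDiff.contDiffAt,
    Finset.smul_sum]
  refine Finset.sum_congr rfl fun i hi => ?_
  rw [taylorCoeff, taylorCoeff, smul_mul_smul_comm, ← nsmul_eq_mul, ← Nat.cast_smul_eq_nsmul ℂ,
    smul_mul_assoc, smul_smul, Nat.cast_choose ℂ (Nat.lt_succ_iff.1 (Finset.mem_range.1 hi))]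
  congr 1
  field_simp

lemma norm_taylorCoeff_le {f : ℂ → E} (hf : Differentiable ℂ f) {x B : ℝ} (hx : 0 < x)
    (hB : ∀ z : ℂ, ‖z‖ ≤ x⁻¹ → ‖f z‖ ≤ B) (p : ℕ) : ‖taylorCoeff p f‖ ≤ B * x ^ p := by
  have cauchy : ‖iteratedDeriv p f 0‖ ≤ p.factorial * B / x⁻¹ ^ p :=
    Complex.norm_iteratedDeriv_le_of_forall_mem_sphere_norm_le p (inv_pos.2 hx) hf.diffContOnCl
      fun z hz => hB z (mem_sphere_zero_iff_norm.1 hz).le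
  rw [taylorCoeff, norm_smul, norm_inv, Complex.norm_natCast]
  calc (p.factorial : ℝ)⁻¹ * ‖iteratedDeriv p f 0‖
      ≤ (p.factorial : ℝ)⁻¹ * (p.factorial * B / x⁻¹ ^ p) := by gcongr
    _ = B * x ^ p := by
      rw [inv_pow, div_inv_eq_mul, mul_assoc,
        inv_mul_cancel_left₀ (by exact_mod_cast p.factorial_ne_zero)]

lemma norm_sub_sum_taylorCoeff_le {f : ℂ → E} (hf : Differentiable ℂ f) {x B : ℝ} (hx : 0 < x)
    (hx2 : x ≤ 1 / 2) (hB : ∀ z : ℂ, ‖z‖ ≤ x⁻¹ → ‖f z‖ ≤ B) (N : ℕ) :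
    ‖f 1 - ∑ p ∈ Finset.range N, taylorCoeff p f‖ ≤ 2 * B * x ^ N := by
  have hB0 : 0 ≤ B := (norm_nonneg _).trans (hB 0 (by simpa using hx.le))
  have taylor : HasSum (fun p => taylorCoeff p f) (f 1) := by
    simpa [taylorCoeff] using Complex.hasSum_taylorSeries_of_entire hf 0 1
  have geometric : HasSum (fun p => B * x ^ (p + N)) (B * x ^ N * (1 - x)⁻¹) := by
    simpa only [pow_add, mul_assoc, mul_comm (x ^ N)]
      using (hasSum_geometric_of_lt_one hx.le (by linarith)).mul_left (B * x ^ N)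
  have tail := tsum_of_norm_bounded geometric fun p => norm_taylorCoeff_le hf hx hB (p + N)
  rw [((hasSum_nat_add_iff' N).2 taylor).tsum_eq] at tail
  have hinv : (1 - x)⁻¹ ≤ 2 := by
    rw [inv_le_comm₀ (by linarith) two_pos]
    linarith
  calc ‖f 1 - ∑ p ∈ Finset.range N, taylorCoeff p f‖ ≤ B * x ^ N * (1 - x)⁻¹ := tail
    _ ≤ B * x ^ N * 2 := by gcongr
    _ = 2 * B * x ^ N := by ring

end Complete

end TaylorCoefficients

section StepProducts

variable {V : Type*} [Monoid V] {S : ℤ → ℂ → V}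

/-- `S (k - 1) z * ⋯ * S 0 z`. -/
def stepProd (S : ℤ → ℂ → V) : ℕ → ℂ → V
  | 0 => 1
  | k + 1 => S k * stepProd S k

/-- The extension of `stepProd S` to `k ∈ ℤ` by `stepProd S (-k) z = stepProd S k (-z)`. -/
def stepProdInt (S : ℤ → ℂ → V) : ℤ → ℂ → V
  | .ofNat k => stepProd S k
  | .negSucc k => fun z => stepProd S (k + 1) (-z)

/-- The step from `(r + 1) z` to `r z` undoes the step from `r z` to `(r + 1) z`. -/
def IsTimeSymmetric (S : ℤ → ℂ → V) : Prop :=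
  ∀ r z, S (-r - 1) z * S r (-z) = 1

lemma stepProdInt_neg_natCast (S : ℤ → ℂ → V) (k : ℕ) :
    stepProdInt S (-(k : ℤ)) = fun z => stepProd S k (-z) := by
  cases k <;> rfl

lemma stepProdInt_neg (S : ℤ → ℂ → V) (k : ℤ) :
    stepProdInt S (-k) = fun z => stepProdInt S k (-z) := by
  obtain ⟨m, rfl | rfl⟩ := Int.eq_nat_or_neg k
  · exact stepProdInt_neg_natCast S m
  · ext z
    simp only [neg_neg, stepProdInt_neg_natCast]
    rfl

lemma IsTimeSymmetric.stepProdInt_succ (hS : IsTimeSymmetric S) (k : ℤ) :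
    stepProdInt S (k + 1) = S k * stepProdInt S k := by
  cases k with
  | ofNat k => rfl
  | negSucc k =>
    have shift : Int.negSucc k = -(k : ℤ) - 1 := by rw [Int.negSucc_eq]; ring
    have unfold_negSucc (z : ℂ) :
        stepProdInt S (Int.negSucc k) z = S k (-z) * stepProd S k (-z) := rfl
    ext z
    rw [Pi.mul_apply, unfold_negSucc, shift, sub_add_cancel, stepProdInt_neg_natCast, ← mul_assoc,
      hS, one_mul]

lemma stepProd_apply_zero (hS : ∀ r, S r 0 = 1) (k : ℕ) : stepProd S k 0 = 1 := by
  induction k with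
  | zero => rfl
  | succ k ih => rw [stepProd, Pi.mul_apply, ih, hS, one_mul]

lemma stepProdInt_apply_zero (hS : ∀ r, S r 0 = 1) (k : ℤ) : stepProdInt S k 0 = 1 := by
  cases k with
  | ofNat k => exact stepProd_apply_zero hS k
  | negSucc k => simpa [stepProdInt] using stepProd_apply_zero hS (k + 1)

end StepProducts

section TimeSymmetricProducts

variable {V : Type*} [NormedRing V] [NormedAlgebra ℂ V]
  {A A' : ℕ → V} {f g S : ℤ → ℂ → V}

/-- Families of entire functions `f r`, `r ∈ ℤ`, with `f r 0 = 1`, whose Taylor coefficient of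
order `p + 1` is a polynomial in `r` of degree at most `p`, with coefficient `A p` in degree `p`.
In the application `f r` is a propagator over one time step starting at `r` times the step. -/
structure IsNearIdentity (A : ℕ → V) (f : ℤ → ℂ → V) : Prop where
  differentiable : ∀ r, Differentiable ℂ (f r)
  apply_zero : ∀ r, f r 0 = 1
  hasTopCoeff : ∀ p, HasTopCoeff p (A p) fun r => taylorCoeff (p + 1) (f r)

lemma IsNearIdentity.one : IsNearIdentity 0 fun _ _ => (1 : V) where
  differentiable _ := by fun_prop
  apply_zero _ := rfl
  hasTopCoeff p := (HasTopCoeff.zero p).congr rfl fun _ => taylorCoeff_const_succ p 1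

/-- `exp (z q(c z) B)` for the polynomial `q` with coefficients `a i`, `i < n`. -/
def polyExp (n : ℕ) (a : ℕ → ℂ) (B : V) (c z : ℂ) : V :=
  NormedSpace.exp ((∑ i ∈ Finset.range n, a i * c ^ i * z ^ (i + 1)) • B)

lemma polyExp_zero (n : ℕ) (a : ℕ → ℂ) (B : V) (c : ℂ) : polyExp n a B c 0 = 1 := by
  simp [polyExp]

lemma differentiable_stepProd (hS : ∀ r, Differentiable ℂ (S r)) (k : ℕ) :
    Differentiable ℂ (stepProd S k) := by
  induction k with
  | zero => exact differentiable_const (1 : V)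
  | succ k ih => exact (hS k).mul ih

lemma differentiable_stepProdInt (hS : ∀ r, Differentiable ℂ (S r)) (k : ℤ) :
    Differentiable ℂ (stepProdInt S k) := by
  cases k with
  | ofNat k => exact differentiable_stepProd hS k
  | negSucc k => exact (differentiable_stepProd hS (k + 1)).comp differentiable_neg

/-- Taylor coefficients of the solution of `u' = (∑ i, A i z ^ i) u`, `u 0 = 1`. -/
def odeCoeff (A : ℕ → V) : ℕ → V
  | 0 => 1
  | p + 1 => ((p : ℂ) + 1)⁻¹ • ∑ i : Fin (p + 1), A i * odeCoeff A (p - i)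
  decreasing_by lia

lemma succ_smul_odeCoeff_succ (A : ℕ → V) (p : ℕ) : ((p : ℂ) + 1) • odeCoeff A (p + 1)
    = ∑ i ∈ Finset.range (p + 1), A i * odeCoeff A (p - i) := by
  have hp : (p : ℂ) + 1 ≠ 0 := by exact_mod_cast p.succ_ne_zero
  rw [odeCoeff, smul_inv_smul₀ hp, Finset.sum_range fun i => A i * odeCoeff A (p - i)]

/-- The multiproduct combination of time-symmetric products. -/
def multiproduct {M : ℕ} (k : Fin M → ℕ) (a : Fin M → ℝ) (S : ℤ → ℂ → V) (z : ℂ) : V :=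
  ∑ j, (a j : ℂ) • stepProd S (k j) ((k j : ℂ)⁻¹ * z)

lemma differentiable_multiproduct {M : ℕ} (k : Fin M → ℕ) (a : Fin M → ℝ)
    (hS : ∀ r, Differentiable ℂ (S r)) : Differentiable ℂ (multiproduct k a S) :=
  .fun_sum fun j _ => .const_smul
    ((differentiable_stepProd hS (k j)).comp (differentiable_id.const_mul ((k j : ℂ)⁻¹))) (a j : ℂ)

section Complete

variable [CompleteSpace V]

namespace IsNearIdentity

lemma mul (hf : IsNearIdentity A f) (hg : IsNearIdentity A' g) :
    IsNearIdentity (A + A') (f * g) where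
  differentiable r := (hf.differentiable r).mul (hg.differentiable r)
  apply_zero r := by simp [hf.apply_zero, hg.apply_zero]
  hasTopCoeff p := by
    have cross := HasTopCoeff.sum_mul_of_lt (p := p) (g := fun q r => taylorCoeff q (g r))
      (fun i _ => hf.hasTopCoeff i) fun i _ => hg.hasTopCoeff i
    refine (((hf.hasTopCoeff p).add (hg.hasTopCoeff p)).add cross).congr (add_zero _) fun r => ?_
    rw [Pi.mul_apply, taylorCoeff_mul _ (hf.differentiable r) (hg.differentiable r),
      Finset.sum_range_succ, Finset.sum_range_succ']
    simp only [Nat.sub_zero, Nat.sub_self, taylorCoeff_zero, hf.apply_zero, hg.apply_zero,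
      one_mul, mul_one, Pi.add_apply, Finset.sum_apply, Pi.mul_apply, Nat.add_sub_add_right]
    abel

lemma list_prod {ι : Type*} {A : ι → ℕ → V} {f : ι → ℤ → ℂ → V}
    (h : ∀ i, IsNearIdentity (A i) (f i)) (l : List ι) :
    IsNearIdentity (l.map A).sum (l.map f).prod := by
  induction l with
  | nil => exact one
  | cons i l ih => simpa using (h i).mul ih

end IsNearIdentity

lemma hasDerivAt_polyExp (n : ℕ) (a : ℕ → ℂ) (B : V) (c z : ℂ) :
    HasDerivAt (polyExp n a B c)
      ((∑ i ∈ Finset.range n, z ^ i • (((i : ℂ) + 1) * (a i * c ^ i)) • B) * polyExp n a B c z)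
      z := by
  have exponent : HasDerivAt (fun z : ℂ => ∑ i ∈ Finset.range n, a i * c ^ i * z ^ (i + 1))
      (∑ i ∈ Finset.range n, a i * c ^ i * (((i + 1 : ℕ) : ℂ) * z ^ i)) z :=
    HasDerivAt.fun_sum fun i _ => (hasDerivAt_pow (i + 1) z).const_mul _
  refine ((hasDerivAt_exp_smul_const' (𝕂 := ℂ) B _).scomp z exponent).congr_deriv ?_
  rw [polyExp, ← smul_mul_assoc, Finset.sum_smul]
  congr 1
  refine Finset.sum_congr rfl fun i _ => ?_
  push_cast
  module

lemma differentiable_polyExp (n : ℕ) (a : ℕ → ℂ) (B : V) (c : ℂ) :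
    Differentiable ℂ (polyExp n a B c) :=
  fun z => (hasDerivAt_polyExp n a B c z).differentiableAt

lemma succ_smul_taylorCoeff_succ_polyExp (n : ℕ) (a : ℕ → ℂ) (B : V) (c : ℂ) (p : ℕ) :
    ((p : ℂ) + 1) • taylorCoeff (p + 1) (polyExp n a B c)
      = ∑ i ∈ Finset.range (p + 1),
          (if i < n then (((i : ℂ) + 1) * (a i * c ^ i)) • B else 0)
            * taylorCoeff (p - i) (polyExp n a B c) := by
  have hderiv : deriv (polyExp n a B c)
      = (fun z : ℂ => ∑ i ∈ Finset.range n, z ^ i • (((i : ℂ) + 1) * (a i * c ^ i)) • B)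
        * polyExp n a B c :=
    funext fun z => (hasDerivAt_polyExp n a B c z).deriv
  rw [succ_smul_taylorCoeff_succ, hderiv,
    taylorCoeff_mul p (by fun_prop) (differentiable_polyExp n a B c)]
  simp only [taylorCoeff_sum_pow_smul]

lemma isNearIdentity_polyExp (n : ℕ) (a : ℕ → ℂ) (B : V) (x : ℂ) :
    IsNearIdentity (fun i => if i < n then a i • B else 0)
      fun r => polyExp n a B ((r : ℂ) + x) where
  differentiable r := differentiable_polyExp n a B _
  apply_zero r := polyExp_zero n a B _
  hasTopCoeff p := by
    induction p using Nat.strong_induction_on with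
    | _ p ih =>
      have factor (i : ℕ) : HasTopCoeff i (if i < n then (((i : ℂ) + 1) * a i) • B else 0)
          fun r : ℤ => if i < n then (((i : ℂ) + 1) * (a i * ((r : ℂ) + x) ^ i)) • B else 0 := by
        split_ifs
        · exact (HasTopCoeff.add_pow_smul i x _).congr rfl fun r => by module
        · exact HasTopCoeff.zero i
      have lower := HasTopCoeff.sum_mul_of_lt
        (g := fun q (r : ℤ) => taylorCoeff q (polyExp n a B ((r : ℂ) + x)))
        (fun i _ => factor i) ih
      have hp : (p : ℂ) + 1 ≠ 0 := by exact_mod_cast p.succ_ne_zero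
      refine (((factor p).add lower).smul ((p : ℂ) + 1)⁻¹).congr ?_ fun r => ?_
      · split_ifs
        · rw [add_zero, smul_smul, inv_mul_cancel_left₀ hp]
        · simp
      · rw [Pi.smul_apply, eq_inv_smul_iff₀ hp, succ_smul_taylorCoeff_succ_polyExp,
          Finset.sum_range_succ, Nat.sub_self, taylorCoeff_zero, polyExp_zero, mul_one]
        simp [add_comm]

/-- The differences in `k` satisfy, to leading order in `k`, the recursion of the Taylor
coefficients of the differential equation. -/
lemma IsTimeSymmetric.hasTopCoeff_stepProdInt (hS : IsTimeSymmetric S) (hA : IsNearIdentity A S)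
    (p : ℕ) : HasTopCoeff p (odeCoeff A p) fun k => taylorCoeff p (stepProdInt S k) := by
  induction p using Nat.strong_induction_on with
  | _ p ih =>
    cases p with
    | zero =>
      refine (HasTopCoeff.const (1 : V)).congr (by rw [odeCoeff]) fun k => ?_
      rw [taylorCoeff_zero, stepProdInt_apply_zero hA.apply_zero]
    | succ p =>
      refine .of_diff ℂ ?_
      have conv : HasTopCoeff p (∑ i ∈ Finset.range (p + 1), A i * odeCoeff A (p - i))
          (∑ i ∈ Finset.range (p + 1), (fun k => taylorCoeff (i + 1) (S k))
            * fun k => taylorCoeff (p - i) (stepProdInt S k)) := by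
        refine .sum fun i hi => ?_
        have hip := Nat.lt_succ_iff.1 (Finset.mem_range.1 hi)
        simpa only [Nat.add_sub_cancel' hip]
          using (hA.hasTopCoeff i).mul (ih (p - i) (by lia))
      refine conv.congr (succ_smul_odeCoeff_succ A p).symm fun k => ?_
      rw [hS.stepProdInt_succ, taylorCoeff_mul _ (hA.differentiable k)
        (differentiable_stepProdInt hA.differentiable k), Finset.sum_range_succ']
      simp [taylorCoeff_zero, hA.apply_zero]

/-- Time symmetry makes the Taylor coefficient of order `p` of the `k`-step product a polynomial in
`k` of the parity of `p`, so that the moment conditions kill everything but its leading term. -/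
lemma IsTimeSymmetric.taylorCoeff_multiproduct (hS : IsTimeSymmetric S) (hA : IsNearIdentity A S)
    {M p : ℕ} (hM : 0 < M) (hp : p ≤ 2 * M) {k : Fin M → ℕ} {a : Fin M → ℝ} (ha : IsMPF k a) :
    taylorCoeff p (multiproduct k a S) = odeCoeff A p := by
  have moment (i : ℕ) (hi : i < M) :
      ∑ j, (a j : ℂ) * ((k j : ℂ)⁻¹) ^ (2 * i) = if i = 0 then 1 else 0 := by
    have real_moment := congrArg (fun x : ℝ => (x : ℂ)) (ha.2 i hi)
    push_cast at real_moment
    simpa only [inv_pow, apply_ite Complex.ofReal, Complex.ofReal_one, Complex.ofReal_zero]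
      using real_moment
  have step (j : Fin M) : Differentiable ℂ fun z => stepProd S (k j) ((k j : ℂ)⁻¹ * z) :=
    (differentiable_stepProd hA.differentiable (k j)).comp (differentiable_id.const_mul _)
  rw [funext (multiproduct.eq_1 k a S), taylorCoeff_sum_smul _ _ _ fun j _ => step j,
    ← (hS.hasTopCoeff_stepProdInt hA p).sum_weights_smul hM hp
    (fun j => Nat.cast_ne_zero.2 (ha.1 j).ne') moment]
  · refine Finset.sum_congr rfl fun j _ => ?_
    rw [taylorCoeff_comp_const_mul _ (differentiable_stepProd hA.differentiable _), smul_smul]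
    rfl
  · exact fun r => by rw [stepProdInt_neg, taylorCoeff_comp_neg]
  · intro hp0
    obtain ⟨q, rfl⟩ := Nat.exists_eq_succ_of_ne_zero hp0.ne'
    exact taylorCoeff_const_succ q 1

end Complete

end TimeSymmetricProducts

section NormBounds

variable {V : Type*} [NormedRing V] [NormOneClass V]

lemma norm_prod_map_le_exp {ι : Type*} {f : ι → V} {c : ι → ℝ}
    (h : ∀ i, ‖f i‖ ≤ Real.exp (c i)) (l : List ι) :
    ‖(l.map f).prod‖ ≤ Real.exp (l.map c).sum := by
  induction l with
  | nil => simp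
  | cons i l ih =>
    rw [List.map_cons, List.map_cons, List.prod_cons, List.sum_cons, Real.exp_add]
    exact (norm_mul_le _ _).trans (mul_le_mul (h i) ih (norm_nonneg _) (Real.exp_pos _).le)

lemma norm_stepProd_le {S : ℤ → ℂ → V} {C : ℝ} {z : ℂ} {k : ℕ} (h : ∀ r < k, ‖S r z‖ ≤ C) :
    ‖stepProd S k z‖ ≤ C ^ k := by
  induction k with
  | zero => simp [stepProd]
  | succ k ih =>
    have hk := h k k.lt_succ_self
    rw [stepProd, Pi.mul_apply, pow_succ']
    exact (norm_mul_le _ _).trans (mul_le_mul hk (ih fun r hr => h r (by lia)) (norm_nonneg _)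
      ((norm_nonneg _).trans hk))

variable [NormedAlgebra ℂ V]

lemma norm_exp_le (X : V) : ‖(NormedSpace.exp X : V)‖ ≤ Real.exp ‖X‖ := by
  rw [Real.exp_eq_exp_ℝ, NormedSpace.exp_eq_tsum ℂ, NormedSpace.exp_eq_tsum ℝ]
  refine tsum_of_norm_bounded (NormedSpace.expSeries_summable' (𝕂 := ℝ) ‖X‖).hasSum fun n => ?_
  rw [norm_smul, smul_eq_mul, norm_inv, Complex.norm_natCast]
  gcongr
  exact norm_pow_le X n

lemma norm_polyExp_le (n : ℕ) (a : ℕ → ℂ) (B : V) (c z : ℂ) : ‖polyExp n a B c z‖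
    ≤ Real.exp ((∑ i ∈ Finset.range n, ‖a i‖ * ‖c‖ ^ i * ‖z‖ ^ (i + 1)) * ‖B‖) := by
  refine (norm_exp_le _).trans (Real.exp_le_exp.2 ?_)
  rw [norm_smul]
  gcongr
  refine (norm_sum_le _ _).trans_eq (Finset.sum_congr rfl fun i _ => ?_)
  rw [norm_mul, norm_mul, norm_pow, norm_pow]

end NormBounds

section SymmetricStep

lemma prod_map_mul_prod_map_reverse {ι V : Type*} [Monoid V] {f g : ι → V}
    (h : ∀ i, f i * g i = 1) (l : List ι) : (l.map f).prod * (l.reverse.map g).prod = 1 := by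
  induction l with
  | nil => simp
  | cons i l ih =>
    simp only [List.map_cons, List.prod_cons, List.reverse_cons, List.map_append, List.prod_append,
      List.map_nil, List.prod_nil, mul_one]
    rw [mul_assoc, ← mul_assoc _ _ (g i), ih, one_mul, h]

/-- The order of the exponentials in one step of the second-order product formula. -/
def palindrome (L : ℕ) : List (Fin L) := List.finRange L ++ (List.finRange L).reverse

lemma reverse_palindrome (L : ℕ) : (palindrome L).reverse = palindrome L := by
  simp [palindrome]

lemma sum_map_palindrome {L : ℕ} {W : Type*} [AddCommMonoid W] (f : Fin L → W) :
    ((palindrome L).map f).sum = 2 • ∑ l, f l := by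
  rw [palindrome, List.map_append, List.sum_append, List.map_reverse, List.sum_reverse,
    ← Fin.sum_univ_def, two_nsmul]

variable {V : Type*} [NormedRing V] [NormedAlgebra ℂ V] {n L : ℕ} {a : Fin L → ℕ → ℂ}
  {B : Fin L → V}

/-- One step of the symmetric product formula of step size `z`, with coefficients evaluated at the
midpoint `(r + 1 / 2) z`. -/
def symStep (n : ℕ) {L : ℕ} (a : Fin L → ℕ → ℂ) (B : Fin L → V) : ℤ → ℂ → V :=
  ((palindrome L).map fun l (r : ℤ) => polyExp n (a l) ((1 / 2 : ℂ) • B l) ((r : ℂ) + 1 / 2)).prod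

lemma symStep_apply (n : ℕ) {L : ℕ} (a : Fin L → ℕ → ℂ) (B : Fin L → V) (r : ℤ) (z : ℂ) :
    symStep n a B r z = ((palindrome L).map
      fun l => polyExp n (a l) ((1 / 2 : ℂ) • B l) ((r : ℂ) + 1 / 2) z).prod := by
  rw [symStep, Pi.list_prod_apply, Pi.list_prod_apply, List.map_map, List.map_map]
  rfl

/-- Taylor coefficients of the generator `∑ l, p_l(z) B l` of the evolution, where `p_l` is the
polynomial with coefficients `a l i`, `i < n`. -/
def genCoeff (n : ℕ) {L : ℕ} (a : Fin L → ℕ → ℂ) (B : Fin L → V) (i : ℕ) : V :=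
  if i < n then ∑ l, a l i • B l else 0

lemma norm_genCoeff_le {x : ℝ} (hx : 0 ≤ x)
    (h : ∀ i < n, ∑ l, ‖a l i‖ * ‖B l‖ ≤ x ^ (i + 1)) (i : ℕ) :
    ‖genCoeff n a B i‖ ≤ x ^ (i + 1) := by
  rw [genCoeff]
  split_ifs with hi
  · exact (norm_sum_le _ _).trans ((Finset.sum_le_sum fun l _ => norm_smul_le _ _).trans (h i hi))
  · rw [norm_zero]
    positivity

section

variable [CompleteSpace V]

lemma isNearIdentity_symStep (n : ℕ) {L : ℕ} (a : Fin L → ℕ → ℂ) (B : Fin L → V) :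
    IsNearIdentity (genCoeff n a B) (symStep n a B) := by
  have generator : ((palindrome L).map
      fun l i => if i < n then a l i • (1 / 2 : ℂ) • B l else 0).sum = genCoeff n a B := by
    ext i
    rw [sum_map_palindrome]
    simp only [genCoeff, Pi.smul_apply, Finset.sum_apply]
    split_ifs
    · rw [Finset.smul_sum]
      refine Finset.sum_congr rfl fun l _ => ?_
      rw [← Nat.cast_smul_eq_nsmul ℂ]
      module
    · simp
  rw [← generator]
  exact .list_prod (fun l => isNearIdentity_polyExp n (a l) _ (1 / 2)) (palindrome L)

lemma polyExp_neg_mul_polyExp_neg (n : ℕ) (a : ℕ → ℂ) (B : V) (c z : ℂ) :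
    polyExp n a B (-c) z * polyExp n a B c (-z) = 1 := by
  have odd_exponent : ∑ i ∈ Finset.range n, a i * c ^ i * (-z) ^ (i + 1)
      = -∑ i ∈ Finset.range n, a i * (-c) ^ i * z ^ (i + 1) := by
    rw [← Finset.sum_neg_distrib]
    refine Finset.sum_congr rfl fun i _ => ?_
    rw [neg_pow c, neg_pow z, pow_succ]
    ring
  let _ : NormedAlgebra ℚ V := .restrictScalars ℚ ℂ V
  rw [polyExp, polyExp, odd_exponent, neg_smul,
    ← NormedSpace.exp_add_of_commute (Commute.refl _).neg_right, add_neg_cancel,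
    NormedSpace.exp_zero]

lemma isTimeSymmetric_symStep (n : ℕ) {L : ℕ} (a : Fin L → ℕ → ℂ) (B : Fin L → V) :
    IsTimeSymmetric (symStep n a B) := by
  intro r z
  have midpoint : ((-r - 1 : ℤ) : ℂ) + 1 / 2 = -((r : ℂ) + 1 / 2) := by push_cast; ring
  rw [symStep_apply, symStep_apply, midpoint]
  nth_rw 2 [← reverse_palindrome]
  exact prod_map_mul_prod_map_reverse (fun l => polyExp_neg_mul_polyExp_neg n (a l) _ _ z) _

end

variable [NormOneClass V]

lemma norm_symStep_le (n : ℕ) {L : ℕ} (a : Fin L → ℕ → ℂ) (B : Fin L → V) (r : ℤ) (z : ℂ) :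
    ‖symStep n a B r z‖ ≤ Real.exp (∑ i ∈ Finset.range n,
      ‖(r : ℂ) + 1 / 2‖ ^ i * ‖z‖ ^ (i + 1) * ∑ l, ‖a l i‖ * ‖B l‖) := by
  rw [symStep_apply]
  refine (norm_prod_map_le_exp (fun l => norm_polyExp_le n (a l) _ _ z) _).trans_eq
    (congrArg Real.exp ?_)
  rw [sum_map_palindrome]
  simp only [Finset.mul_sum, Finset.sum_mul, Finset.smul_sum]
  rw [Finset.sum_comm]
  refine Finset.sum_congr rfl fun i _ => Finset.sum_congr rfl fun l _ => ?_
  rw [norm_smul, nsmul_eq_mul, show ‖(1 / 2 : ℂ)‖ = 1 / 2 by simp]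
  push_cast
  ring

lemma norm_symStep_inv_mul_le {x : ℝ} (hx : 0 < x)
    (h : ∀ i < n, ∑ l, ‖a l i‖ * ‖B l‖ ≤ x ^ (i + 1)) {k r : ℕ} (hr : r < k) {z : ℂ}
    (hz : ‖z‖ ≤ x⁻¹) : ‖symStep n a B r ((k : ℂ)⁻¹ * z)‖ ≤ Real.exp (n / k) := by
  have hk : (0 : ℝ) < k := by exact_mod_cast (Nat.zero_le r).trans_lt hr
  have midpoint_le : ‖((r : ℤ) : ℂ) + 1 / 2‖ ≤ k := by
    have hrk : (r : ℝ) + 1 ≤ k := by exact_mod_cast hr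
    refine (norm_add_le _ _).trans ?_
    simp only [Int.cast_natCast, Complex.norm_natCast, one_div, norm_inv, Complex.norm_ofNat]
    linarith
  refine (norm_symStep_le n a B r _).trans (Real.exp_le_exp.2 ?_)
  rw [norm_mul, norm_inv, Complex.norm_natCast]
  calc ∑ i ∈ Finset.range n, ‖((r : ℤ) : ℂ) + 1 / 2‖ ^ i * ((k : ℝ)⁻¹ * ‖z‖) ^ (i + 1)
        * ∑ l, ‖a l i‖ * ‖B l‖
      ≤ ∑ i ∈ Finset.range n, (k : ℝ) ^ i * ((k : ℝ)⁻¹ * x⁻¹) ^ (i + 1) * x ^ (i + 1) := by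
        gcongr with i hi
        exact h i (Finset.mem_range.1 hi)
    _ = ∑ _i ∈ Finset.range n, (k : ℝ)⁻¹ := by
        refine Finset.sum_congr rfl fun i _ => ?_
        rw [mul_assoc, ← mul_pow, inv_mul_cancel_right₀ hx.ne', pow_succ, ← mul_assoc, ← mul_pow,
          mul_inv_cancel₀ hk.ne', one_pow, one_mul]
    _ = n / k := by rw [Finset.sum_const, Finset.card_range, nsmul_eq_mul, div_eq_mul_inv]

lemma norm_stepProd_symStep_le {x : ℝ} (hx : 0 < x)
    (h : ∀ i < n, ∑ l, ‖a l i‖ * ‖B l‖ ≤ x ^ (i + 1)) {k : ℕ} (hk : 0 < k) {z : ℂ}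
    (hz : ‖z‖ ≤ x⁻¹) : ‖stepProd (symStep n a B) k ((k : ℂ)⁻¹ * z)‖ ≤ Real.exp n := by
  have hk0 : (k : ℝ) ≠ 0 := by exact_mod_cast hk.ne'
  refine (norm_stepProd_le fun r hr => norm_symStep_inv_mul_le hx h hr hz).trans_eq ?_
  rw [← Real.exp_nat_mul, mul_div_cancel₀ _ hk0]

variable [CompleteSpace V]

lemma norm_multiproduct_sub_sum_odeCoeff_le {M : ℕ} (hM : 0 < M) {k : Fin M → ℕ} {w : Fin M → ℝ}
    (hw : IsMPF k w) {x : ℝ} (hx : 0 < x) (hx2 : x ≤ 1 / 2)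
    (h : ∀ i < 2 * M, ∑ l, ‖a l i‖ * ‖B l‖ ≤ x ^ (i + 1)) :
    ‖multiproduct k w (symStep (2 * M) a B) 1
        - ∑ p ∈ Finset.range (2 * M + 1), odeCoeff (genCoeff (2 * M) a B) p‖
      ≤ 2 * (l1norm w * Real.exp (2 * M)) * x ^ (2 * M + 1) := by
  have hA := isNearIdentity_symStep (2 * M) a B
  have taylor : ∑ p ∈ Finset.range (2 * M + 1), odeCoeff (genCoeff (2 * M) a B) p
      = ∑ p ∈ Finset.range (2 * M + 1), taylorCoeff p (multiproduct k w (symStep (2 * M) a B)) :=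
    Finset.sum_congr rfl fun p hp =>
      ((isTimeSymmetric_symStep (2 * M) a B).taylorCoeff_multiproduct hA hM
        (Nat.lt_succ_iff.1 (Finset.mem_range.1 hp)) hw).symm
  rw [taylor]
  refine norm_sub_sum_taylorCoeff_le (differentiable_multiproduct k w hA.differentiable) hx hx2
    (fun z hz => ?_) _
  refine (norm_sum_le _ _).trans ?_
  rw [l1norm, Finset.sum_mul]
  gcongr with j
  rw [norm_smul, Complex.norm_real, Real.norm_eq_abs]
  gcongr
  exact_mod_cast norm_stepProd_symStep_le hx h (hw.1 j) hz

end SymmetricStep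

section LinearODE

variable {V : Type*} [NormedRing V] [NormedAlgebra ℂ V] {A : ℕ → V} {x : ℝ}

lemma norm_sub_le_gronwallBound {F U P P' : ℝ → V} {K ε b : ℝ}
    (hF : ∀ s ∈ Set.Icc 0 b, ‖F s‖ ≤ K)
    (hU : ∀ s ∈ Set.Icc 0 b, HasDerivWithinAt U (F s * U s) (Set.Icc 0 b) s)
    (hP : ∀ s ∈ Set.Icc 0 b, HasDerivWithinAt P (P' s) (Set.Icc 0 b) s)
    (residual : ∀ s ∈ Set.Icc 0 b, ‖P' s - F s * P s‖ ≤ ε) (h0 : U 0 = P 0) {s : ℝ}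
    (hs : s ∈ Set.Icc 0 b) : ‖U s - P s‖ ≤ gronwallBound 0 K ε s := by
  have h := norm_le_gronwallBound_of_norm_deriv_right_le (f := fun s => U s - P s)
    (f' := fun s => F s * U s - P' s) (δ := 0) (K := K) (ε := ε)
    (fun s hs => ((hU s hs).sub (hP s hs)).continuousWithinAt)
    (fun s hs => ((hU s (Set.Ico_subset_Icc_self hs)).sub
      (hP s (Set.Ico_subset_Icc_self hs))).mono_of_mem_nhdsWithin (Icc_mem_nhdsGE_of_mem hs))
    (by simp [h0]) (fun s hs => ?_) s hs
  · rwa [sub_zero] at h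
  · have hs := Set.Ico_subset_Icc_self hs
    calc ‖F s * U s - P' s‖ = ‖F s * (U s - P s) - (P' s - F s * P s)‖ := by
          rw [mul_sub]; congr 1; abel
      _ ≤ K * ‖U s - P s‖ + ε := (norm_sub_le _ _).trans <| add_le_add
          ((norm_mul_le _ _).trans (mul_le_mul_of_nonneg_right (hF s hs) (norm_nonneg _)))
          (residual s hs)

/-- `∑ i < n, u i s ^ i` for real `s`. -/
def polyCurve (n : ℕ) (u : ℕ → V) (s : ℝ) : V := ∑ i ∈ Finset.range n, (s : ℂ) ^ i • u i

lemma norm_ofReal_pow_smul_le {s : ℝ} (hs : s ∈ Set.Icc (0 : ℝ) 1) (m : ℕ) (v : V) :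
    ‖(s : ℂ) ^ m • v‖ ≤ ‖v‖ := by
  rw [norm_smul, norm_pow, Complex.norm_real, Real.norm_of_nonneg hs.1]
  exact mul_le_of_le_one_left (norm_nonneg v) (pow_le_one₀ hs.1 hs.2)

lemma norm_polyCurve_le (hx : 0 ≤ x) (hx2 : x ≤ 1 / 2) {C : ℝ} (hC : 0 ≤ C) {u : ℕ → V}
    (h : ∀ i, ‖u i‖ ≤ C * x ^ i) (n : ℕ) {s : ℝ} (hs : s ∈ Set.Icc (0 : ℝ) 1) :
    ‖polyCurve n u s‖ ≤ C * 2 := by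
  calc ‖polyCurve n u s‖ ≤ ∑ i ∈ Finset.range n, C * x ^ i :=
        (norm_sum_le _ _).trans
          (Finset.sum_le_sum fun i _ => (norm_ofReal_pow_smul_le hs i _).trans (h i))
    _ = C * ∑ i ∈ Finset.range n, x ^ i := (Finset.mul_sum _ _ _).symm
    _ ≤ C * (1 - x)⁻¹ := by
        rw [← tsum_geometric_of_lt_one hx (by linarith)]
        exact mul_le_mul_of_nonneg_left ((summable_geometric_of_lt_one hx
          (by linarith)).sum_le_tsum _ fun i _ => by positivity) hC
    _ ≤ C * 2 := by
        gcongr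
        rw [inv_le_comm₀ (by linarith) two_pos]
        linarith

lemma hasDerivAt_polyCurve (n : ℕ) (u : ℕ → V) (s : ℝ) :
    HasDerivAt (polyCurve (n + 1) u) (polyCurve n (fun p => ((p : ℂ) + 1) • u (p + 1)) s) s := by
  have monomial (p : ℕ) : HasDerivAt (fun s : ℝ => (s : ℂ) ^ p • u p)
      (((p : ℂ) * (s : ℂ) ^ (p - 1)) • u p) s :=
    (hasDerivAt_pow p (s : ℂ)).comp_ofReal.smul_const (u p)
  refine (HasDerivAt.fun_sum fun p _ => monomial p).congr_deriv ?_
  simp [Finset.sum_range_succ', polyCurve, smul_smul, mul_comm]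

lemma gronwallBound_zero_two_one_le {ε : ℝ} (hε : 0 ≤ ε) : gronwallBound 0 2 ε 1 ≤ 4 * ε := by
  have hexp : Real.exp (2 * 1) ≤ 9 := by
    rw [mul_one, ← one_add_one_eq_two, Real.exp_add]
    nlinarith [Real.exp_pos 1, Real.exp_one_lt_three]
  rw [gronwallBound_of_K_ne_0 two_ne_zero]
  calc 0 * Real.exp (2 * 1) + ε / 2 * (Real.exp (2 * 1) - 1) ≤ 0 + ε / 2 * (9 - 1) := by
        rw [zero_mul]
        gcongr
    _ = 4 * ε := by ring

variable [NormOneClass V]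

lemma norm_odeCoeff_le (hx : 0 ≤ x) (h : ∀ i, ‖A i‖ ≤ x ^ (i + 1)) (p : ℕ) :
    ‖odeCoeff A p‖ ≤ x ^ p := by
  induction p using Nat.strong_induction_on with
  | _ p ih =>
    cases p with
    | zero => simp [odeCoeff]
    | succ p =>
      have recursion := congrArg norm (succ_smul_odeCoeff_succ A p)
      rw [norm_smul, ← Nat.cast_succ, Complex.norm_natCast] at recursion
      refine le_of_mul_le_mul_left (recursion.trans_le ?_) (Nat.cast_pos.2 p.succ_pos)
      calc ‖∑ i ∈ Finset.range (p + 1), A i * odeCoeff A (p - i)‖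
          ≤ ∑ i ∈ Finset.range (p + 1), x ^ (i + 1) * x ^ (p - i) := by
            refine (norm_sum_le _ _).trans (Finset.sum_le_sum fun i _ => ?_)
            exact (norm_mul_le _ _).trans
              (mul_le_mul (h i) (ih _ (by lia)) (norm_nonneg _) (by positivity))
        _ = ∑ _i ∈ Finset.range (p + 1), x ^ (p + 1) := by
            refine Finset.sum_congr rfl fun i hi => ?_
            rw [← pow_add, show i + 1 + (p - i) = p + 1 by have := Finset.mem_range.1 hi; lia]
        _ = (p.succ : ℝ) * x ^ (p + 1) := by simp

lemma norm_ode_residual_le (hx : 0 ≤ x) (hx1 : x ≤ 1) (h : ∀ i, ‖A i‖ ≤ x ^ (i + 1)) (n : ℕ)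
    {s : ℝ} (hs : s ∈ Set.Icc (0 : ℝ) 1) :
    ‖polyCurve n (fun p => ((p : ℂ) + 1) • odeCoeff A (p + 1)) s
      - polyCurve n A s * polyCurve (n + 1) (odeCoeff A) s‖ ≤ n * (n + 1) * x ^ (n + 1) := by
  let g (i q : ℕ) : V := (s : ℂ) ^ (i + q) • (A i * odeCoeff A q)
  have derivative_eq : polyCurve n (fun p => ((p : ℂ) + 1) • odeCoeff A (p + 1)) s
      = ∑ i ∈ Finset.range n, ∑ q ∈ Finset.range (n - i), g i q := by
    rw [← Finset.sum_range_diag_flip]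
    refine Finset.sum_congr rfl fun p _ => ?_
    beta_reduce
    rw [succ_smul_odeCoeff_succ, Finset.smul_sum]
    refine Finset.sum_congr rfl fun i hi => ?_
    simp only [g, Nat.add_sub_cancel' (Nat.lt_succ_iff.1 (Finset.mem_range.1 hi))]
  have product_eq : polyCurve n A s * polyCurve (n + 1) (odeCoeff A) s
      = ∑ i ∈ Finset.range n, ∑ q ∈ Finset.range (n + 1), g i q := by
    simp only [polyCurve, Finset.sum_mul_sum, smul_mul_smul_comm, ← pow_add, g]
  have term_le (i q : ℕ) (hq : q ∈ Finset.Ico (n - i) (n + 1)) : ‖g i q‖ ≤ x ^ (n + 1) := by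
    calc ‖g i q‖ ≤ x ^ (i + 1) * x ^ q :=
          (norm_ofReal_pow_smul_le hs _ _).trans <| (norm_mul_le _ _).trans
            (mul_le_mul (h i) (norm_odeCoeff_le hx h q) (norm_nonneg _) (by positivity))
      _ ≤ x ^ (n + 1) := by
          rw [← pow_add]
          exact pow_le_pow_of_le_one hx hx1 (by have := (Finset.mem_Ico.1 hq).1; lia)
  have tail_le (i : ℕ) : ‖∑ q ∈ Finset.range (n - i), g i q - ∑ q ∈ Finset.range (n + 1), g i q‖
      ≤ (n + 1) * x ^ (n + 1) := by
    rw [norm_sub_rev, ← Finset.sum_Ico_eq_sub _ (show n - i ≤ n + 1 by lia)]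
    refine (norm_sum_le_of_le _ (term_le i)).trans ?_
    rw [Finset.sum_const, nsmul_eq_mul, Nat.card_Ico]
    gcongr
    exact_mod_cast Nat.sub_le _ _
  rw [derivative_eq, product_eq, ← Finset.sum_sub_distrib]
  refine (norm_sum_le_of_le _ fun i _ => tail_le i).trans_eq ?_
  rw [Finset.sum_const, Finset.card_range, nsmul_eq_mul, mul_assoc]

theorem norm_ode_sub_sum_odeCoeff_le (hx : 0 ≤ x) (hx2 : x ≤ 1 / 2)
    (h : ∀ i, ‖A i‖ ≤ x ^ (i + 1)) (n : ℕ) {F U : ℝ → V}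
    (hF : ∀ s ∈ Set.Icc (0 : ℝ) 1, ‖F s - polyCurve n A s‖ ≤ x ^ (n + 1))
    (hU : ∀ s ∈ Set.Icc (0 : ℝ) 1, HasDerivWithinAt U (F s * U s) (Set.Icc 0 1) s)
    (hU0 : U 0 = 1) :
    ‖U 1 - ∑ p ∈ Finset.range (n + 1), odeCoeff A p‖ ≤ 4 * ((n * (n + 1) + 2) * x ^ (n + 1)) := by
  set P : ℝ → V := polyCurve (n + 1) (odeCoeff A) with hP
  have generator_le (s : ℝ) (hs : s ∈ Set.Icc (0 : ℝ) 1) : ‖F s‖ ≤ 2 := by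
    have poly_le : ‖polyCurve n A s‖ ≤ x * 2 :=
      norm_polyCurve_le hx hx2 hx (fun i => (h i).trans_eq (pow_succ' x i)) n hs
    calc ‖F s‖ ≤ ‖F s - polyCurve n A s‖ + ‖polyCurve n A s‖ := norm_le_norm_sub_add _ _
      _ ≤ 1 + 1 := add_le_add ((hF s hs).trans (pow_le_one₀ hx (by linarith)))
          (poly_le.trans (by linarith))
      _ = 2 := one_add_one_eq_two
  have residual (s : ℝ) (hs : s ∈ Set.Icc (0 : ℝ) 1) :
      ‖polyCurve n (fun p => ((p : ℂ) + 1) • odeCoeff A (p + 1)) s - F s * P s‖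
        ≤ (n * (n + 1) + 2) * x ^ (n + 1) := by
    have solution_le : ‖P s‖ ≤ 1 * 2 := norm_polyCurve_le hx hx2 zero_le_one
      (fun i => (norm_odeCoeff_le hx h i).trans_eq (one_mul _).symm) _ hs
    have approx : ‖(F s - polyCurve n A s) * P s‖ ≤ x ^ (n + 1) * (1 * 2) :=
      (norm_mul_le _ _).trans (mul_le_mul (hF s hs) solution_le (norm_nonneg _) (by positivity))
    rw [show ∀ Y : V, Y - F s * P s = (Y - polyCurve n A s * P s) - (F s - polyCurve n A s) * P s
      from fun Y => by rw [sub_mul]; abel]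
    exact (norm_sub_le _ _).trans
      (by linarith [norm_ode_residual_le hx (hx2.trans (by norm_num)) h n hs])
  have P_zero : P 0 = 1 := by simp [hP, polyCurve, Finset.sum_range_succ', odeCoeff]
  have P_one : P 1 = ∑ p ∈ Finset.range (n + 1), odeCoeff A p := by simp [hP, polyCurve]
  rw [← P_one]
  exact (norm_sub_le_gronwallBound generator_le hU
    (fun s _ => (hasDerivAt_polyCurve n _ s).hasDerivWithinAt) residual (by rw [hU0, P_zero])
    (Set.right_mem_Icc.2 zero_le_one)).trans (gronwallBound_zero_two_one_le (by positivity))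

end LinearODE

section WellConditioned

lemma prod_range_erase_abs_sub {R : Type*} [CommMonoid R] (g : ℝ → R) {M j : ℕ} (hj : j < M) :
    ∏ i ∈ (Finset.range M).erase j, g |(i : ℝ) - j|
      = (∏ d ∈ Finset.range j, g (d + 1)) * ∏ d ∈ Finset.range (M - 1 - j), g (d + 1) := by
  have split : (Finset.range M).erase j
      = Finset.range j ∪ (Finset.range (M - 1 - j)).map (addLeftEmbedding (j + 1)) := by
    ext i
    simp only [Finset.mem_erase, Finset.mem_range, Finset.mem_union, Finset.mem_map,
      addLeftEmbedding_apply]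
    constructor
    · rintro ⟨hne, hi⟩
      rcases lt_or_gt_of_ne hne with h | h
      · exact .inl h
      · exact .inr ⟨i - (j + 1), by lia, by lia⟩
    · rintro (h | ⟨d, hd, rfl⟩) <;> lia
  have disjoint : Disjoint (Finset.range j)
      ((Finset.range (M - 1 - j)).map (addLeftEmbedding (j + 1))) := by
    simp only [Finset.disjoint_left, Finset.mem_range, Finset.mem_map, addLeftEmbedding_apply]
    rintro i hi ⟨d, -, rfl⟩
    lia
  rw [split, Finset.prod_union disjoint, Finset.prod_map, ← Finset.prod_range_reflect]
  refine congrArg₂ _ (Finset.prod_congr rfl fun d hd => congrArg g ?_)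
    (Finset.prod_congr rfl fun d _ => congrArg g ?_)
  · have hdj : d + 1 ≤ j := Finset.mem_range.1 hd
    rw [Nat.sub_sub, add_comm 1 d, Nat.cast_sub hdj, sub_sub_cancel_left, abs_neg, Nat.abs_cast]
    push_cast
    rfl
  · rw [addLeftEmbedding_apply, Nat.add_right_comm, Nat.add_assoc, Nat.cast_add,
      add_sub_cancel_left, Nat.abs_cast]
    push_cast
    rw [add_comm]

lemma sum_range_erase_abs_sub {R : Type*} [AddCommMonoid R] (g : ℝ → R) {M j : ℕ} (hj : j < M) :
    ∑ i ∈ (Finset.range M).erase j, g |(i : ℝ) - j|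
      = ∑ d ∈ Finset.range j, g (d + 1) + ∑ d ∈ Finset.range (M - 1 - j), g (d + 1) :=
  prod_range_erase_abs_sub (R := Multiplicative R) g hj

lemma prod_range_erase_abs_sub_eq_factorial {M j : ℕ} (hj : j < M) :
    ∏ i ∈ (Finset.range M).erase j, |(i : ℝ) - j| = j.factorial * (M - 1 - j).factorial := by
  rw [prod_range_erase_abs_sub (fun x => x) hj, ← Finset.prod_range_add_one_eq_factorial,
    ← Finset.prod_range_add_one_eq_factorial]
  push_cast
  rfl

lemma sum_range_inv_succ_le {n M : ℕ} (h : n ≤ M) :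
    ∑ i ∈ Finset.range n, ((i : ℝ) + 1)⁻¹ ≤ 1 + Real.log M := by
  have harmonic_le := harmonic_le_one_add_log M
  rw [harmonic] at harmonic_le
  push_cast at harmonic_le
  exact (Finset.sum_le_sum_of_subset_of_nonneg (Finset.range_mono h)
    fun i _ _ => by positivity).trans harmonic_le

lemma sum_range_erase_inv_abs_sub_le {M j : ℕ} (hj : j < M) :
    ∑ i ∈ (Finset.range M).erase j, |(i : ℝ) - j|⁻¹ ≤ 2 * (1 + Real.log M) := by
  rw [sum_range_erase_abs_sub (fun x => x⁻¹) hj, two_mul]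
  exact add_le_add (sum_range_inv_succ_le hj.le) (sum_range_inv_succ_le (by lia))

lemma prod_range_add_mul_factorial (M j : ℕ) :
    (∏ i ∈ Finset.range M, ((i : ℝ) + j + 1)) * j.factorial = (M + j).factorial := by
  rw [add_comm M, ← Nat.factorial_mul_ascFactorial, Nat.ascFactorial_eq_prod_range, mul_comm]
  push_cast
  congr 1
  exact Finset.prod_congr rfl fun i _ => by ring

lemma abs_odd_sq_sub_odd_sq (i j : ℕ) :
    |(2 * (i : ℝ) + 1) ^ 2 - (2 * (j : ℝ) + 1) ^ 2| = 4 * (|(i : ℝ) - j| * (i + j + 1)) := by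
  rw [show (2 * (i : ℝ) + 1) ^ 2 - (2 * (j : ℝ) + 1) ^ 2 = 4 * ((i - j) * (i + j + 1)) by ring,
    abs_mul, abs_mul, abs_of_pos four_pos, abs_of_pos (by positivity : (0 : ℝ) < i + j + 1)]

lemma prod_abs_odd_sq_sub_odd_sq {m j : ℕ} (hj : j < m + 1) :
    (∏ i ∈ (Finset.range (m + 1)).erase j, |(2 * (i : ℝ) + 1) ^ 2 - (2 * (j : ℝ) + 1) ^ 2|)
        * (2 * (j : ℝ) + 1)
      = 4 ^ m * ((m - j).factorial * (m + 1 + j).factorial) := by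
  have hjm := Finset.mem_range.2 hj
  rw [← prod_range_add_mul_factorial, ← Finset.mul_prod_erase _ _ hjm,
    Finset.prod_congr rfl fun i _ => abs_odd_sq_sub_odd_sq i j, Finset.prod_mul_distrib,
    Finset.prod_mul_distrib, prod_range_erase_abs_sub_eq_factorial hj, Finset.prod_const,
    Finset.card_erase_of_mem hjm, Finset.card_range, Nat.add_sub_cancel]
  ring

-- The factor `2 - 1 / (m + 1)` instead of `2` is what makes the induction close.
lemma prod_odd_sq_le (m : ℕ) : ∏ i ∈ Finset.range (m + 1), (2 * (i : ℝ) + 1) ^ 2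
    ≤ (2 - 1 / ((m : ℝ) + 1)) * (4 ^ m * (m.factorial * (m + 1).factorial)) := by
  induction m with
  | zero => norm_num
  | succ m ih =>
    have factor_le : (2 - 1 / ((m : ℝ) + 1)) * (2 * ((m : ℝ) + 1) + 1) ^ 2
        ≤ (2 - 1 / ((m : ℝ) + 1 + 1)) * (4 * ((m + 1) * (m + 1 + 1))) := by
      have left : 2 - 1 / ((m : ℝ) + 1) = (2 * m + 1) / (m + 1) := by field_simp; ring
      have right : (2 - 1 / ((m : ℝ) + 1 + 1)) * (4 * ((m + 1) * (m + 1 + 1)))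
          = (2 * m + 3) * (4 * (m + 1)) := by field_simp; ring
      rw [left, right, div_mul_eq_mul_div, div_le_iff₀ (by positivity)]
      nlinarith [(Nat.cast_nonneg m : (0 : ℝ) ≤ m)]
    have scaled := mul_le_mul_of_nonneg_right factor_le
      (show (0 : ℝ) ≤ 4 ^ m * (m.factorial * (m + 1).factorial) by positivity)
    rw [Finset.prod_range_succ, Nat.factorial_succ (m + 1), Nat.factorial_succ m]
    rw [Nat.factorial_succ m] at ih scaled
    push_cast at ih scaled ⊢
    refine (mul_le_mul_of_nonneg_right ih (by positivity)).trans ?_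
    convert scaled using 1 <;> ring

lemma factorial_mul_factorial_le {m j : ℕ} (hj : j < m + 1) :
    (m.factorial : ℝ) * (m + 1).factorial ≤ Real.exp (-(j * (j + 1) / (2 * (m + 1))))
      * ((m - j).factorial * (m + 1 + j).factorial) := by
  induction j with
  | zero => simp
  | succ j ih =>
    obtain ⟨q, rfl⟩ : ∃ q, m = j + 1 + q := Nat.exists_eq_add_of_le (Nat.le_of_lt_succ hj)
    have ratio_le : (q : ℝ) + 1
        ≤ Real.exp (-((j + 1) / (j + 1 + q + 1))) * (j + 1 + q + 1 + j + 1) := by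
      calc (q : ℝ) + 1 = (-((j + 1) / (j + 1 + q + 1)) + 1) * (j + 1 + q + 1) := by
            field_simp
            ring
        _ ≤ Real.exp (-((j + 1) / (j + 1 + q + 1))) * (j + 1 + q + 1) := by
            gcongr
            exact Real.add_one_le_exp _
        _ ≤ _ := by
            refine mul_le_mul_of_nonneg_left ?_ (Real.exp_pos _).le
            linarith [(Nat.cast_nonneg j : (0 : ℝ) ≤ j)]
    have exp_split : Real.exp (-((j + 1) * (j + 1 + 1) / (2 * (j + 1 + q + 1))))
        = Real.exp (-(j * (j + 1) / (2 * ((j : ℝ) + 1 + q + 1))))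
          * Real.exp (-((j + 1) / (j + 1 + q + 1))) := by
      rw [← Real.exp_add]
      congr 1
      field_simp
      ring
    refine (ih (by lia)).trans ?_
    rw [show j + 1 + q - j = q + 1 by lia, show j + 1 + q - (j + 1) = q by lia,
      ← Nat.add_assoc _ j 1, Nat.factorial_succ q, Nat.factorial_succ (j + 1 + q + 1 + j)]
    push_cast
    rw [exp_split]
    have scaled := mul_le_mul_of_nonneg_left ratio_le
      (show 0 ≤ Real.exp (-(j * (j + 1) / (2 * ((j : ℝ) + 1 + q + 1))))
        * (q.factorial * (j + 1 + q + 1 + j).factorial) by positivity)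
    convert scaled using 1 <;> ring

lemma prod_odd_sq_div_abs_sub_le {M j : ℕ} (hj : j < M) :
    ∏ i ∈ (Finset.range M).erase j,
        ((2 * (i : ℝ) + 1) ^ 2 / |(2 * (i : ℝ) + 1) ^ 2 - (2 * (j : ℝ) + 1) ^ 2|)
      ≤ 2 / (2 * (j : ℝ) + 1) * Real.exp (-(j * (j + 1) / (2 * M))) := by
  obtain ⟨m, rfl⟩ : ∃ m, M = m + 1 := Nat.exists_eq_add_one.2 (Nat.zero_lt_of_lt hj)
  have numerator := prod_odd_sq_le m
  rw [← Finset.mul_prod_erase _ _ (Finset.mem_range.2 hj)] at numerator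
  have denominator := prod_abs_odd_sq_sub_odd_sq hj
  rw [Finset.prod_div_distrib, eq_div_of_mul_eq (by positivity) denominator,
    div_le_iff₀ (by positivity)]
  push_cast
  set X := ∏ i ∈ (Finset.range (m + 1)).erase j, (2 * (i : ℝ) + 1) ^ 2
  set E := Real.exp (-(j * (j + 1) / (2 * ((m : ℝ) + 1))))
  set G : ℝ := (m - j).factorial * (m + 1 + j).factorial
  have numerator_le : (2 * (j : ℝ) + 1) ^ 2 * X ≤ 2 * (4 ^ m * (E * G)) :=
    numerator.trans (mul_le_mul (sub_le_self 2 (by positivity))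
      (mul_le_mul_of_nonneg_left (factorial_mul_factorial_le hj) (by positivity))
      (by positivity) zero_le_two)
  rw [show 2 / (2 * (j : ℝ) + 1) * E * (4 ^ m * G / (2 * j + 1))
      = 2 * (4 ^ m * (E * G)) / (2 * (j : ℝ) + 1) ^ 2 by field_simp, le_div_iff₀' (by positivity)]
  exact numerator_le

/-- The step numbers are the integer parts of `3 M ^ 2 / (2 j + 1)`, the reciprocals of the first
odd numbers rescaled so that rounding hardly changes their ratios. -/
def mpfStep (M j : ℕ) : ℕ := 3 * M ^ 2 / (2 * j + 1)

lemma mpfStep_le (M j : ℕ) : mpfStep M j ≤ 3 * M ^ 2 := Nat.div_le_self _ _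

lemma mpfStep_pos {M j : ℕ} (hj : j < M) : 0 < mpfStep M j :=
  Nat.div_pos (by nlinarith) (by lia)

lemma cast_mpfStep_le (M j : ℕ) : (mpfStep M j : ℝ) ≤ 3 * M ^ 2 / (2 * j + 1) :=
  Nat.cast_div_le.trans_eq (by push_cast; rfl)

lemma lt_cast_mpfStep_add_one (M j : ℕ) : 3 * (M : ℝ) ^ 2 / (2 * j + 1) < mpfStep M j + 1 := by
  rw [div_lt_iff₀' (by positivity)]
  exact_mod_cast Nat.lt_mul_div_succ (3 * M ^ 2) (show 0 < 2 * j + 1 by lia)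

lemma abs_sub_le_abs_sub_add_one {k k' x x' : ℝ} (hk : k ≤ x) (hx : x ≤ k + 1) (hk' : k' ≤ x')
    (hx' : x' ≤ k' + 1) : |x - x'| ≤ |k - k'| + 1 := by
  have upper := le_abs_self (k - k')
  have lower := neg_abs_le (k - k')
  exact abs_le.2 ⟨by linarith, by linarith⟩

lemma mul_abs_sub_le_abs_mpfStep_sub {M i j : ℕ} (hi : i < M) (hj : j < M) (hij : i ≠ j) :
    (M : ℝ) * |(i : ℝ) - j| / (2 * j + 1) ≤ |(mpfStep M i : ℝ) - mpfStep M j| := by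
  have hi' : 2 * (i : ℝ) + 1 ≤ 2 * M := by exact_mod_cast (show 2 * i + 1 ≤ 2 * M by lia)
  have hj' : 2 * (j : ℝ) + 1 ≤ 2 * M := by exact_mod_cast (show 2 * j + 1 ≤ 2 * M by lia)
  have one_le : (1 : ℝ) ≤ |(i : ℝ) - j| := by
    exact_mod_cast Int.one_le_abs (sub_ne_zero.2 (Nat.cast_injective.ne hij : (i : ℤ) ≠ j))
  have hM : (0 : ℝ) < M := by exact_mod_cast (Nat.zero_le j).trans_lt hj
  have rounding := abs_sub_le_abs_sub_add_one (cast_mpfStep_le M i)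
    (lt_cast_mpfStep_add_one M i).le (cast_mpfStep_le M j) (lt_cast_mpfStep_add_one M j).le
  have node_sub : |3 * (M : ℝ) ^ 2 / (2 * i + 1) - 3 * M ^ 2 / (2 * j + 1)|
      = 6 * M ^ 2 * |(i : ℝ) - j| / ((2 * i + 1) * (2 * j + 1)) := by
    rw [div_sub_div _ _ (by positivity) (by positivity), abs_div,
      abs_of_pos (by positivity : (0 : ℝ) < (2 * i + 1) * (2 * j + 1)), abs_sub_comm (i : ℝ),
      ← abs_of_nonneg (by positivity : (0 : ℝ) ≤ 6 * M ^ 2), ← abs_mul]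
    congr 2
    ring
  have three_gaps_le : 3 * (M * |(i : ℝ) - j| / (2 * j + 1))
      ≤ 6 * M ^ 2 * |(i : ℝ) - j| / ((2 * i + 1) * (2 * j + 1)) := by
    rw [le_div_iff₀ (by positivity)]
    calc 3 * (M * |(i : ℝ) - j| / (2 * j + 1)) * ((2 * i + 1) * (2 * j + 1))
        = 3 * (M * |(i : ℝ) - j|) * (2 * i + 1) := by field_simp
      _ ≤ 3 * (M * |(i : ℝ) - j|) * (2 * M) := by gcongr
      _ = 6 * M ^ 2 * |(i : ℝ) - j| := by ring
  have node_gap : 3 / 2 ≤ 6 * M ^ 2 * |(i : ℝ) - j| / ((2 * i + 1) * (2 * j + 1)) := by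
    rw [le_div_iff₀ (by positivity)]
    calc 3 / 2 * ((2 * (i : ℝ) + 1) * (2 * j + 1)) ≤ 3 / 2 * (2 * M * (2 * M)) := by gcongr
      _ = 6 * M ^ 2 * 1 := by ring
      _ ≤ 6 * M ^ 2 * |(i : ℝ) - j| := by gcongr
  linarith

lemma cast_mpfStep_injective (M : ℕ) : Function.Injective fun j : Fin M => (mpfStep M j : ℝ) := by
  intro i j h
  by_contra hne
  have hij : (i : ℕ) ≠ j := fun h => hne (Fin.ext h)
  have gap := mul_abs_sub_le_abs_mpfStep_sub i.2 j.2 hij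
  have hM : (0 : ℝ) < M := by exact_mod_cast (Nat.zero_le _).trans_lt i.2
  have abs_pos : 0 < |((i : ℕ) : ℝ) - (j : ℕ)| := abs_sub_pos.2 (Nat.cast_injective.ne hij)
  rw [sub_eq_zero.2 h, abs_zero] at gap
  exact absurd gap (not_le.2 (by positivity))

-- Rounding moves the difference of the nodes by at most `1` and their sum by at most `2`.
lemma sq_div_abs_sq_sub_sq_le_mul_exp {k k' x x' : ℝ} (hk : 0 < k) (hk' : 0 < k') (hkx : k ≤ x)
    (hx : x ≤ k + 1) (hkx' : k' ≤ x') (hx' : x' ≤ k' + 1) (hne : k' ≠ k) (hxne : x' ≠ x) :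
    k ^ 2 / |k' ^ 2 - k ^ 2|
      ≤ x ^ 2 / |x' ^ 2 - x ^ 2| * Real.exp (3 * |k' - k|⁻¹) := by
  set d := |k' - k|
  set s := k' + k
  have hd : 0 < d := abs_sub_pos.2 hne
  have hds : d ≤ s := abs_le.2 ⟨by linarith, by linarith⟩
  have hs : 0 < s := hd.trans_le hds
  have sq_sub : |k' ^ 2 - k ^ 2| = d * s := by
    rw [sq_sub_sq, abs_mul, mul_comm, abs_of_pos hs]
  have sq_sub_le : |x' ^ 2 - x ^ 2| ≤ (d + 1) * (s + 2) := by
    rw [sq_sub_sq, abs_mul, mul_comm, abs_of_pos (by linarith : 0 < x' + x)]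
    exact mul_le_mul (abs_sub_le_abs_sub_add_one hkx' hx' hkx hx) (by linarith) (by linarith)
      (by positivity)
  have sq_sub_pos : 0 < |x' ^ 2 - x ^ 2| := by
    rw [sq_sub_sq, abs_mul]
    exact mul_pos (abs_pos.2 (by linarith)) (abs_sub_pos.2 hxne)
  have factor_le : (1 + 1 / d) * (1 + 2 / s) ≤ Real.exp (3 * d⁻¹) := by
    calc (1 + 1 / d) * (1 + 2 / s) ≤ (1 / d + 1) * (2 / d + 1) := by
          rw [add_comm 1, add_comm 1]
          gcongr
      _ ≤ Real.exp (1 / d) * Real.exp (2 / d) := by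
          gcongr <;> exact Real.add_one_le_exp _
      _ = Real.exp (3 * d⁻¹) := by
          rw [← Real.exp_add]
          ring_nf
  calc k ^ 2 / |k' ^ 2 - k ^ 2| ≤ x ^ 2 / (d * s) := by
        rw [sq_sub]
        gcongr
    _ = x ^ 2 / ((d + 1) * (s + 2)) * ((1 + 1 / d) * (1 + 2 / s)) := by field_simp
    _ ≤ x ^ 2 / |x' ^ 2 - x ^ 2| * Real.exp (3 * d⁻¹) := by gcongr

lemma div_sq_div_abs_sub_eq {c p q : ℝ} (hc : 0 < c) (hp : 0 < p) (hq : 0 < q) :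
    (c / q) ^ 2 / |(c / p) ^ 2 - (c / q) ^ 2| = p ^ 2 / |p ^ 2 - q ^ 2| := by
  have difference : (c / p) ^ 2 - (c / q) ^ 2 = (c / (p * q)) ^ 2 * (q ^ 2 - p ^ 2) := by
    field_simp
  rw [difference, abs_mul, abs_of_pos (by positivity : 0 < (c / (p * q)) ^ 2), abs_sub_comm,
    ← mul_div_mul_left (p ^ 2) |p ^ 2 - q ^ 2| (by positivity : (c / (p * q)) ^ 2 ≠ 0)]
  congr 1
  field_simp

lemma mpfStep_sq_div_abs_sub_le {M i j : ℕ} (hi : i < M) (hj : j < M) (hij : i ≠ j) :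
    (mpfStep M j : ℝ) ^ 2 / |(mpfStep M i : ℝ) ^ 2 - (mpfStep M j : ℝ) ^ 2|
      ≤ (2 * (i : ℝ) + 1) ^ 2 / |(2 * (i : ℝ) + 1) ^ 2 - (2 * (j : ℝ) + 1) ^ 2|
        * Real.exp (3 * (2 * j + 1) / M * |(i : ℝ) - j|⁻¹) := by
  have hM : (0 : ℝ) < M := by exact_mod_cast (Nat.zero_le j).trans_lt hj
  have gap_pos : 0 < (M : ℝ) * |(i : ℝ) - j| / (2 * j + 1) :=
    div_pos (mul_pos hM (abs_sub_pos.2 (Nat.cast_injective.ne hij))) (by positivity)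
  have gap := mul_abs_sub_le_abs_mpfStep_sub hi hj hij
  have steps_ne : (mpfStep M i : ℝ) ≠ mpfStep M j := abs_sub_pos.1 (gap_pos.trans_le gap)
  have nodes_ne : 3 * (M : ℝ) ^ 2 / (2 * i + 1) ≠ 3 * M ^ 2 / (2 * j + 1) := by
    rw [Ne, div_eq_mul_inv, div_eq_mul_inv, mul_right_inj' (by positivity), inv_inj]
    exact_mod_cast show 2 * i + 1 ≠ 2 * j + 1 by lia
  rw [← div_sq_div_abs_sub_eq (by positivity : 0 < 3 * (M : ℝ) ^ 2) (by positivity)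
    (by positivity)]
  refine (sq_div_abs_sq_sub_sq_le_mul_exp (by exact_mod_cast mpfStep_pos hj)
    (by exact_mod_cast mpfStep_pos hi) (cast_mpfStep_le M j) (lt_cast_mpfStep_add_one M j).le
    (cast_mpfStep_le M i) (lt_cast_mpfStep_add_one M i).le steps_ne nodes_ne).trans ?_
  refine mul_le_mul_of_nonneg_left (Real.exp_le_exp.2 ?_) (by positivity)
  calc 3 * |(mpfStep M i : ℝ) - mpfStep M j|⁻¹ ≤ 3 * (M * |(i : ℝ) - j| / (2 * j + 1))⁻¹ := by
        gcongr
    _ = 3 * (2 * j + 1) / M * |(i : ℝ) - j|⁻¹ := by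
        rw [inv_div, mul_comm (M : ℝ), div_mul_eq_div_mul_one_div]
        ring

lemma one_add_log_sq_le {x : ℝ} (hx : 1 ≤ x) : (1 + Real.log x) ^ 2 ≤ 4 * x := by
  have hx0 : 0 ≤ x := zero_le_one.trans hx
  have log_nonneg := Real.log_nonneg hx
  have log_sqrt_le := Real.log_le_sub_one_of_pos (Real.sqrt_pos.2 (zero_lt_one.trans_le hx))
  rw [Real.log_sqrt hx0] at log_sqrt_le
  calc (1 + Real.log x) ^ 2 ≤ (2 * Real.sqrt x) ^ 2 := by
        gcongr
        linarith
    _ = 4 * x := by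
        rw [mul_pow, Real.sq_sqrt hx0]
        norm_num

-- Completing the square in `j` gives the constant: `6 (2 j + 1) l - j (j + 1) / 2 ≤ 78 l ^ 2` for
-- `1 ≤ l = 1 + log M`, and `l ^ 2 ≤ 4 M`.
lemma weight_exponent_le {M : ℕ} (hM : 1 ≤ M) {j : ℝ} (hj : 0 ≤ j) :
    -(j * (j + 1) / (2 * M)) + 3 * (2 * j + 1) / M * (2 * (1 + Real.log M)) ≤ 312 := by
  have hM' : (1 : ℝ) ≤ M := by exact_mod_cast hM
  have log_sq := one_add_log_sq_le hM'
  have one_le_l : 1 ≤ 1 + Real.log M := le_add_of_nonneg_right (Real.log_nonneg hM')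
  set l := 1 + Real.log M
  rw [show -(j * (j + 1) / (2 * M)) + 3 * (2 * j + 1) / M * (2 * l)
      = (6 * (2 * j + 1) * l - j * (j + 1) / 2) / M by field_simp; ring,
    div_le_iff₀ (by positivity)]
  nlinarith [sq_nonneg (j - 12 * l)]

lemma prod_mpfStep_sq_div_le {M j : ℕ} (hj : j < M) :
    ∏ i ∈ (Finset.range M).erase j,
      ((mpfStep M j : ℝ) ^ 2 / |(mpfStep M i : ℝ) ^ 2 - (mpfStep M j : ℝ) ^ 2|)
      ≤ 2 * Real.exp 312 * ((j : ℝ) + 1)⁻¹ := by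
  calc _ ≤ ∏ i ∈ (Finset.range M).erase j,
        ((2 * (i : ℝ) + 1) ^ 2 / |(2 * (i : ℝ) + 1) ^ 2 - (2 * (j : ℝ) + 1) ^ 2|
        * Real.exp (3 * (2 * j + 1) / M * |(i : ℝ) - j|⁻¹)) := by
        refine Finset.prod_le_prod (fun i _ => by positivity) fun i hi => ?_
        rw [Finset.mem_erase, Finset.mem_range] at hi
        exact mpfStep_sq_div_abs_sub_le hi.2 hj hi.1
    _ = (∏ i ∈ (Finset.range M).erase j,
        ((2 * (i : ℝ) + 1) ^ 2 / |(2 * (i : ℝ) + 1) ^ 2 - (2 * (j : ℝ) + 1) ^ 2|))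
        * Real.exp (3 * (2 * j + 1) / M * ∑ i ∈ (Finset.range M).erase j, |(i : ℝ) - j|⁻¹) := by
        rw [Finset.prod_mul_distrib, ← Real.exp_sum, Finset.mul_sum]
    _ ≤ (2 / (2 * (j : ℝ) + 1) * Real.exp (-(j * (j + 1) / (2 * M))))
        * Real.exp (3 * (2 * j + 1) / M * (2 * (1 + Real.log M))) := by
        gcongr
        · exact prod_odd_sq_div_abs_sub_le hj
        · exact sum_range_erase_inv_abs_sub_le hj
    _ = 2 / (2 * (j : ℝ) + 1) * Real.exp (-(j * (j + 1) / (2 * M))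
          + 3 * (2 * j + 1) / M * (2 * (1 + Real.log M))) := by
        rw [Real.exp_add, mul_assoc]
    _ ≤ 2 / ((j : ℝ) + 1) * Real.exp 312 := by
        gcongr
        · linarith [(Nat.cast_nonneg j : (0 : ℝ) ≤ j)]
        · exact weight_exponent_le (Nat.one_le_of_lt hj) (Nat.cast_nonneg j)
    _ = 2 * Real.exp 312 * ((j : ℝ) + 1)⁻¹ := by ring

open Polynomial in
lemma sum_eval_zero_lagrangeBasis_mul_pow {F : Type*} [Field F] {M : ℕ} {x : Fin M → F}
    (hx : Function.Injective x) {i : ℕ} (hi : i < M) :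
    ∑ j, (Lagrange.basis Finset.univ x j).eval 0 * x j ^ i = if i = 0 then 1 else 0 := by
  have interpolate_pow := Lagrange.eq_interpolate (s := Finset.univ) (v := x) (f := X ^ i)
    hx.injOn (by rw [degree_X_pow, Finset.card_univ, Fintype.card_fin]; exact_mod_cast hi)
  have eval_zero := congrArg (eval 0) interpolate_pow
  simp only [Lagrange.interpolate_apply, eval_finsetSum, eval_pow, eval_X, eval_mul, eval_C,
    zero_pow_eq] at eval_zero
  rw [eval_zero]
  exact Finset.sum_congr rfl fun j _ => mul_comm _ _

lemma eval_zero_basisDivisor_inv {F : Type*} [Field F] {x y : F} (hx : x ≠ 0) (hy : y ≠ 0) :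
    (Lagrange.basisDivisor x⁻¹ y⁻¹).eval 0 = x / (x - y) := by
  rw [Lagrange.basisDivisor, Polynomial.eval_mul, Polynomial.eval_C, Polynomial.eval_sub,
    Polynomial.eval_X, Polynomial.eval_C, inv_sub_inv hx hy, inv_div, zero_sub, mul_neg,
    div_mul_eq_mul_div, mul_inv_cancel_right₀ hy, ← div_neg, neg_sub]

lemma prod_univ_erase_eq_prod_range_erase {R : Type*} [CommMonoid R] {M : ℕ} (f : ℕ → R)
    (j : Fin M) : ∏ i ∈ Finset.univ.erase j, f i = ∏ i ∈ (Finset.range M).erase j, f i := by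
  rw [← Nat.Iio_eq_range, ← Fin.map_valEmbedding_univ,
    show (j : ℕ) = Fin.valEmbedding j from rfl, ← Finset.map_erase, Finset.prod_map]
  rfl

/-- The weights extrapolating a polynomial of degree `< M` in `1 / k ^ 2` to `1 / k ^ 2 = 0` from
its values at the step numbers `mpfStep M j`. -/
def mpfWeight (M : ℕ) (j : Fin M) : ℝ :=
  (Lagrange.basis Finset.univ (fun i : Fin M => ((mpfStep M i : ℝ) ^ 2)⁻¹) j).eval 0

lemma abs_mpfWeight_le {M : ℕ} (j : Fin M) :
    |mpfWeight M j| ≤ 2 * Real.exp 312 * ((j : ℝ) + 1)⁻¹ := by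
  have sq_ne (i : Fin M) : (mpfStep M i : ℝ) ^ 2 ≠ 0 :=
    pow_ne_zero 2 (Nat.cast_ne_zero.2 (mpfStep_pos i.2).ne')
  rw [mpfWeight, Lagrange.basis, Polynomial.eval_prod, Finset.abs_prod]
  refine le_of_eq_of_le ?_ (prod_mpfStep_sq_div_le j.2)
  rw [← prod_univ_erase_eq_prod_range_erase]
  refine Finset.prod_congr rfl fun i _ => ?_
  rw [eval_zero_basisDivisor_inv (sq_ne j) (sq_ne i), abs_div, abs_sq, abs_sub_comm]

lemma isMPF_mpfWeight (M : ℕ) : IsMPF (fun j : Fin M => mpfStep M j) (mpfWeight M) := by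
  have injective : Function.Injective fun j : Fin M => ((mpfStep M j : ℝ) ^ 2)⁻¹ :=
    inv_injective.comp fun i j h => cast_mpfStep_injective M
      ((pow_left_inj₀ (Nat.cast_nonneg _) (Nat.cast_nonneg _) two_ne_zero).1 h)
  refine ⟨fun j => mpfStep_pos j.2, fun i hi => ?_⟩
  rw [← sum_eval_zero_lagrangeBasis_mul_pow injective hi]
  exact Finset.sum_congr rfl fun j _ => by rw [pow_mul, ← inv_pow]; rfl

lemma l1norm_mpfWeight_le (M : ℕ) :
    l1norm (mpfWeight M) ≤ 2 * Real.exp 312 * (1 + Real.log M) := by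
  refine (Finset.sum_le_sum fun j _ => abs_mpfWeight_le j).trans ?_
  rw [← Finset.mul_sum, ← Finset.sum_range fun i => ((i : ℝ) + 1)⁻¹]
  exact mul_le_mul_of_nonneg_left (sum_range_inv_succ_le le_rfl) (by positivity)

end WellConditioned

section NormBounds

variable {V : Type*} [NormedRing V]

lemma norm_mul_sub_mul_le {A B C D : V} (hB : ‖B‖ ≤ 1) (hC : ‖C‖ ≤ 1) :
    ‖A * B - C * D‖ ≤ ‖A - C‖ + ‖B - D‖ := by
  calc ‖A * B - C * D‖ = ‖(A - C) * B + C * (B - D)‖ := by noncomm_ring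
    _ ≤ ‖A - C‖ * ‖B‖ + ‖C‖ * ‖B - D‖ :=
        (norm_add_le _ _).trans (add_le_add (norm_mul_le _ _) (norm_mul_le _ _))
    _ ≤ _ := add_le_add (mul_le_of_le_one_right (norm_nonneg _) hB)
        (mul_le_of_le_one_left (norm_nonneg _) hC)

variable [NormOneClass V]

lemma norm_prod_map_le_one {ι : Type*} {f : ι → V} {l : List ι} (hf : ∀ i ∈ l, ‖f i‖ ≤ 1) :
    ‖(l.map f).prod‖ ≤ 1 := by
  induction l with
  | nil => simp
  | cons i l ih =>
    rw [List.forall_mem_cons] at hf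
    exact (norm_mul_le _ _).trans (mul_le_one₀ hf.1 (norm_nonneg _) (ih hf.2))

lemma norm_prod_map_sub_prod_map_le {ι : Type*} {f g : ι → V} {l : List ι}
    (hf : ∀ i ∈ l, ‖f i‖ ≤ 1) (hg : ∀ i ∈ l, ‖g i‖ ≤ 1) :
    ‖(l.map f).prod - (l.map g).prod‖ ≤ (l.map fun i => ‖f i - g i‖).sum := by
  induction l with
  | nil => simp
  | cons i l ih =>
    rw [List.forall_mem_cons] at hf hg
    simp only [List.map_cons, List.prod_cons, List.sum_cons]
    exact (norm_mul_sub_mul_le (norm_prod_map_le_one hf.2) hg.1).trans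
      (add_le_add_right (ih hf.2 hg.2) _)

end NormBounds

section DescendingProduct

/-- The ordered product `f (k - 1) * ⋯ * f 0` of `k` factors, the first one acting first. -/
def descProd {V : Type*} [Monoid V] (f : ℕ → V) (k : ℕ) : V :=
  ((List.range k).reverse.map f).prod

lemma descProd_succ {V : Type*} [Monoid V] (f : ℕ → V) (k : ℕ) :
    descProd f (k + 1) = f k * descProd f k := by
  simp [descProd, List.range_succ]

lemma descProd_congr {V : Type*} [Monoid V] {f g : ℕ → V} {k : ℕ} (h : ∀ r < k, f r = g r) :
    descProd f k = descProd g k :=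
  congrArg List.prod (List.map_congr_left fun r hr => h r (by simpa using hr))

lemma descProd_eq_of_le {V : Type*} [Monoid V] {f : ℕ → V} {k R : ℕ} (hk : k ≤ R)
    (h : ∀ r, k ≤ r → f r = 1) : descProd f R = descProd f k := by
  induction R, hk using Nat.le_induction with
  | base => rfl
  | succ R hR ih => rw [descProd_succ, ih, h R hR, one_mul]

lemma stepProd_apply {V : Type*} [Monoid V] (S : ℤ → ℂ → V) (k : ℕ) (z : ℂ) :
    stepProd S k z = descProd (fun r => S r z) k := by
  induction k with
  | zero => rfl
  | succ k ih => rw [stepProd, Pi.mul_apply, ih, descProd_succ]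

lemma norm_descProd_sub_le {V : Type*} [NormedRing V] [NormOneClass V] {f g : ℕ → V} {k : ℕ}
    {ε : ℝ} (hf : ∀ r < k, ‖f r‖ ≤ 1) (hg : ∀ r < k, ‖g r‖ ≤ 1) (h : ∀ r < k, ‖f r - g r‖ ≤ ε) :
    ‖descProd f k - descProd g k‖ ≤ k * ε := by
  have forall_mem {p : ℕ → Prop} (hp : ∀ r < k, p r) : ∀ r ∈ (List.range k).reverse, p r :=
    fun r hr => hp r (by simpa using hr)
  refine (norm_prod_map_sub_prod_map_le (forall_mem hf) (forall_mem hg)).trans ?_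
  refine (List.sum_le_card_nsmul _ ε ?_).trans_eq (by simp)
  simpa only [List.forall_mem_map] using forall_mem h

end DescendingProduct

section Unitary

variable {V : Type*} [NormedRing V] [NormedAlgebra ℂ V] [CompleteSpace V]

lemma hasDerivAt_exp_neg_I_mul_smul (H : V) (u : ℝ) :
    HasDerivAt (fun u : ℝ => NormedSpace.exp ((-(Complex.I * (u : ℂ))) • H))
      ((-Complex.I) • (H * NormedSpace.exp ((-(Complex.I * (u : ℂ))) • H))) u := by
  have inner : HasDerivAt (fun u : ℝ => -(Complex.I * (u : ℂ))) (-Complex.I) u := by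
    simpa using (((hasDerivAt_id u).ofReal_comp).const_mul Complex.I).fun_neg
  exact (hasDerivAt_exp_smul_const' (𝕂 := ℂ) H (-(Complex.I * (u : ℂ)))).scomp u inner

variable [StarRing V] [CStarRing V] [StarModule ℂ V]

lemma exp_neg_I_mul_smul_mem_unitary {H : V} (hH : IsSelfAdjoint H) (θ : ℝ) :
    NormedSpace.exp ((-(Complex.I * (θ : ℂ))) • H) ∈ unitary V := by
  let _ : NormedAlgebra ℚ V := .restrictScalars ℚ ℂ _
  refine NormedSpace.exp_mem_unitary_of_mem_skewAdjoint ?_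
  rw [skewAdjoint.mem_iff, star_smul, hH.star_eq]
  simp

variable [Nontrivial V]

lemma norm_exp_neg_I_mul_smul {H : V} (hH : IsSelfAdjoint H) (θ : ℝ) :
    ‖NormedSpace.exp ((-(Complex.I * (θ : ℂ))) • H)‖ = 1 :=
  CStarRing.norm_of_mem_unitary (exp_neg_I_mul_smul_mem_unitary hH θ)

lemma norm_exp_neg_I_mul_smul_sub_le {H : V} (hH : IsSelfAdjoint H) (θ φ : ℝ) :
    ‖NormedSpace.exp ((-(Complex.I * (θ : ℂ))) • H)
      - NormedSpace.exp ((-(Complex.I * (φ : ℂ))) • H)‖ ≤ |θ - φ| * ‖H‖ := by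
  have norm_deriv_le (u : ℝ) :
      ‖(-Complex.I) • (H * NormedSpace.exp ((-(Complex.I * (u : ℂ))) • H))‖ ≤ ‖H‖ := by
    rw [norm_smul, norm_neg, Complex.norm_I, one_mul]
    exact (norm_mul_le _ _).trans_eq (by rw [norm_exp_neg_I_mul_smul hH, mul_one])
  have mean_value := convex_univ.norm_image_sub_le_of_norm_hasDerivWithin_le
    (fun u _ => (hasDerivAt_exp_neg_I_mul_smul H u).hasDerivWithinAt)
    (fun u _ => norm_deriv_le u) (Set.mem_univ φ) (Set.mem_univ θ)
  rwa [mul_comm ‖H‖, Real.norm_eq_abs] at mean_value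

end Unitary

section Propagator

variable {n : ℕ} {H : ℝ → QOp n} {t₀ t : ℝ} {U : ℝ → QOp n}

lemma IsPropagator.star_mul_self (hU : IsPropagator H t₀ t U) (h : t₀ < t)
    (hH : ∀ τ, (H τ).IsHermitian) : star (U t) * U t = 1 := by
  have hasDeriv_zero : ∀ τ ∈ Set.Icc t₀ t,
      HasDerivWithinAt (fun τ => star (U τ) * U τ) 0 (Set.Icc t₀ t) τ := by
    intro τ hτ
    refine ((hU.2 τ hτ).star.mul (hU.2 τ hτ)).congr_deriv ?_
    simp [(hH τ).isSelfAdjoint.star_eq, mul_assoc]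
  have const := constant_of_derivWithin_zero (f := fun τ => star (U τ) * U τ)
    (fun τ hτ => (hasDeriv_zero τ hτ).differentiableWithinAt)
    (fun τ hτ => (hasDeriv_zero τ (Set.Ico_subset_Icc_self hτ)).derivWithin
      (uniqueDiffOn_Icc h τ (Set.Ico_subset_Icc_self hτ))) t ⟨h.le, le_rfl⟩
  simpa only [hU.1, star_one, one_mul] using const

lemma norm_le_one_of_star_mul_self_eq_one {V : Type*} [NormedRing V] [StarRing V] [CStarRing V]
    [Nontrivial V] {u : V} (hu : star u * u = 1) : ‖u‖ ≤ 1 := by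
  have norm_sq := CStarRing.norm_star_mul_self (x := u)
  rw [hu, CStarRing.norm_one] at norm_sq
  nlinarith [norm_nonneg u]

lemma isHermitian_hamiltonian {L : ℕ} {Hs : Fin L → QOp n} (hH : ∀ j, (Hs j).IsHermitian)
    (α : Fin L → ℝ → ℝ) (τ : ℝ) : (hamiltonian Hs α τ).IsHermitian := by
  have selfAdjoint : IsSelfAdjoint (hamiltonian Hs α τ) :=
    isSelfAdjoint_sum _ fun j _ => .smul (Complex.conj_ofReal _) (hH j).isSelfAdjoint
  exact selfAdjoint

end Propagator

section WeightedTaylorRemainder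

variable {ι : Type*} [Fintype ι] {α : ι → ℝ → ℝ} {D : Set ℝ}

lemma iteratedDerivWithin_sum_const_mul {i : ℕ} {τ : ℝ} (hD : UniqueDiffOn ℝ D) (hτ : τ ∈ D)
    (hα : ∀ j, ContDiffOn ℝ i (α j) D) (c : ι → ℝ) :
    iteratedDerivWithin i (fun τ => ∑ j, c j * α j τ) D τ
      = ∑ j, c j * iteratedDerivWithin i (α j) D τ := by
  rw [iteratedDerivWithin_fun_sum hτ hD fun j _ => contDiffWithinAt_const.mul (hα j τ hτ)]
  exact Finset.sum_congr rfl fun j _ => iteratedDerivWithin_const_mul_field _ _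

lemma taylorWithinEval_sum_const_mul {N : ℕ} {x₀ : ℝ} (hD : UniqueDiffOn ℝ D) (hx₀ : x₀ ∈ D)
    (hα : ∀ j, ContDiffOn ℝ N (α j) D) (c : ι → ℝ) (τ : ℝ) :
    taylorWithinEval (fun τ => ∑ j, c j * α j τ) N D x₀ τ
      = ∑ j, c j * taylorWithinEval (α j) N D x₀ τ := by
  simp only [taylor_within_apply, Finset.mul_sum, smul_eq_mul]
  rw [Finset.sum_comm]
  refine Finset.sum_congr rfl fun i hi => ?_
  have hiN : (i : WithTop ℕ∞) ≤ N := by exact_mod_cast Finset.mem_range_succ_iff.1 hi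
  rw [iteratedDerivWithin_sum_const_mul hD hx₀ fun j => (hα j).of_le hiN, Finset.mul_sum]
  exact Finset.sum_congr rfl fun j _ => by ring

/- The weighted sum of the absolute remainders is the remainder of the single function
`∑ j, ± w j * α j`, with the signs of the remainders at `τ`. -/
lemma sum_abs_sub_taylorWithinEval_mul_le {a b : ℝ} (hab : a < b) {N : ℕ}
    (hα : ∀ j, ContDiffOn ℝ (N + 1 : ℕ) (α j) (Set.Icc a b)) {w : ι → ℝ} (hw : ∀ j, 0 ≤ w j)
    {Y : ℝ} (hY : ∀ τ ∈ Set.Icc a b,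
      ∑ j, |iteratedDerivWithin (N + 1) (α j) (Set.Icc a b) τ| * w j ≤ Y) {τ : ℝ}
    (hτ : τ ∈ Set.Icc a b) :
    ∑ j, |α j τ - taylorWithinEval (α j) N (Set.Icc a b) a τ| * w j
      ≤ Y * (τ - a) ^ (N + 1) / N.factorial := by
  have hD : UniqueDiffOn ℝ (Set.Icc a b) := uniqueDiffOn_Icc hab
  set R : ι → ℝ := fun j => α j τ - taylorWithinEval (α j) N (Set.Icc a b) a τ
  set c : ι → ℝ := fun j => SignType.sign (R j) * w j
  have abs_c_le (j : ι) : |c j| ≤ w j := by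
    rw [abs_mul, abs_of_nonneg (hw j)]
    refine mul_le_of_le_one_left (hw j) ?_
    cases SignType.sign (R j) <;> simp
  have norm_iteratedDeriv_le : ∀ y ∈ Set.Icc a b,
      ‖iteratedDerivWithin (N + 1) (fun τ => ∑ j, c j * α j τ) (Set.Icc a b) y‖ ≤ Y := by
    intro y hy
    rw [iteratedDerivWithin_sum_const_mul hD hy hα]
    refine (norm_sum_le _ _).trans ((Finset.sum_le_sum fun j _ => ?_).trans (hY y hy))
    rw [norm_mul, Real.norm_eq_abs, Real.norm_eq_abs, mul_comm]
    exact mul_le_mul_of_nonneg_left (abs_c_le j) (abs_nonneg _)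
  have remainder_eq : ∑ j, |R j| * w j = (∑ j, c j * α j τ)
      - taylorWithinEval (fun τ => ∑ j, c j * α j τ) N (Set.Icc a b) a τ := by
    rw [taylorWithinEval_sum_const_mul hD ⟨le_rfl, hab.le⟩
      fun j => (hα j).of_le (by exact_mod_cast N.le_succ), ← Finset.sum_sub_distrib]
    refine Finset.sum_congr rfl fun j _ => ?_
    rw [← mul_sub, mul_right_comm, sign_mul_self]
  have contDiff_sum : ContDiffOn ℝ (N + 1) (fun τ => ∑ j, c j * α j τ) (Set.Icc a b) :=
    .sum fun j _ => contDiffOn_const.mul (hα j)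
  rw [remainder_eq]
  exact (le_abs_self _).trans
    (taylor_mean_remainder_bound hab.le contDiff_sum hτ norm_iteratedDeriv_le)

end WeightedTaylorRemainder

section ScaledCoefficients

/-- The Taylor coefficients at `s = 0` of the rescaled coefficient function
`s ↦ (t - t₀) * α (t₀ + s * (t - t₀))` on `[0, 1]`. -/
def scaledCoeff (α : ℝ → ℝ) (t₀ t : ℝ) (i : ℕ) : ℝ :=
  (t - t₀) ^ (i + 1) / i.factorial * iteratedDerivWithin i α (Set.Icc t₀ t) t₀

lemma sum_scaledCoeff_mul_pow (α : ℝ → ℝ) (t₀ t : ℝ) (N : ℕ) (s : ℝ) :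
    ∑ i ∈ Finset.range (N + 1), scaledCoeff α t₀ t i * s ^ i
      = (t - t₀) * taylorWithinEval α N (Set.Icc t₀ t) t₀ (t₀ + s * (t - t₀)) := by
  rw [taylor_within_apply, Finset.mul_sum]
  refine Finset.sum_congr rfl fun i _ => ?_
  rw [scaledCoeff, smul_eq_mul, add_sub_cancel_left, mul_pow, pow_succ]
  ring

lemma add_mul_sub_mem_Icc {t₀ t s : ℝ} (h : t₀ ≤ t) (hs : s ∈ Set.Icc (0 : ℝ) 1) :
    t₀ + s * (t - t₀) ∈ Set.Icc t₀ t :=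
  ⟨le_add_of_nonneg_right (mul_nonneg hs.1 (sub_nonneg.2 h)), by
    linarith [mul_le_of_le_one_left (sub_nonneg.2 h) hs.2]⟩

variable {n L M : ℕ} {Hs : Fin L → QOp n} {α : Fin L → ℝ → ℝ} {Λ : ℝ → ℝ} {t₀ t κ : ℝ}

lemma IsTermRatio.sum_abs_scaledCoeff_le (hκ : IsTermRatio M Hs α Λ t₀ t κ) (h : t₀ < t) {i : ℕ}
    (hi : i ≤ 2 * M + 1) :
    ∑ j, |scaledCoeff (α j) t₀ t i| * ‖Hs j‖ ≤ (κ * lambdaMax Λ t₀ t * (t - t₀)) ^ (i + 1) := by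
  have := sub_pos.2 h
  have deriv_le := hκ.2.2 i hi t₀ ⟨le_rfl, h.le⟩
  have nonneg : 0 ≤ ∑ j, |iteratedDerivWithin i (α j) (Set.Icc t₀ t) t₀| * ‖Hs j‖ := by positivity
  calc ∑ j, |scaledCoeff (α j) t₀ t i| * ‖Hs j‖
      = (t - t₀) ^ (i + 1) / i.factorial
          * ∑ j, |iteratedDerivWithin i (α j) (Set.Icc t₀ t) t₀| * ‖Hs j‖ := by
        rw [Finset.mul_sum]
        refine Finset.sum_congr rfl fun j _ => ?_
        rw [scaledCoeff, abs_mul, abs_of_pos (by positivity), mul_assoc]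
    _ ≤ (t - t₀) ^ (i + 1) * (κ * lambdaMax Λ t₀ t) ^ (i + 1) :=
        mul_le_mul (div_le_self (by positivity) (by exact_mod_cast i.factorial_pos)) deriv_le
          nonneg (by positivity)
    _ = _ := by rw [mul_pow _ (t - t₀), mul_comm]

lemma IsTermRatio.sum_abs_scaled_remainder_le (hκ : IsTermRatio M Hs α Λ t₀ t κ) (hM : 0 < M)
    (h : t₀ < t) (hα : ∀ j, ContDiffOn ℝ (2 * M : ℕ) (α j) (Set.Icc t₀ t))
    (hx : 0 ≤ κ * lambdaMax Λ t₀ t) {s : ℝ} (hs : s ∈ Set.Icc (0 : ℝ) 1) :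
    ∑ j, |(t - t₀) * α j (t₀ + s * (t - t₀))
        - ∑ i ∈ Finset.range (2 * M), scaledCoeff (α j) t₀ t i * s ^ i| * ‖Hs j‖
      ≤ (κ * lambdaMax Λ t₀ t * (t - t₀)) ^ (2 * M + 1) := by
  have h0 : 0 < t - t₀ := sub_pos.2 h
  have deriv_le := hκ.2.2 (2 * M) (by lia)
  obtain ⟨N, hN⟩ : ∃ N, 2 * M = N + 1 := ⟨2 * M - 1, by lia⟩
  rw [hN] at hα deriv_le ⊢
  have remainder_le := sum_abs_sub_taylorWithinEval_mul_le h hα (fun j => norm_nonneg (Hs j))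
    deriv_le (add_mul_sub_mem_Icc h.le hs)
  simp only [sum_scaledCoeff_mul_pow, ← mul_sub, abs_mul, abs_of_pos h0, mul_assoc (t - t₀)]
  rw [← Finset.mul_sum]
  set y := κ * lambdaMax Λ t₀ t
  calc _ ≤ (t - t₀) * (y ^ (N + 1 + 1) * (s * (t - t₀)) ^ (N + 1) / N.factorial) := by
        rw [add_sub_cancel_left] at remainder_le
        exact mul_le_mul_of_nonneg_left remainder_le h0.le
    _ ≤ (t - t₀) * (y ^ (N + 1 + 1) * (1 * (t - t₀)) ^ (N + 1)) := by
        have := hs.1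
        gcongr
        refine (div_le_self (by positivity) (by exact_mod_cast N.factorial_pos)).trans ?_
        gcongr
        exact hs.2
    _ = _ := by rw [one_mul, mul_pow y]; ring

end ScaledCoefficients

section Mesh

variable {L : ℕ} {α : Fin L → ℝ → ℝ} {t₀ t : ℝ}

lemma IsLambdaBound.lambdaMax_pos {n : ℕ} {H : ℝ → QOp n} {Λ : ℝ → ℝ}
    (hΛ : IsLambdaBound H t₀ t Λ) (h : t₀ ≤ t) : 0 < lambdaMax Λ t₀ t :=
  (hΛ.2 t₀ ⟨le_rfl, h⟩).1.trans_le <|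
    le_csSup (isCompact_Icc.image_of_continuousOn hΛ.1).bddAbove ⟨t₀, ⟨le_rfl, h⟩, rfl⟩

lemma bddAbove_abs_derivWithin (h : t₀ < t) (hα : ∀ j, ContDiffOn ℝ 1 (α j) (Set.Icc t₀ t)) :
    BddAbove {x | ∃ j, ∃ τ ∈ Set.Icc t₀ t, x = |derivWithin (α j) (Set.Icc t₀ t) τ|} := by
  have eq_iUnion : {x | ∃ j, ∃ τ ∈ Set.Icc t₀ t, x = |derivWithin (α j) (Set.Icc t₀ t) τ|}
      = ⋃ j, (fun τ => |derivWithin (α j) (Set.Icc t₀ t) τ|) '' Set.Icc t₀ t := by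
    ext x; simp [eq_comm]
  rw [eq_iUnion, ← Set.biUnion_univ, Set.finite_univ.bddAbove_biUnion]
  refine fun j _ => (isCompact_Icc.image_of_continuousOn ?_).bddAbove
  exact ((hα j).continuousOn_derivWithin (uniqueDiffOn_Icc h) le_rfl).abs

lemma maxDeriv_nonneg (α : Fin L → ℝ → ℝ) (t₀ t : ℝ) : 0 ≤ maxDeriv α t₀ t := by
  refine Real.sSup_nonneg ?_
  rintro x ⟨j, τ, _, rfl⟩
  exact abs_nonneg _

lemma abs_sub_le_maxDeriv_mul (h : t₀ < t) (hα : ∀ j, ContDiffOn ℝ 1 (α j) (Set.Icc t₀ t))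
    (j : Fin L) {σ τ : ℝ} (hσ : σ ∈ Set.Icc t₀ t) (hτ : τ ∈ Set.Icc t₀ t) :
    |α j σ - α j τ| ≤ maxDeriv α t₀ t * |σ - τ| :=
  (convex_Icc t₀ t).norm_image_sub_le_of_norm_derivWithin_le
    ((hα j).differentiableOn one_ne_zero)
    (fun x hx => le_csSup (bddAbove_abs_derivWithin h hα) ⟨j, x, hx, rfl⟩) hτ hσ

lemma natCast_le_two_pow_sub_one {nt : ℕ} (q : Fin (2 ^ nt)) : ((q : ℕ) : ℝ) ≤ 2 ^ nt - 1 := by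
  rw [le_sub_iff_add_le]
  exact_mod_cast q.2

lemma meshPoint_mem_Icc (h : t₀ ≤ t) (nt : ℕ) (q : Fin (2 ^ nt)) :
    meshPoint t₀ t nt q ∈ Set.Icc t₀ t := by
  have q_le := natCast_le_two_pow_sub_one q
  have width_nonneg := (Nat.cast_nonneg (q : ℕ)).trans q_le
  rw [meshPoint, ← mul_div_assoc, mul_div_right_comm]
  exact add_mul_sub_mem_Icc h ⟨by positivity, div_le_one_of_le₀ q_le width_nonneg⟩

lemma exists_abs_meshPoint_sub_le (h : t₀ < t) (nt : ℕ) {s : ℝ} (hs : s ∈ Set.Icc (0 : ℝ) 1) :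
    ∃ q, |meshPoint t₀ t nt q - (t₀ + s * (t - t₀))| ≤ 2 * (t - t₀) / 2 ^ nt := by
  have := sub_pos.2 h
  obtain ⟨s_nonneg, s_le⟩ := hs
  rcases nt.eq_zero_or_pos with rfl | hnt
  · refine ⟨0, ?_⟩
    simp only [meshPoint, pow_zero, sub_self, div_zero, mul_zero, add_zero, div_one]
    rw [abs_le]; constructor <;> nlinarith
  have two_le : (2 : ℝ) ≤ 2 ^ nt := le_self_pow₀ one_le_two hnt.ne'
  set N : ℝ := 2 ^ nt - 1 with hN
  have hN1 : 1 ≤ N := by linarith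
  have floor_le : (⌊s * N⌋₊ : ℝ) ≤ s * N := Nat.floor_le (by positivity)
  have lt_floor := Nat.lt_floor_add_one (s * N)
  have floor_lt : ⌊s * N⌋₊ < 2 ^ nt := by
    have : (⌊s * N⌋₊ : ℝ) < 2 ^ nt := by linarith [mul_le_of_le_one_left (by linarith : 0 ≤ N) s_le]
    exact_mod_cast this
  refine ⟨⟨⌊s * N⌋₊, floor_lt⟩, ?_⟩
  have dist_eq : meshPoint t₀ t nt ⟨⌊s * N⌋₊, floor_lt⟩ - (t₀ + s * (t - t₀))
      = (⌊s * N⌋₊ - s * N) * ((t - t₀) / N) := by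
    rw [meshPoint, ← hN]; simp only; field_simp; ring
  rw [dist_eq, abs_mul, abs_of_pos (by positivity : 0 < (t - t₀) / N)]
  calc _ ≤ 1 * ((t - t₀) / N) := by
        gcongr
        rw [abs_le]; constructor <;> linarith
    _ ≤ 2 * (t - t₀) / 2 ^ nt := by
        rw [one_mul, div_le_div_iff₀ (by positivity) (by positivity)]
        nlinarith

end Mesh

section PhaseSteps

variable {n L : ℕ} {Hs : Fin L → QOp n}

/-- One symmetric product step `∏ l, exp (-i θ l H l)`, the product running over the palindrome of
the indices. -/
def phaseStep (Hs : Fin L → QOp n) (θ : Fin L → ℝ) : QOp n :=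
  ((palindrome L).map fun l =>
    (NormedSpace.exp ((-(Complex.I * ((θ l : ℝ) : ℂ))) • Hs l) : QOp n)).prod

lemma norm_phaseStep_le_one (hH : ∀ j, (Hs j).IsHermitian) (θ : Fin L → ℝ) :
    ‖phaseStep Hs θ‖ ≤ 1 :=
  norm_prod_map_le_one fun l _ => (norm_exp_neg_I_mul_smul (hH l).isSelfAdjoint (θ l)).le

lemma norm_phaseStep_sub_le (hH : ∀ j, (Hs j).IsHermitian) (θ φ : Fin L → ℝ) :
    ‖phaseStep Hs θ - phaseStep Hs φ‖ ≤ 2 * ∑ l, |θ l - φ l| * ‖Hs l‖ := by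
  have norm_factor_le (ψ : Fin L → ℝ) (l : Fin L) :
      ‖(NormedSpace.exp ((-(Complex.I * ((ψ l : ℝ) : ℂ))) • Hs l) : QOp n)‖ ≤ 1 :=
    (norm_exp_neg_I_mul_smul (hH l).isSelfAdjoint (ψ l)).le
  refine (norm_prod_map_sub_prod_map_le (fun l _ => norm_factor_le θ l)
    fun l _ => norm_factor_le φ l).trans ?_
  rw [sum_map_palindrome, nsmul_eq_mul, Nat.cast_ofNat]
  gcongr
  exact norm_exp_neg_I_mul_smul_sub_le (hH _).isSelfAdjoint _ _

lemma symStep_inv_natCast (N : ℕ) (c : Fin L → ℕ → ℝ) (r k : ℕ) :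
    symStep N (fun l i => (c l i : ℂ)) ((-Complex.I) • Hs) r ((k : ℂ)⁻¹)
      = phaseStep Hs fun l =>
        (∑ i ∈ Finset.range N, c l i * (((r : ℝ) + 1 / 2) / k) ^ i) / (2 * k) := by
  rw [symStep_apply, phaseStep]
  congr 1
  refine List.map_congr_left fun l _ => ?_
  rw [polyExp, Pi.smul_apply, smul_smul, smul_smul]
  congr 2
  push_cast
  rw [Finset.sum_mul, Finset.sum_mul, Finset.sum_div, Finset.mul_sum, ← Finset.sum_neg_distrib]
  refine Finset.sum_congr rfl fun i _ => ?_
  rw [div_pow, inv_pow, pow_succ]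
  by_cases hk : (k : ℂ) = 0
  · simp [hk]
  · field_simp

end PhaseSteps

section MultiproductConstants

variable {M : ℕ}

/-- The constant in the error bound of the multiproduct formula with coefficients rounded to mesh
points: rounding and Taylor truncation of the coefficients, the remainder of the multiproduct
formula, and the remainder of the propagator. -/
def mpfConst (M : ℕ) : ℝ :=
  (41 ^ (2 * M + 1) + 1) + 2 * Real.exp (2 * M) + 4 * ((2 * M) * (2 * M + 1) + 2)

lemma mpfConst_nonneg (M : ℕ) : 0 ≤ mpfConst M := by
  rw [mpfConst]
  positivity

lemma IsMPF.one_le_l1norm {k : Fin M → ℕ} {a : Fin M → ℝ} (ha : IsMPF k a) (hM : 0 < M) :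
    1 ≤ l1norm a := by
  have sum_eq := ha.2 0 hM
  simp only [mul_zero, pow_zero, inv_one, mul_one, if_true] at sum_eq
  rw [← sum_eq]
  exact Finset.sum_le_sum fun j _ => le_abs_self _

lemma le_two_pow_of_logb_le {X : ℝ} (hX : 0 ≤ X) {m : ℕ} (h : Real.logb 2 X ≤ m) : X ≤ 2 ^ m := by
  rcases hX.eq_or_lt with rfl | hX
  · positivity
  · rwa [Real.logb_le_iff_le_rpow one_lt_two hX, Real.rpow_natCast] at h

lemma rounding_error_le (hM : 0 < M) {Δ κ lam D : ℝ} (hΔ : 0 < Δ) (hlam : 0 < lam) (hκ : 1 ≤ κ)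
    (hD : 0 ≤ D) {L nt : ℕ}
    (hnt : Real.logb 2 (10 * (M : ℝ) ^ 2 * L * D * Δ ^ 2 / (41 * lam * Δ) ^ (2 * M + 1)) ≤ nt) :
    L * (κ * Δ * (D * (2 * Δ / 2 ^ nt))) ≤ 41 ^ (2 * M + 1) * (κ * lam * Δ) ^ (2 * M + 1) := by
  have mesh_fine := le_two_pow_of_logb_le (by positivity) hnt
  rw [div_le_iff₀ (by positivity)] at mesh_fine
  have hM' : (1 : ℝ) ≤ (M : ℝ) ^ 2 := one_le_pow₀ (by exact_mod_cast hM)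
  have hκ_pow : κ ≤ κ ^ (2 * M + 1) := le_self_pow₀ hκ (by lia)
  have nonneg : 0 ≤ L * D * Δ ^ 2 := by positivity
  have two_mul_le : 2 * (L * D * Δ ^ 2) ≤ 2 ^ nt * (41 * lam * Δ) ^ (2 * M + 1) := by
    nlinarith [mul_le_mul_of_nonneg_right hM' nonneg]
  calc L * (κ * Δ * (D * (2 * Δ / 2 ^ nt)))
      = κ * (2 * (L * D * Δ ^ 2)) / 2 ^ nt := by ring
    _ ≤ κ ^ (2 * M + 1) * (2 ^ nt * (41 * lam * Δ) ^ (2 * M + 1)) / 2 ^ nt := by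
        refine div_le_div_of_nonneg_right ?_ (by positivity)
        exact mul_le_mul hκ_pow two_mul_le (by positivity) (by positivity)
    _ = (κ * (41 * lam * Δ)) ^ (2 * M + 1) := by rw [mul_pow κ]; field_simp
    _ = _ := by rw [← mul_pow]; ring

end MultiproductConstants

section RescaledPropagator

lemma polyCurve_genCoeff {V : Type*} [NormedRing V] [NormedAlgebra ℂ V] (N : ℕ) {L : ℕ}
    (a : Fin L → ℕ → ℂ) (B : Fin L → V) (s : ℝ) :
    polyCurve N (genCoeff N a B) s
      = ∑ l, (∑ i ∈ Finset.range N, a l i * (s : ℂ) ^ i) • B l := by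
  simp only [polyCurve, Finset.sum_smul]
  rw [Finset.sum_comm]
  refine Finset.sum_congr rfl fun i hi => ?_
  rw [genCoeff, if_pos (Finset.mem_range.1 hi), Finset.smul_sum]
  exact Finset.sum_congr rfl fun l _ => by rw [smul_smul, mul_comm]

lemma IsPropagator.hasDerivWithinAt_rescale {n : ℕ} {H U : ℝ → QOp n} {t₀ t : ℝ}
    (hU : IsPropagator H t₀ t U) (h : t₀ ≤ t) {s : ℝ} (hs : s ∈ Set.Icc (0 : ℝ) 1) :
    HasDerivWithinAt (fun s => U (t₀ + s * (t - t₀)))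
      (((t - t₀ : ℝ) : ℂ) • ((-Complex.I) • H (t₀ + s * (t - t₀))) * U (t₀ + s * (t - t₀)))
      (Set.Icc 0 1) s := by
  have inner : HasDerivWithinAt (fun s : ℝ => t₀ + s * (t - t₀)) (t - t₀) (Set.Icc 0 1) s := by
    simpa using (((hasDerivAt_id s).mul_const (t - t₀)).const_add t₀).hasDerivWithinAt
  refine ((hU.2 _ (add_mul_sub_mem_Icc h hs)).scomp s inner
    fun s hs => add_mul_sub_mem_Icc h hs).congr_deriv ?_
  rw [← Complex.coe_smul, smul_mul_assoc, smul_mul_assoc, neg_smul]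

variable {n L M : ℕ} {Hs : Fin L → QOp n} {α : Fin L → ℝ → ℝ} {Λ : ℝ → ℝ} {t₀ t κ : ℝ}

lemma norm_rescaled_hamiltonian_sub_polyCurve_le (N : ℕ) (c : Fin L → ℕ → ℝ) (s : ℝ) :
    ‖((t - t₀ : ℝ) : ℂ) • ((-Complex.I) • hamiltonian Hs α (t₀ + s * (t - t₀)))
        - polyCurve N (genCoeff N (fun l i => (c l i : ℂ)) ((-Complex.I) • Hs)) s‖
      ≤ ∑ l, |(t - t₀) * α l (t₀ + s * (t - t₀)) - ∑ i ∈ Finset.range N, c l i * s ^ i|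
          * ‖Hs l‖ := by
  rw [polyCurve_genCoeff, hamiltonian, Finset.smul_sum, Finset.smul_sum, ← Finset.sum_sub_distrib]
  refine (norm_sum_le _ _).trans_eq (Finset.sum_congr rfl fun l _ => ?_)
  rw [Pi.smul_apply, smul_comm (-Complex.I), smul_smul, ← sub_smul, norm_smul, norm_smul,
    norm_neg, Complex.norm_I, one_mul, ← Real.norm_eq_abs, ← Complex.norm_real]
  push_cast
  rfl

lemma IsTermRatio.sum_norm_scaledCoeff_le (hκ : IsTermRatio M Hs α Λ t₀ t κ) (h : t₀ < t) {i : ℕ}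
    (hi : i < 2 * M) :
    ∑ l, ‖(scaledCoeff (α l) t₀ t i : ℂ)‖ * ‖((-Complex.I) • Hs) l‖
      ≤ (κ * lambdaMax Λ t₀ t * (t - t₀)) ^ (i + 1) := by
  simpa [norm_smul] using hκ.sum_abs_scaledCoeff_le h (by lia : i ≤ 2 * M + 1)

lemma IsTermRatio.norm_propagator_sub_sum_odeCoeff_le (hκ : IsTermRatio M Hs α Λ t₀ t κ)
    (hM : 0 < M) (h : t₀ < t) (hα : ∀ j, ContDiffOn ℝ (2 * M : ℕ) (α j) (Set.Icc t₀ t))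
    (hlam : 0 < lambdaMax Λ t₀ t) (hx : κ * lambdaMax Λ t₀ t * (t - t₀) ≤ 1 / 2) {U : ℝ → QOp n}
    (hU : IsPropagator (hamiltonian Hs α) t₀ t U) :
    ‖U t - ∑ p ∈ Finset.range (2 * M + 1), odeCoeff (genCoeff (2 * M)
        (fun l i => (scaledCoeff (α l) t₀ t i : ℂ)) ((-Complex.I) • Hs)) p‖
      ≤ 4 * ((2 * M * (2 * M + 1) + 2) * (κ * lambdaMax Λ t₀ t * (t - t₀)) ^ (2 * M + 1)) := by
  have hκ0 : 0 < κ := zero_lt_one.trans_le hκ.1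
  have hx0 : 0 ≤ κ * lambdaMax Λ t₀ t * (t - t₀) := by have := sub_pos.2 h; positivity
  have norm_generator_sub_le (s : ℝ) (hs : s ∈ Set.Icc (0 : ℝ) 1) :=
    (norm_rescaled_hamiltonian_sub_polyCurve_le (2 * M) (fun l i => scaledCoeff (α l) t₀ t i)
      s).trans (hκ.sum_abs_scaled_remainder_le hM h hα (by positivity) hs)
  simpa using norm_ode_sub_sum_odeCoeff_le (U := fun s => U (t₀ + s * (t - t₀))) hx0 hx
    (norm_genCoeff_le hx0 fun i hi => hκ.sum_norm_scaledCoeff_le h hi) (2 * M)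
    norm_generator_sub_le (fun s hs => hU.hasDerivWithinAt_rescale h.le hs) (by simp [hU.1])

end RescaledPropagator

section MeshMultiproduct

variable {n L M nt : ℕ} {Hs : Fin L → QOp n} {α : Fin L → ℝ → ℝ} {Λ : ℝ → ℝ} {t₀ t κ : ℝ}
  {k : Fin M → ℕ} {a : Fin M → ℝ} {q : Fin M → ℕ → Fin (2 ^ nt)}

/-- The midpoint of the `r`-th of the `k` equal subintervals of `[0, 1]`. -/
def unitMidpoint (k r : ℕ) : ℝ := ((r : ℝ) + 1 / 2) / k

lemma unitMidpoint_mem_Icc {k r : ℕ} (hr : r < k) : unitMidpoint k r ∈ Set.Icc (0 : ℝ) 1 := by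
  have succ_le : (r : ℝ) + 1 ≤ k := by exact_mod_cast hr
  exact ⟨by rw [unitMidpoint]; positivity, div_le_one_of_le₀ (by linarith) k.cast_nonneg⟩

/-- `q j r` is a mesh point near the midpoint of the `r`-th of the `k j` equal time steps. -/
def IsMidpointRounding (t₀ t : ℝ) (k : Fin M → ℕ) (q : Fin M → ℕ → Fin (2 ^ nt)) : Prop :=
  ∀ j, ∀ r < k j, |meshPoint t₀ t nt (q j r) - (t₀ + unitMidpoint (k j) r * (t - t₀))|
    ≤ 2 * (t - t₀) / 2 ^ nt

lemma exists_isMidpointRounding (h : t₀ < t) (k : Fin M → ℕ) (nt : ℕ) :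
    ∃ q : Fin M → ℕ → Fin (2 ^ nt), IsMidpointRounding t₀ t k q := by
  have (j : Fin M) (r : ℕ) : ∃ q : Fin (2 ^ nt), r < k j →
      |meshPoint t₀ t nt q - (t₀ + unitMidpoint (k j) r * (t - t₀))|
        ≤ 2 * (t - t₀) / 2 ^ nt := by
    by_cases hr : r < k j
    · exact (exists_abs_meshPoint_sub_le h nt (unitMidpoint_mem_Icc hr)).imp fun _ hq _ => hq
    · exact ⟨0, fun h => absurd h hr⟩
  choose q hq using this
  exact ⟨q, hq⟩

/-- The product of `k` symmetric steps of length `(t - t₀) / k`, with the coefficients evaluated at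
the mesh points `q r`. -/
def meshProduct (Hs : Fin L → QOp n) (α : Fin L → ℝ → ℝ) (t₀ t : ℝ) (k : ℕ)
    (q : ℕ → Fin (2 ^ nt)) : QOp n :=
  descProd (fun r => phaseStep Hs fun l =>
    α l (meshPoint t₀ t nt (q r)) * ((t - t₀) / (2 * k))) k

lemma IsTermRatio.sum_abs_sub_scaledCoeff_le (hκ : IsTermRatio M Hs α Λ t₀ t κ) (hM : 0 < M)
    (h : t₀ < t) (hα : ∀ j, ContDiffOn ℝ (2 * M : ℕ) (α j) (Set.Icc t₀ t))
    (hlam : 0 < lambdaMax Λ t₀ t) {s : ℝ} (hs : s ∈ Set.Icc (0 : ℝ) 1) {σ δ : ℝ}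
    (hσ : σ ∈ Set.Icc t₀ t) (hδ : |σ - (t₀ + s * (t - t₀))| ≤ δ) :
    ∑ l, |(t - t₀) * α l σ - ∑ i ∈ Finset.range (2 * M), scaledCoeff (α l) t₀ t i * s ^ i|
        * ‖Hs l‖
      ≤ L * (κ * (t - t₀) * (maxDeriv α t₀ t * δ))
        + (κ * lambdaMax Λ t₀ t * (t - t₀)) ^ (2 * M + 1) := by
  have h0 : 0 < t - t₀ := sub_pos.2 h
  have hκ0 : 0 < κ := zero_lt_one.trans_le hκ.1
  have hα1 (j : Fin L) : ContDiffOn ℝ 1 (α j) (Set.Icc t₀ t) :=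
    (hα j).of_le (by exact_mod_cast (by lia : 1 ≤ 2 * M))
  set τ := t₀ + s * (t - t₀)
  have rounding_le (l : Fin L) :
      (t - t₀) * |α l σ - α l τ| * ‖Hs l‖ ≤ κ * (t - t₀) * (maxDeriv α t₀ t * δ) := by
    have abs_sub_le : |α l σ - α l τ| ≤ maxDeriv α t₀ t * δ :=
      (abs_sub_le_maxDeriv_mul h hα1 l hσ (add_mul_sub_mem_Icc h.le hs)).trans
        (mul_le_mul_of_nonneg_left hδ (maxDeriv_nonneg α t₀ t))
    rw [mul_comm, ← mul_assoc]
    have norm_le := hκ.2.1 l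
    gcongr
  calc _ ≤ ∑ l, ((t - t₀) * |α l σ - α l τ| * ‖Hs l‖ + |(t - t₀) * α l τ
          - ∑ i ∈ Finset.range (2 * M), scaledCoeff (α l) t₀ t i * s ^ i| * ‖Hs l‖) := by
        refine Finset.sum_le_sum fun l _ => ?_
        rw [← add_mul, ← abs_of_pos h0, ← abs_mul, abs_of_pos h0, mul_sub]
        exact mul_le_mul_of_nonneg_right (abs_sub_le _ _ _) (norm_nonneg _)
    _ ≤ ∑ _l : Fin L, κ * (t - t₀) * (maxDeriv α t₀ t * δ)
          + (κ * lambdaMax Λ t₀ t * (t - t₀)) ^ (2 * M + 1) := by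
        rw [Finset.sum_add_distrib]
        exact add_le_add (Finset.sum_le_sum fun l _ => rounding_le l)
          (hκ.sum_abs_scaled_remainder_le hM h hα (by positivity) hs)
    _ = _ := by rw [Finset.sum_const, Finset.card_univ, Fintype.card_fin, nsmul_eq_mul]

lemma norm_meshProduct_sub_stepProd_le (hH : ∀ j, (Hs j).IsHermitian) {N k : ℕ} (hk : 0 < k)
    {c : Fin L → ℕ → ℝ} {q : ℕ → Fin (2 ^ nt)} {ε : ℝ}
    (hε : ∀ r < k, ∑ l, |(t - t₀) * α l (meshPoint t₀ t nt (q r))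
      - ∑ i ∈ Finset.range N, c l i * unitMidpoint k r ^ i| * ‖Hs l‖ ≤ ε) :
    ‖meshProduct Hs α t₀ t k q
      - stepProd (symStep N (fun l i => (c l i : ℂ)) ((-Complex.I) • Hs)) k ((k : ℂ)⁻¹)‖ ≤ ε := by
  have hk' : (0 : ℝ) < k := by exact_mod_cast hk
  have step_le : ∀ r < k,
      ‖phaseStep Hs (fun l => α l (meshPoint t₀ t nt (q r)) * ((t - t₀) / (2 * k)))
        - symStep N (fun l i => (c l i : ℂ)) ((-Complex.I) • Hs) r ((k : ℂ)⁻¹)‖ ≤ ε / k := by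
    intro r hr
    rw [symStep_inv_natCast]
    calc _ ≤ 2 * ∑ l, |(t - t₀) * α l (meshPoint t₀ t nt (q r))
            - ∑ i ∈ Finset.range N, c l i * unitMidpoint k r ^ i| / (2 * k) * ‖Hs l‖ := by
          refine (norm_phaseStep_sub_le hH _ _).trans_eq ?_
          congr! 3 with l
          rw [← abs_of_pos (by positivity : (0 : ℝ) < 2 * k), ← abs_div,
            abs_of_pos (by positivity : (0 : ℝ) < 2 * k), unitMidpoint]
          ring_nf
      _ ≤ ε / k := by
          simp only [div_mul_eq_mul_div]
          rw [← Finset.sum_div, ← mul_div_assoc, mul_div_mul_left _ _ two_ne_zero]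
          gcongr
          exact hε r hr
  rw [stepProd_apply, meshProduct]
  refine (norm_descProd_sub_le (fun r _ => norm_phaseStep_le_one hH _) (fun r _ => ?_)
    step_le).trans_eq (mul_div_cancel₀ _ hk'.ne')
  rw [symStep_inv_natCast]
  exact norm_phaseStep_le_one hH _

/-- The multiproduct formula of `meshProduct`s with step numbers `k` and weights `a`. -/
def meshMultiproduct (Hs : Fin L → QOp n) (α : Fin L → ℝ → ℝ) (t₀ t : ℝ) (k : Fin M → ℕ)
    (a : Fin M → ℝ) (q : Fin M → ℕ → Fin (2 ^ nt)) : QOp n :=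
  ∑ j, (a j : ℂ) • meshProduct Hs α t₀ t (k j) (q j)

lemma IsTermRatio.norm_meshMultiproduct_sub_multiproduct_le (hκ : IsTermRatio M Hs α Λ t₀ t κ)
    (hM : 0 < M) (h : t₀ < t) (hk : ∀ j, 0 < k j) (a : Fin M → ℝ)
    (hH : ∀ j, (Hs j).IsHermitian) (hα : ∀ j, ContDiffOn ℝ (2 * M : ℕ) (α j) (Set.Icc t₀ t))
    (hlam : 0 < lambdaMax Λ t₀ t)
    (hnt : Real.logb 2 (10 * (M : ℝ) ^ 2 * L * maxDeriv α t₀ t * (t - t₀) ^ 2 /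
        (41 * lambdaMax Λ t₀ t * (t - t₀)) ^ (2 * M + 1)) ≤ nt)
    (hq : IsMidpointRounding t₀ t k q) :
    ‖meshMultiproduct Hs α t₀ t k a q - multiproduct k a (symStep (2 * M)
        (fun l i => (scaledCoeff (α l) t₀ t i : ℂ)) ((-Complex.I) • Hs)) 1‖
      ≤ l1norm a * ((41 ^ (2 * M + 1) + 1)
          * (κ * lambdaMax Λ t₀ t * (t - t₀)) ^ (2 * M + 1)) := by
  have rounding_le := rounding_error_le hM (sub_pos.2 h) hlam hκ.1 (maxDeriv_nonneg α t₀ t) hnt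
  rw [meshMultiproduct, multiproduct, ← Finset.sum_sub_distrib, l1norm, Finset.sum_mul]
  refine (norm_sum_le _ _).trans (Finset.sum_le_sum fun j _ => ?_)
  rw [← smul_sub, norm_smul, Complex.norm_real, Real.norm_eq_abs, mul_one]
  refine mul_le_mul_of_nonneg_left (norm_meshProduct_sub_stepProd_le hH (hk j) fun r hr => ?_)
    (abs_nonneg _)
  rw [add_one_mul]
  exact (hκ.sum_abs_sub_scaledCoeff_le hM h hα hlam (unitMidpoint_mem_Icc hr)
    (meshPoint_mem_Icc h.le nt _) (hq j r hr)).trans (add_le_add_left rounding_le _)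

theorem IsTermRatio.norm_meshMultiproduct_sub_propagator_le (hκ : IsTermRatio M Hs α Λ t₀ t κ)
    (hM : 0 < M) (h : t₀ < t) (ha : IsMPF k a)
    (hH : ∀ j, (Hs j).IsHermitian) (hα : ∀ j, ContDiffOn ℝ (2 * M : ℕ) (α j) (Set.Icc t₀ t))
    (hlam : 0 < lambdaMax Λ t₀ t)
    (hnt : Real.logb 2 (10 * (M : ℝ) ^ 2 * L * maxDeriv α t₀ t * (t - t₀) ^ 2 /
        (41 * lambdaMax Λ t₀ t * (t - t₀)) ^ (2 * M + 1)) ≤ nt)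
    (hq : IsMidpointRounding t₀ t k q) {U : ℝ → QOp n}
    (hU : IsPropagator (hamiltonian Hs α) t₀ t U)
    (hx : κ * lambdaMax Λ t₀ t * (t - t₀) ≤ 1 / 2) :
    ‖meshMultiproduct Hs α t₀ t k a q - U t‖
      ≤ mpfConst M * (l1norm a * (κ * lambdaMax Λ t₀ t * (t - t₀)) ^ (2 * M + 1)) := by
  have hκ0 : 0 < κ := zero_lt_one.trans_le hκ.1
  have hx0 : 0 < κ * lambdaMax Λ t₀ t * (t - t₀) := by have := sub_pos.2 h; positivity
  have mesh_le := hκ.norm_meshMultiproduct_sub_multiproduct_le hM h ha.1 a hH hα hlam hnt hq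
  have multiproduct_le := norm_multiproduct_sub_sum_odeCoeff_le hM ha hx0 hx
    fun i hi => hκ.sum_norm_scaledCoeff_le h hi
  have propagator_le := hκ.norm_propagator_sub_sum_odeCoeff_le hM h hα hlam hx hU
  set x := κ * lambdaMax Λ t₀ t * (t - t₀)
  set P := multiproduct k a (symStep (2 * M) (fun l i => (scaledCoeff (α l) t₀ t i : ℂ))
    ((-Complex.I) • Hs)) 1
  set T := ∑ p ∈ Finset.range (2 * M + 1), odeCoeff (genCoeff (2 * M)
    (fun l i => (scaledCoeff (α l) t₀ t i : ℂ)) ((-Complex.I) • Hs)) p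
  have pow_le : x ^ (2 * M + 1) ≤ l1norm a * x ^ (2 * M + 1) :=
    le_mul_of_one_le_left (by positivity) (ha.one_le_l1norm hM)
  have propagator_le' : ‖T - U t‖
      ≤ 4 * ((2 * M * (2 * M + 1) + 2) * (l1norm a * x ^ (2 * M + 1))) := by
    rw [norm_sub_rev]
    exact propagator_le.trans (by gcongr)
  calc _ ≤ ‖meshMultiproduct Hs α t₀ t k a q - P‖ + (‖P - T‖ + ‖T - U t‖) :=
        (norm_sub_le_norm_sub_add_norm_sub _ P _).trans
          (add_le_add_right (norm_sub_le_norm_sub_add_norm_sub _ T _) _)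
    _ ≤ _ := add_le_add mesh_le (add_le_add multiproduct_le propagator_le')
    _ = _ := by rw [mpfConst]; ring

end MeshMultiproduct

section IsometricCompression

open scoped Matrix

variable {ι κ : Type*} [Fintype ι]

lemma mul_one_submatrix [DecidableEq ι] {μ : Type*} (A : Matrix μ ι ℂ) (f : κ → ι) :
    A * (1 : Matrix ι ι ℂ).submatrix id f = A.submatrix id f := by
  simpa using (Matrix.submatrix_mul A 1 id id f Function.bijective_id).symm

lemma conjTranspose_one_submatrix_mul [DecidableEq ι] {μ : Type*} (A : Matrix ι μ ℂ)
    (f : κ → ι) : ((1 : Matrix ι ι ℂ).submatrix id f)ᴴ * A = A.submatrix f id := by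
  rw [Matrix.conjTranspose_submatrix, Matrix.conjTranspose_one]
  simpa using (Matrix.submatrix_mul 1 A f id id Function.bijective_id).symm

variable [DecidableEq κ] {S : Matrix ι κ ℂ}

lemma mul_conjTranspose_mul_self [Fintype κ] (hS : Sᴴ * S = 1) :
    (S * Sᴴ) * (S * Sᴴ) = S * Sᴴ := by
  rw [Matrix.mul_assoc, ← Matrix.mul_assoc Sᴴ, hS, Matrix.one_mul]

variable [DecidableEq ι]

lemma one_sub_two_mul_mem_unitaryGroup [Fintype κ] (hS : Sᴴ * S = 1) :
    1 - 2 * (S * Sᴴ) ∈ Matrix.unitaryGroup ι ℂ := by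
  have isSelfAdjoint : star (1 - 2 * (S * Sᴴ)) = 1 - 2 * (S * Sᴴ) := by
    rw [star_sub, star_one, star_mul, Matrix.star_eq_conjTranspose, Matrix.conjTranspose_mul,
      Matrix.conjTranspose_conjTranspose]
    simp [two_mul, mul_two]
  rw [Matrix.mem_unitaryGroup_iff, isSelfAdjoint]
  calc _ = 1 - 4 * (S * Sᴴ) + 4 * ((S * Sᴴ) * (S * Sᴴ)) := by noncomm_ring
    _ = 1 := by rw [mul_conjTranspose_mul_self hS, sub_add_cancel]

lemma norm_conjTranspose_mul_mul_le_one [Fintype κ] [Nonempty κ] (hS : Sᴴ * S = 1)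
    {V : Matrix ι ι ℂ} (hV : V ∈ Matrix.unitaryGroup ι ℂ) : ‖Sᴴ * V * S‖ ≤ 1 := by
  have norm_le : ‖S‖ ≤ 1 := by
    have norm_sq := Matrix.l2_opNorm_conjTranspose_mul_self S
    rw [hS, CStarRing.norm_one] at norm_sq
    nlinarith [norm_nonneg S]
  have norm_V_le : ‖V‖ ≤ 1 := by
    cases isEmpty_or_nonempty ι
    · simp [Subsingleton.elim V 0]
    · exact (CStarRing.norm_of_mem_unitary hV).le
  refine (Matrix.l2_opNorm_mul _ _).trans (mul_le_one₀ ?_ (norm_nonneg _) norm_le)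
  refine (Matrix.l2_opNorm_mul _ _).trans (mul_le_one₀ ?_ (norm_nonneg _) norm_V_le)
  rwa [Matrix.l2_opNorm_conjTranspose]

lemma conjTranspose_mul_amplified_mul [Fintype κ] (hS : Sᴴ * S = 1) {V : Matrix ι ι ℂ}
    (hV : V ∈ Matrix.unitaryGroup ι ℂ) :
    Sᴴ * (V * (1 - 2 * (S * Sᴴ)) * Vᴴ * -(1 - 2 * (S * Sᴴ)) * V) * S
      = (3 : ℂ) • (Sᴴ * V * S)
        - (4 : ℂ) • ((Sᴴ * V * S) * star (Sᴴ * V * S) * (Sᴴ * V * S)) := by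
  have star_mul_self : Vᴴ * V = 1 := Matrix.mem_unitaryGroup_iff'.1 hV
  have mul_star_self : V * Vᴴ = 1 := Matrix.mem_unitaryGroup_iff.1 hV
  have expand (P : Matrix ι ι ℂ) : V * (1 - 2 * P) * Vᴴ * -(1 - 2 * P) * V
      = 2 * (P * V) + 2 * (V * P) - V - 4 * (V * P * Vᴴ * P * V) := by
    calc _ = -(V * Vᴴ * V) + 2 * (V * Vᴴ * (P * V)) + 2 * (V * P * (Vᴴ * V))
          - 4 * (V * P * Vᴴ * P * V) := by noncomm_ring
      _ = _ := by rw [mul_star_self, star_mul_self]; noncomm_ring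
  have compress_left : Sᴴ * (S * Sᴴ * V) * S = Sᴴ * V * S := by
    rw [← Matrix.mul_assoc, ← Matrix.mul_assoc, hS, Matrix.one_mul]
  have compress_right : Sᴴ * (V * (S * Sᴴ)) * S = Sᴴ * V * S := by
    simp only [Matrix.mul_assoc, hS, Matrix.mul_one]
  have compress_cubic : Sᴴ * (V * (S * Sᴴ) * Vᴴ * (S * Sᴴ) * V) * S
      = (Sᴴ * V * S) * star (Sᴴ * V * S) * (Sᴴ * V * S) := by
    simp only [Matrix.star_eq_conjTranspose, Matrix.conjTranspose_mul,
      Matrix.conjTranspose_conjTranspose, Matrix.mul_assoc]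
  rw [expand]
  simp only [← nsmul_eq_mul, ← Nat.cast_ofNat (R := Matrix ι ι ℂ), Matrix.mul_sub, Matrix.sub_mul,
    Matrix.mul_add, Matrix.add_mul, Matrix.mul_smul, Matrix.smul_mul, compress_left,
    compress_right, compress_cubic]
  module

end IsometricCompression

section RobustAmplification

variable {V : Type*} [NormedRing V] [StarRing V] [NormedAlgebra ℂ V]
  [StarModule ℂ V] {u : V}

lemma three_smul_sub_four_smul_smul_eq (hu : star u * u = 1) (σ : ℝ) :
    (3 : ℂ) • ((σ : ℂ) • u) - (4 : ℂ) • (((σ : ℂ) • u) * star ((σ : ℂ) • u) * ((σ : ℂ) • u))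
      = ((3 * σ - 4 * σ ^ 3 : ℝ) : ℂ) • u := by
  rw [star_smul, smul_mul_smul_comm, smul_mul_smul_comm, mul_assoc u, hu, mul_one, smul_smul,
    smul_smul, ← sub_smul]
  congr 1
  simp only [Complex.star_def, Complex.conj_ofReal]
  push_cast
  ring

lemma norm_three_smul_sub_four_smul_sub_le [CStarRing V] [Nontrivial V] {A : V}
    (hA : ‖A‖ ≤ 1) (hu : star u * u = 1) {σ : ℝ} (hσ : |σ| ≤ 1) {ε : ℝ}
    (h : ‖A - (σ : ℂ) • u‖ ≤ ε) :
    ‖((3 : ℂ) • A - (4 : ℂ) • (A * star A * A)) - ((3 * σ - 4 * σ ^ 3 : ℝ) : ℂ) • u‖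
      ≤ 15 * ε := by
  rw [← three_smul_sub_four_smul_smul_eq hu]
  set B := (σ : ℂ) • u
  have norm_B_le : ‖B‖ ≤ 1 := by
    rw [norm_smul, Complex.norm_real, Real.norm_eq_abs]
    exact mul_le_one₀ hσ (norm_nonneg _) (norm_le_one_of_star_mul_self_eq_one hu)
  have norm_star_sub_le : ‖star A - star B‖ ≤ ε := by rwa [← star_sub, norm_star]
  have norm_mul_star_B_le : ‖B * star B‖ ≤ 1 :=
    (norm_mul_le _ _).trans (mul_le_one₀ norm_B_le (norm_nonneg _) (by rwa [norm_star]))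
  have cubic_le : ‖A * star A * A - B * star B * B‖ ≤ ε + ε + ε :=
    (norm_mul_sub_mul_le hA norm_mul_star_B_le).trans (add_le_add
      ((norm_mul_sub_mul_le (by rwa [norm_star]) norm_B_le).trans
        (add_le_add h norm_star_sub_le)) h)
  calc _ = ‖(3 : ℂ) • (A - B) - (4 : ℂ) • (A * star A * A - B * star B * B)‖ := by
        congr 1; module
    _ ≤ 3 * ‖A - B‖ + 4 * ‖A * star A * A - B * star B * B‖ :=
        (norm_sub_le _ _).trans_eq (by simp [norm_smul])
    _ ≤ 3 * ε + 4 * (ε + ε + ε) := by gcongr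
    _ = 15 * ε := by ring

end RobustAmplification

section Circuits

open scoped Matrix Kronecker

variable {w L nt m b n : ℕ}

lemma Circuit.eval_append (Uα : Matrix (CoeffIdx L nt m b) (CoeffIdx L nt m b) ℂ)
    (UH : Matrix (HamIdx L b n) (HamIdx L b n) ℂ) (c d : Circuit w L nt m b n) :
    Circuit.eval Uα UH (c ++ d) = Circuit.eval Uα UH d * Circuit.eval Uα UH c := by
  induction c with
  | nil => simp [Circuit.eval]
  | cons g c ih => simp only [List.cons_append, Circuit.eval, ih, mul_assoc]

lemma Circuit.queries_append (c d : Circuit w L nt m b n) :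
    Circuit.queries (c ++ d) = Circuit.queries c + Circuit.queries d := by
  simp [Circuit.queries]

lemma Circuit.queries_cons (g : Gate w L nt m b n) (c : Circuit w L nt m b n) :
    Circuit.queries (g :: c) = g.queries + Circuit.queries c := by
  simp [Circuit.queries]

lemma Circuit.queries_flatMap {ι : Type*} {f : ι → Circuit w L nt m b n} {N : ℕ}
    (h : ∀ i, (f i).queries = N) (l : List ι) :
    Circuit.queries (l.flatMap f) = l.length * N := by
  induction l with
  | nil => simp [Circuit.queries]
  | cons i l ih =>
    rw [List.flatMap_cons, Circuit.queries_append, h, ih, List.length_cons, Nat.succ_mul, add_comm]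

/-- The gate inverse to `g` when `U_α` is self-inverse. -/
def Gate.adj : Gate w L nt m b n → Gate w L nt m b n
  | .free G => .free G⁻¹
  | .coeff => .coeff
  | .ham => .hamInv
  | .hamInv => .ham

/-- The circuit inverse to `c` when `U_α` is self-inverse. -/
def Circuit.adj (c : Circuit w L nt m b n) : Circuit w L nt m b n := (c.map Gate.adj).reverse

lemma Circuit.adj_cons (g : Gate w L nt m b n) (c : Circuit w L nt m b n) :
    Circuit.adj (g :: c) = c.adj ++ [g.adj] := by
  simp [Circuit.adj]

lemma Gate.queries_adj (g : Gate w L nt m b n) : g.adj.queries = g.queries := by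
  cases g <;> rfl

lemma Circuit.queries_adj (c : Circuit w L nt m b n) :
    Circuit.queries c.adj = Circuit.queries c := by
  simp [Circuit.queries, Circuit.adj, Function.comp_def, Gate.queries_adj, List.sum_reverse]

lemma liftCoeff_conjTranspose (U : Matrix (CoeffIdx L nt m b) (CoeffIdx L nt m b) ℂ) :
    (liftCoeff w n U)ᴴ = liftCoeff w n Uᴴ := by
  ext ⟨w₁, j, q, s, v, x⟩ ⟨w₂, j', q', s', v', x'⟩
  simp only [Matrix.conjTranspose_apply, liftCoeff, Matrix.of_apply, eq_comm (a := w₂),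
    eq_comm (a := x')]
  split_ifs <;> simp

lemma liftHam_conjTranspose (U : Matrix (HamIdx L b n) (HamIdx L b n) ℂ) :
    (liftHam w nt m U)ᴴ = liftHam w nt m Uᴴ := by
  ext ⟨w₁, j, q, s, v, x⟩ ⟨w₂, j', q', s', v', x'⟩
  simp only [Matrix.conjTranspose_apply, liftHam, Matrix.of_apply, eq_comm (a := w₂),
    eq_comm (a := q'), eq_comm (a := s')]
  split_ifs <;> simp

/-- The reordering of the registers that puts those of `U_α` last. -/
def coeffEquiv (w L nt m b n : ℕ) :
    FullIdx w L nt m b n ≃ (Fin (2 ^ w) × Fin (2 ^ n)) × CoeffIdx L nt m b where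
  toFun f := ((f.1, f.2.2.2.2.2), (f.2.1, f.2.2.1, f.2.2.2.1, f.2.2.2.2.1))
  invFun g := (g.1.1, g.2.1, g.2.2.1, g.2.2.2.1, g.2.2.2.2, g.1.2)

/-- The reordering of the registers that puts those of `U_H` last. -/
def hamEquiv (w L nt m b n : ℕ) :
    FullIdx w L nt m b n ≃ (Fin (2 ^ w) × Fin (2 ^ nt) × Fin (2 ^ m)) × HamIdx L b n where
  toFun f := ((f.1, f.2.2.1, f.2.2.2.1), (f.2.1, f.2.2.2.2.1, f.2.2.2.2.2))
  invFun g := (g.1.1, g.2.1, g.1.2.1, g.1.2.2, g.2.2.1, g.2.2.2)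

lemma submatrix_kronecker_mem_unitaryGroup {ι κ ν : Type*} [Fintype ι] [DecidableEq ι]
    [Finite κ] [DecidableEq κ] [Fintype ν] [DecidableEq ν] (e : ι ≃ κ × ν) {U : Matrix ν ν ℂ}
    (hU : U ∈ Matrix.unitaryGroup ν ℂ) :
    ((1 : Matrix κ κ ℂ) ⊗ₖ U).submatrix e e ∈ Matrix.unitaryGroup ι ℂ := by
  have := Fintype.ofFinite κ
  have mem := Matrix.kronecker_mem_unitary (one_mem (Matrix.unitaryGroup κ ℂ)) hU
  rw [Matrix.mem_unitaryGroup_iff] at mem ⊢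
  rw [Matrix.star_eq_conjTranspose, Matrix.conjTranspose_submatrix, Matrix.submatrix_mul_equiv,
    ← Matrix.star_eq_conjTranspose, mem, Matrix.submatrix_one_equiv]

lemma liftCoeff_mem_unitaryGroup {U : Matrix (CoeffIdx L nt m b) (CoeffIdx L nt m b) ℂ}
    (hU : U ∈ Matrix.unitaryGroup _ ℂ) :
    liftCoeff w n U ∈ Matrix.unitaryGroup (FullIdx w L nt m b n) ℂ := by
  convert submatrix_kronecker_mem_unitaryGroup (coeffEquiv w L nt m b n) hU using 1
  ext ⟨w₁, j, q, s, v, x⟩ ⟨w₂, j', q', s', v', x'⟩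
  simp [liftCoeff, coeffEquiv, Matrix.one_apply]

lemma liftHam_mem_unitaryGroup {U : Matrix (HamIdx L b n) (HamIdx L b n) ℂ}
    (hU : U ∈ Matrix.unitaryGroup _ ℂ) :
    liftHam w nt m U ∈ Matrix.unitaryGroup (FullIdx w L nt m b n) ℂ := by
  convert submatrix_kronecker_mem_unitaryGroup (hamEquiv w L nt m b n) hU using 1
  ext ⟨w₁, j, q, s, v, x⟩ ⟨w₂, j', q', s', v', x'⟩
  simp [liftHam, hamEquiv, Matrix.one_apply]

variable {Uα : Matrix (CoeffIdx L nt m b) (CoeffIdx L nt m b) ℂ}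
  {UH : Matrix (HamIdx L b n) (HamIdx L b n) ℂ}

lemma Gate.eval_mem_unitaryGroup (hα : Uα ∈ Matrix.unitaryGroup _ ℂ)
    (hH : UH ∈ Matrix.unitaryGroup _ ℂ) (g : Gate w L nt m b n) :
    g.eval Uα UH ∈ Matrix.unitaryGroup (FullIdx w L nt m b n) ℂ := by
  cases g with
  | free G => exact G.2
  | coeff => exact liftCoeff_mem_unitaryGroup hα
  | ham => exact liftHam_mem_unitaryGroup hH
  | hamInv => exact liftHam_mem_unitaryGroup (Unitary.star_mem hH)

lemma Circuit.eval_mem_unitaryGroup (hα : Uα ∈ Matrix.unitaryGroup _ ℂ)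
    (hH : UH ∈ Matrix.unitaryGroup _ ℂ) (c : Circuit w L nt m b n) :
    Circuit.eval Uα UH c ∈ Matrix.unitaryGroup (FullIdx w L nt m b n) ℂ := by
  induction c with
  | nil => exact one_mem _
  | cons g c ih => exact mul_mem ih (Gate.eval_mem_unitaryGroup hα hH g)

lemma Gate.eval_adj (hα : Uα.IsHermitian) (g : Gate w L nt m b n) :
    g.adj.eval Uα UH = (g.eval Uα UH)ᴴ := by
  cases g with
  | free G => rfl
  | coeff => rw [Gate.adj, Gate.eval, liftCoeff_conjTranspose, hα.eq]
  | ham => rw [Gate.adj, Gate.eval, Gate.eval, liftHam_conjTranspose]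
  | hamInv =>
    rw [Gate.adj, Gate.eval, Gate.eval, liftHam_conjTranspose, Matrix.conjTranspose_conjTranspose]

lemma Circuit.eval_adj (hα : Uα.IsHermitian) (c : Circuit w L nt m b n) :
    Circuit.eval Uα UH c.adj = (Circuit.eval Uα UH c)ᴴ := by
  induction c with
  | nil => simp [Circuit.adj, Circuit.eval]
  | cons g c ih =>
    rw [Circuit.adj_cons, Circuit.eval_append, ih, Circuit.eval, Circuit.eval, Circuit.eval,
      one_mul, Gate.eval_adj hα, Matrix.conjTranspose_mul]

lemma IsCoeffOracle.isHermitian {enc : Fin L → Fin (2 ^ nt) → Fin (2 ^ m) → Fin (2 ^ b)}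
    (h : IsCoeffOracle enc Uα) : Uα.IsHermitian :=
  left_inv_eq_right_inv (Matrix.mem_unitaryGroup_iff'.1 h.1) h.2.1

end Circuits

section Block

variable {w L nt m b n : ℕ}

/-- The isometry `|ψ⟩ ↦ |w₀⟩|j⟩|q⟩|s⟩|v⟩|ψ⟩`. -/
def slice (n : ℕ) (w₀ : Fin (2 ^ w)) (j : Fin L) (q : Fin (2 ^ nt)) (s : Fin (2 ^ m))
    (v : Fin (2 ^ b)) : Matrix (FullIdx w L nt m b n) (Fin (2 ^ n)) ℂ :=
  (1 : Matrix _ _ ℂ).submatrix id fun x => (w₀, j, q, s, v, x)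

variable [NeZero L]

/-- The isometry `|ψ⟩ ↦ |w₀⟩|0⟩|0⟩|0⟩|0⟩|ψ⟩`. -/
def workSlice (w L nt m b n : ℕ) [NeZero L] (w₀ : Fin (2 ^ w)) :
    Matrix (FullIdx w L nt m b n) (Fin (2 ^ n)) ℂ :=
  slice n w₀ 0 0 0 0

lemma conjTranspose_workSlice_mul_workSlice (w₁ w₂ : Fin (2 ^ w)) :
    (workSlice w L nt m b n w₁).conjTranspose * workSlice w L nt m b n w₂
      = if w₁ = w₂ then 1 else 0 := by
  rw [workSlice, workSlice, slice, slice, Matrix.conjTranspose_submatrix, Matrix.conjTranspose_one,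
    mul_one_submatrix]
  ext x y
  split_ifs with h <;> simp [h, Matrix.one_apply]

lemma conjTranspose_workSlice_mul_self (w₀ : Fin (2 ^ w)) :
    (workSlice w L nt m b n w₀).conjTranspose * workSlice w L nt m b n w₀ = 1 := by
  rw [conjTranspose_workSlice_mul_workSlice, if_pos rfl]

lemma block_eq (A : Matrix (FullIdx w L nt m b n) (FullIdx w L nt m b n) ℂ) :
    block A = (workSlice w L nt m b n 0).conjTranspose * A * workSlice w L nt m b n 0 := by
  rw [workSlice, slice, conjTranspose_one_submatrix_mul, mul_one_submatrix]
  rfl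

/-- One round of oblivious amplitude amplification of the block `A` of `c`: the circuit
`V (1 - 2 P) V⁻¹ (2 P - 1) V`, where `P` is the projection onto the all-zero state of the ancillas,
has the block `3 A - 4 A A* A`. -/
def amplify (c : Circuit w L nt m b n) : Circuit w L nt m b n :=
  let R : Matrix.unitaryGroup (FullIdx w L nt m b n) ℂ :=
    ⟨_, one_sub_two_mul_mem_unitaryGroup (conjTranspose_workSlice_mul_self (0 : Fin (2 ^ w)))⟩
  c ++ .free (-R) :: (c.adj ++ .free R :: c)

lemma queries_amplify (c : Circuit w L nt m b n) : (amplify c).queries = 3 * c.queries := by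
  simp only [amplify, Circuit.queries_append, Circuit.queries_cons, Circuit.queries_adj,
    Gate.queries]
  ring

lemma queries_iterate_amplify (c : Circuit w L nt m b n) (d : ℕ) :
    (amplify^[d] c).queries = 3 ^ d * c.queries := by
  induction d with
  | zero => simp
  | succ d ih => rw [Function.iterate_succ_apply', queries_amplify, ih]; ring

variable {Uα : Matrix (CoeffIdx L nt m b) (CoeffIdx L nt m b) ℂ}
  {UH : Matrix (HamIdx L b n) (HamIdx L b n) ℂ}

lemma norm_block_eval_le_one (hα : Uα ∈ Matrix.unitaryGroup _ ℂ)
    (hH : UH ∈ Matrix.unitaryGroup _ ℂ) (c : Circuit w L nt m b n) :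
    ‖block (c.eval Uα UH)‖ ≤ 1 := by
  rw [block_eq]
  exact norm_conjTranspose_mul_mul_le_one (conjTranspose_workSlice_mul_self (0 : Fin (2 ^ w)))
    (Circuit.eval_mem_unitaryGroup hα hH c)

variable {enc : Fin L → Fin (2 ^ nt) → Fin (2 ^ m) → Fin (2 ^ b)}

lemma block_eval_amplify (hα : IsCoeffOracle enc Uα) (hH : UH ∈ Matrix.unitaryGroup _ ℂ)
    (c : Circuit w L nt m b n) :
    block ((amplify c).eval Uα UH) = (3 : ℂ) • block (c.eval Uα UH)
      - (4 : ℂ) • (block (c.eval Uα UH) * star (block (c.eval Uα UH))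
        * block (c.eval Uα UH)) := by
  simp only [amplify, Circuit.eval_append, Circuit.eval, Circuit.eval_adj hα.isHermitian, block_eq]
  exact conjTranspose_mul_amplified_mul (conjTranspose_workSlice_mul_self (0 : Fin (2 ^ w)))
    (Circuit.eval_mem_unitaryGroup hα.1 hH c)

-- One round maps `sin θ` to `3 sin θ - 4 sin³ θ = sin 3θ`, so `d` rounds turn `π / (2 · 3 ^ d)`
-- into `π / 2`.
lemma norm_block_eval_iterate_amplify_sub_le (hα : IsCoeffOracle enc Uα)
    (hH : UH ∈ Matrix.unitaryGroup _ ℂ) (c : Circuit w L nt m b n) {U : QOp n}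
    (hU : star U * U = 1) {ε : ℝ} {d : ℕ}
    (h : ‖block (c.eval Uα UH) - (Real.sin (Real.pi / (2 * 3 ^ d)) : ℂ) • U‖ ≤ ε) :
    ‖block ((amplify^[d] c).eval Uα UH) - U‖ ≤ 15 ^ d * ε := by
  have iterate_le (i : ℕ) : ‖block ((amplify^[i] c).eval Uα UH)
      - ((Real.sin (3 ^ i * (Real.pi / (2 * 3 ^ d))) : ℝ) : ℂ) • U‖ ≤ 15 ^ i * ε := by
    induction i with
    | zero => simpa using h
    | succ i ih =>
      rw [Function.iterate_succ_apply', block_eval_amplify hα hH, pow_succ', mul_assoc 3,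
        Real.sin_three_mul, pow_succ' 15, mul_assoc 15]
      exact norm_three_smul_sub_four_smul_sub_le (norm_block_eval_le_one hα.1 hH _) hU
        (Real.abs_sin_le_one _) ih
  have angle : (3 : ℝ) ^ d * (Real.pi / (2 * 3 ^ d)) = Real.pi / 2 := by field_simp
  have final := iterate_le d
  rw [angle, Real.sin_pi_div_two] at final
  simpa using final

end Block

section Select

variable {w L nt m b n : ℕ}

/-- The unitary `|i⟩ ↦ |σ⁻¹ i⟩` permuting the basis labels. -/
def permGate {ι : Type*} [Fintype ι] [DecidableEq ι] (σ : Equiv.Perm ι) :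
    Matrix.unitaryGroup ι ℂ :=
  ⟨(1 : Matrix ι ι ℂ).submatrix id σ, by
    rw [Matrix.mem_unitaryGroup_iff, Matrix.star_eq_conjTranspose, Matrix.conjTranspose_submatrix,
      Matrix.submatrix_mul_equiv, Matrix.conjTranspose_one, one_mul, Matrix.submatrix_id_id]⟩

lemma permGate_mul_slice {σ : Equiv.Perm (FullIdx w L nt m b n)} {w₀ : Fin (2 ^ w)} {j j' : Fin L}
    {q q' : Fin (2 ^ nt)} {s s' : Fin (2 ^ m)} {v : Fin (2 ^ b)}
    (h : ∀ x, σ (w₀, j, q, s, v, x) = (w₀, j', q', s', v, x)) :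
    (permGate σ).1 * slice n w₀ j q s v = slice n w₀ j' q' s' v := by
  rw [slice, mul_one_submatrix]
  rw [permGate, slice, Matrix.submatrix_submatrix, Function.id_comp]
  exact congrArg _ (funext h)

lemma liftCoeff_mul_slice {Uα : Matrix (CoeffIdx L nt m b) (CoeffIdx L nt m b) ℂ} {j : Fin L}
    {q : Fin (2 ^ nt)} {s : Fin (2 ^ m)} {v v' : Fin (2 ^ b)}
    (h : Uα.mulVec (Pi.single (j, q, s, v) 1) = Pi.single (j, q, s, v') 1) (w₀ : Fin (2 ^ w)) :
    liftCoeff w n Uα * slice n w₀ j q s v = slice n w₀ j q s v' := by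
  rw [slice, mul_one_submatrix]
  ext ⟨w₁, j₁, q₁, s₁, v₁, y⟩ x
  have column := congrFun h (j₁, q₁, s₁, v₁)
  rw [Matrix.mulVec_single_one, Matrix.col_apply] at column
  simp only [liftCoeff, slice, Matrix.submatrix_apply, Matrix.of_apply, Matrix.one_apply, id_eq,
    column, Pi.single_apply, Prod.mk.injEq, ← ite_and]
  exact if_congr (by tauto) rfl rfl

lemma IsCoeffOracle.mulVec_enc {enc : Fin L → Fin (2 ^ nt) → Fin (2 ^ m) → Fin (2 ^ b)}
    {Uα : Matrix (CoeffIdx L nt m b) (CoeffIdx L nt m b) ℂ} (h : IsCoeffOracle enc Uα) (j : Fin L)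
    (q : Fin (2 ^ nt)) (s : Fin (2 ^ m)) :
    Uα.mulVec (Pi.single (j, q, s, enc j q s) 1) = Pi.single (j, q, s, 0) 1 := by
  rw [← h.2.2 j q s, Matrix.mulVec_mulVec, h.2.1, Matrix.one_mulVec]

lemma tensorState_single (j : Fin L) (v : Fin (2 ^ b)) (x : Fin (2 ^ n)) :
    tensorState j v (Pi.single x 1) = Pi.single (j, v, x) 1 := by
  ext ⟨j', v', x'⟩
  simp only [tensorState, Pi.single_apply, Prod.mk.injEq, ← ite_and, and_assoc]

lemma slice_mul_apply (w₀ w₁ : Fin (2 ^ w)) (j j₁ : Fin L) (q q₁ : Fin (2 ^ nt))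
    (s s₁ : Fin (2 ^ m)) (v v₁ : Fin (2 ^ b)) (E : QOp n) (x y : Fin (2 ^ n)) :
    (slice n w₀ j q s v * E) (w₁, j₁, q₁, s₁, v₁, y) x
      = if w₁ = w₀ ∧ j₁ = j ∧ q₁ = q ∧ s₁ = s ∧ v₁ = v then E y x else 0 := by
  simp [Matrix.mul_apply, slice, Matrix.one_apply, ite_and]

lemma liftHam_mul_slice {UH : Matrix (HamIdx L b n) (HamIdx L b n) ℂ} {j : Fin L} {v : Fin (2 ^ b)}
    {E : QOp n} (h : ∀ ψ, UH.mulVec (tensorState j v ψ) = tensorState j v (E.mulVec ψ))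
    (w₀ : Fin (2 ^ w)) (q : Fin (2 ^ nt)) (s : Fin (2 ^ m)) :
    liftHam w nt m UH * slice n w₀ j q s v = slice n w₀ j q s v * E := by
  ext ⟨w₁, j₁, q₁, s₁, v₁, y⟩ x
  have column := congrFun (h (Pi.single x 1)) (j₁, v₁, y)
  rw [tensorState_single, Matrix.mulVec_single_one, Matrix.mulVec_single_one,
    Matrix.col_apply] at column
  rw [slice_mul_apply, slice, mul_one_submatrix]
  simp only [liftHam, Matrix.submatrix_apply, Matrix.of_apply, id_eq, column, tensorState,
    Matrix.col_apply, ← ite_and]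
  exact if_congr (by tauto) rfl rfl

variable [NeZero L]

/-- The permutation exchanging the label `0` of the registers `|j⟩|q⟩|τ⟩` with the label `p w₀`
when the work qubits are in the state `|w₀⟩`. -/
def loadPerm (b n : ℕ) (p : Fin (2 ^ w) → Fin L × Fin (2 ^ nt) × Fin (2 ^ m)) :
    Equiv.Perm (FullIdx w L nt m b n) :=
  Function.Involutive.toPerm
    (fun f =>
      let r := Equiv.swap (0, 0, 0) (p f.1) (f.2.1, f.2.2.1, f.2.2.2.1)
      (f.1, r.1, r.2.1, r.2.2, f.2.2.2.2))
    fun f => by simp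

lemma permGate_loadPerm_mul_workSlice (p : Fin (2 ^ w) → Fin L × Fin (2 ^ nt) × Fin (2 ^ m))
    (w₀ : Fin (2 ^ w)) :
    (permGate (loadPerm b n p)).1 * workSlice w L nt m b n w₀
      = slice n w₀ (p w₀).1 (p w₀).2.1 (p w₀).2.2 0 :=
  permGate_mul_slice fun x => by simp [loadPerm, Function.Involutive.toPerm]

lemma permGate_loadPerm_mul_slice (p : Fin (2 ^ w) → Fin L × Fin (2 ^ nt) × Fin (2 ^ m))
    (w₀ : Fin (2 ^ w)) :
    (permGate (loadPerm b n p)).1 * slice (b := b) n w₀ (p w₀).1 (p w₀).2.1 (p w₀).2.2 0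
      = workSlice w L nt m b n w₀ :=
  permGate_mul_slice fun x => by simp [loadPerm, Function.Involutive.toPerm]

/-- The exponential of the term of the Hamiltonian, at the mesh point and for the time step, that
the work qubits select through `p`. The second query to `U_α` clears the value register. -/
def expCircuit (b n : ℕ) (p : Fin (2 ^ w) → Fin L × Fin (2 ^ nt) × Fin (2 ^ m)) :
    Circuit w L nt m b n :=
  [.free (permGate (loadPerm b n p)), .coeff, .ham, .coeff, .free (permGate (loadPerm b n p))]

/-- `c` applies `T w₀` to the system if the work qubits are in the state `|w₀⟩` and all other
registers are zero, and preserves the state of these registers. -/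
def Acts (Uα : Matrix (CoeffIdx L nt m b) (CoeffIdx L nt m b) ℂ)
    (UH : Matrix (HamIdx L b n) (HamIdx L b n) ℂ) (c : Circuit w L nt m b n)
    (T : Fin (2 ^ w) → QOp n) : Prop :=
  ∀ w₀, Circuit.eval Uα UH c * workSlice w L nt m b n w₀ = workSlice w L nt m b n w₀ * T w₀

variable {Uα : Matrix (CoeffIdx L nt m b) (CoeffIdx L nt m b) ℂ}
  {UH : Matrix (HamIdx L b n) (HamIdx L b n) ℂ}

lemma Acts.nil : Acts Uα UH ([] : Circuit w L nt m b n) fun _ => 1 := fun w₀ => by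
  rw [Circuit.eval, Matrix.one_mul, Matrix.mul_one]

lemma Acts.append {c d : Circuit w L nt m b n} {S T : Fin (2 ^ w) → QOp n} (hc : Acts Uα UH c S)
    (hd : Acts Uα UH d T) : Acts Uα UH (c ++ d) fun w₀ => T w₀ * S w₀ := fun w₀ => by
  rw [Circuit.eval_append, Matrix.mul_assoc, hc, ← Matrix.mul_assoc, hd, Matrix.mul_assoc]

lemma Acts.flatMap {ι : Type*} {f : ι → Circuit w L nt m b n} {T : ι → Fin (2 ^ w) → QOp n}
    (h : ∀ i, Acts Uα UH (f i) (T i)) (l : List ι) :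
    Acts Uα UH (l.flatMap f) fun w₀ => (l.reverse.map fun i => T i w₀).prod := by
  induction l with
  | nil => exact Acts.nil
  | cons i l ih => simpa using (h i).append ih

variable {Hs : Fin L → QOp n} {val : Fin (2 ^ b) → ℝ}
  {enc : Fin L → Fin (2 ^ nt) → Fin (2 ^ m) → Fin (2 ^ b)}

lemma acts_expCircuit (hα : IsCoeffOracle enc Uα) (hH : IsHamOracle Hs val enc UH)
    (p : Fin (2 ^ w) → Fin L × Fin (2 ^ nt) × Fin (2 ^ m)) :
    Acts Uα UH (expCircuit b n p) fun w₀ =>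
      NormedSpace.exp ((-(Complex.I *
        (val (enc (p w₀).1 (p w₀).2.1 (p w₀).2.2) : ℂ))) • Hs (p w₀).1) := by
  intro w₀
  simp only [expCircuit, Circuit.eval, Gate.eval, Matrix.one_mul, Matrix.mul_assoc]
  rw [permGate_loadPerm_mul_workSlice, liftCoeff_mul_slice (hα.2.2 _ _ _),
    liftHam_mul_slice (hH.2 _ _ _), ← Matrix.mul_assoc (liftCoeff w n Uα),
    liftCoeff_mul_slice (hα.mulVec_enc _ _ _), ← Matrix.mul_assoc (permGate (loadPerm b n p)).1,
    permGate_loadPerm_mul_slice]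

/-- One symmetric product step, at the mesh point `q w₀` and for the time step `s w₀` selected by
the work qubits. -/
def stepCircuit (b n : ℕ) (q : Fin (2 ^ w) → Fin (2 ^ nt)) (s : Fin (2 ^ w) → Fin (2 ^ m)) :
    Circuit w L nt m b n :=
  (palindrome L).flatMap fun l => expCircuit b n fun w₀ => (l, q w₀, s w₀)

/-- The product formula with `R` symmetric steps, at mesh points and for time steps selected by the
work qubits. -/
def selectCircuit (b n : ℕ) (q : Fin (2 ^ w) → ℕ → Fin (2 ^ nt))
    (s : Fin (2 ^ w) → ℕ → Fin (2 ^ m)) (R : ℕ) : Circuit w L nt m b n :=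
  (List.range R).flatMap fun r => stepCircuit b n (q · r) (s · r)

lemma queries_stepCircuit (q : Fin (2 ^ w) → Fin (2 ^ nt)) (s : Fin (2 ^ w) → Fin (2 ^ m)) :
    (stepCircuit b n q s : Circuit w L nt m b n).queries = 6 * L := by
  rw [stepCircuit, Circuit.queries_flatMap (N := 3) fun _ => rfl]
  simp only [palindrome, List.length_append, List.length_reverse, List.length_finRange]
  ring

lemma queries_selectCircuit (q : Fin (2 ^ w) → ℕ → Fin (2 ^ nt))
    (s : Fin (2 ^ w) → ℕ → Fin (2 ^ m)) (R : ℕ) :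
    (selectCircuit b n q s R : Circuit w L nt m b n).queries = R * (6 * L) := by
  rw [selectCircuit, Circuit.queries_flatMap fun _ => queries_stepCircuit _ _, List.length_range]

variable {α : Fin L → ℝ → ℝ} {t₀ t : ℝ} {dur : Fin (2 ^ m) → ℝ}

lemma acts_stepCircuit (hα : IsCoeffOracle enc Uα) (hH : IsHamOracle Hs val enc UH)
    (henc : IsEncoding α t₀ t dur val enc) (q : Fin (2 ^ w) → Fin (2 ^ nt))
    (s : Fin (2 ^ w) → Fin (2 ^ m)) :
    Acts Uα UH (stepCircuit b n q s) fun w₀ =>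
      phaseStep Hs fun l => α l (meshPoint t₀ t nt (q w₀)) * dur (s w₀) := by
  have acts := Acts.flatMap (fun l => acts_expCircuit hα hH fun w₀ => (l, q w₀, s w₀))
    (palindrome L)
  simp only [reverse_palindrome, henc _ _ _] at acts
  exact acts

lemma acts_selectCircuit (hα : IsCoeffOracle enc Uα) (hH : IsHamOracle Hs val enc UH)
    (henc : IsEncoding α t₀ t dur val enc) (q : Fin (2 ^ w) → ℕ → Fin (2 ^ nt))
    (s : Fin (2 ^ w) → ℕ → Fin (2 ^ m)) (R : ℕ) :
    Acts Uα UH (selectCircuit b n q s R) fun w₀ => descProd (fun r =>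
      phaseStep Hs fun l => α l (meshPoint t₀ t nt (q w₀ r)) * dur (s w₀ r)) R :=
  Acts.flatMap (fun _ => acts_stepCircuit hα hH henc _ _) _

end Select

section LinearCombination

variable {ι : Type*} [Fintype ι] [DecidableEq ι]

lemma exists_unitary_column (i₀ : ι) {v : ι → ℝ} (hv : ∑ i, v i ^ 2 = 1) :
    ∃ G : Matrix.unitaryGroup ι ℂ, ∀ i, G.1 i i₀ = v i := by
  set x : EuclideanSpace ℂ ι := WithLp.toLp 2 fun i => (v i : ℂ)
  have norm_eq : ‖x‖ = 1 := by
    rw [EuclideanSpace.norm_eq, Real.sqrt_eq_one]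
    simpa [x] using hv
  have orthonormal : Orthonormal ℂ (({i₀} : Set ι).domRestrict fun _ => x) := by
    rw [orthonormal_subsingleton_iff]
    exact fun _ => norm_eq
  obtain ⟨B, hB⟩ := orthonormal.exists_orthonormalBasis_extension_of_card_eq (by simp)
  refine ⟨⟨_, (EuclideanSpace.basisFun ι ℂ).toMatrix_orthonormalBasis_mem_unitary B⟩,
    fun i => ?_⟩
  change (EuclideanSpace.basisFun ι ℂ).toBasis.toMatrix B i i₀ = v i
  rw [Module.Basis.toMatrix_apply, hB i₀ rfl]
  simp [x]

lemma sum_update_sq {f : ι → ℝ} {p : ι} (hp : f p = 0) (r : ℝ) :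
    ∑ i, Function.update f p r i ^ 2 = r ^ 2 + ∑ i, f i ^ 2 := by
  rw [← Finset.add_sum_erase _ _ (Finset.mem_univ p),
    ← Finset.add_sum_erase _ (f · ^ 2) (Finset.mem_univ p), Function.update_self, hp,
    zero_pow two_ne_zero, zero_add]
  congr 1
  exact Finset.sum_congr rfl fun i hi => by rw [Function.update_of_ne (Finset.ne_of_mem_erase hi)]

-- The columns are `√|c|` and `sign c * √|c|`; the missing norm is put on the two distinct labels
-- `p` and `p'`, so that it does not contribute to the products.
lemma exists_unitary_star_mul_eq (i₀ : ι) {c : ι → ℝ} {p p' : ι} (hne : p ≠ p') (hp : c p = 0)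
    (hp' : c p' = 0) (hc : ∑ i, |c i| ≤ 1) :
    ∃ F G : Matrix.unitaryGroup ι ℂ, ∀ i, star (G.1 i i₀) * F.1 i i₀ = c i := by
  set f : ι → ℝ := fun i => √|c i|
  set g : ι → ℝ := fun i => SignType.sign (c i) * √|c i|
  set r := √(1 - ∑ i, |c i|)
  have sq_r : r ^ 2 = 1 - ∑ i, |c i| := Real.sq_sqrt (by linarith)
  have sq_f (i : ι) : f i ^ 2 = |c i| := Real.sq_sqrt (abs_nonneg _)
  have sq_g (i : ι) : g i ^ 2 = |c i| := by
    rcases lt_trichotomy (c i) 0 with h | h | h <;> simp [g, h, Real.sq_sqrt]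
  have mul_eq (i : ι) : g i * f i = c i := by
    rw [mul_assoc, ← sq, sq_f, sign_mul_abs]
  obtain ⟨F, hF⟩ := exists_unitary_column i₀ (v := Function.update f p r) <| by
    rw [sum_update_sq (by simp [f, hp]), sq_r]
    simp [sq_f]
  obtain ⟨G, hG⟩ := exists_unitary_column i₀ (v := Function.update g p' r) <| by
    rw [sum_update_sq (by simp [g, hp']), sq_r]
    simp [sq_g]
  refine ⟨F, G, fun i => ?_⟩
  rw [hF, hG, Complex.star_def, Complex.conj_ofReal, ← Complex.ofReal_mul]
  congr 1
  rcases eq_or_ne i p with rfl | hi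
  · simp [Function.update_of_ne hne, g, hp]
  rcases eq_or_ne i p' with rfl | hi'
  · simp [Function.update_of_ne hi, f, hp']
  · rw [Function.update_of_ne hi, Function.update_of_ne hi', mul_eq]

variable {w L nt m b n : ℕ}

open scoped Kronecker in
/-- A gate on the work qubits. -/
def workGate (L nt m b n : ℕ) (G : Matrix.unitaryGroup (Fin (2 ^ w)) ℂ) :
    Matrix.unitaryGroup (FullIdx w L nt m b n) ℂ :=
  ⟨G.1 ⊗ₖ 1, Matrix.kronecker_mem_unitary G.2 (one_mem _)⟩

/-- The linear combination of the operators that `c` applies to the system: `F` prepares the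
amplitudes in the work qubits and `G` unprepares them. -/
def lcuCircuit (F : Matrix.unitaryGroup (Fin (2 ^ w)) ℂ) (c : Circuit w L nt m b n)
    (G : Matrix.unitaryGroup (Fin (2 ^ w)) ℂ) : Circuit w L nt m b n :=
  .free (workGate L nt m b n F) :: (c ++ [.free (workGate L nt m b n G)⁻¹])

lemma queries_lcuCircuit (F : Matrix.unitaryGroup (Fin (2 ^ w)) ℂ) (c : Circuit w L nt m b n)
    (G : Matrix.unitaryGroup (Fin (2 ^ w)) ℂ) : (lcuCircuit F c G).queries = c.queries := by
  simp [lcuCircuit, Circuit.queries, Gate.queries]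

variable [NeZero L]

lemma workGate_mul_workSlice (G : Matrix.unitaryGroup (Fin (2 ^ w)) ℂ) (w₀ : Fin (2 ^ w)) :
    (workGate L nt m b n G).1 * workSlice w L nt m b n w₀
      = ∑ i, G.1 i w₀ • workSlice w L nt m b n i := by
  rw [workSlice, slice, mul_one_submatrix]
  ext ⟨w₁, j, q, s, v, y⟩ x
  rw [Matrix.sum_apply, Finset.sum_eq_single w₁ (fun i _ hi => by
    simp [workSlice, slice, hi.symm]) (by simp)]
  simp [workGate, workSlice, slice, Matrix.one_apply]

variable {Uα : Matrix (CoeffIdx L nt m b) (CoeffIdx L nt m b) ℂ}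
  {UH : Matrix (HamIdx L b n) (HamIdx L b n) ℂ}

lemma block_lcuCircuit {c : Circuit w L nt m b n} {T : Fin (2 ^ w) → QOp n} (hc : Acts Uα UH c T)
    (F G : Matrix.unitaryGroup (Fin (2 ^ w)) ℂ) :
    block ((lcuCircuit F c G).eval Uα UH) = ∑ i, (star (G.1 i 0) * F.1 i 0) • T i := by
  have prepare : Circuit.eval Uα UH c * ((workGate L nt m b n F).1 * workSlice w L nt m b n 0)
      = ∑ i, F.1 i 0 • (workSlice w L nt m b n i * T i) := by
    rw [workGate_mul_workSlice, Matrix.mul_sum]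
    exact Finset.sum_congr rfl fun i _ => by rw [Matrix.mul_smul, hc i]
  have unprepare : (workSlice w L nt m b n 0).conjTranspose * (workGate L nt m b n G)⁻¹.1
      = ∑ i, star (G.1 i 0) • (workSlice w L nt m b n i).conjTranspose := by
    rw [Matrix.UnitaryGroup.inv_val, Matrix.star_eq_conjTranspose, ← Matrix.conjTranspose_mul,
      workGate_mul_workSlice, Matrix.conjTranspose_sum]
    exact Finset.sum_congr rfl fun i _ => Matrix.conjTranspose_smul ..
  simp only [lcuCircuit, Circuit.eval_append, Circuit.eval, Gate.eval, block_eq, Matrix.one_mul]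
  rw [← Matrix.mul_assoc, ← Matrix.mul_assoc, unprepare, Matrix.mul_assoc, Matrix.mul_assoc,
    prepare, Matrix.sum_mul]
  refine Finset.sum_congr rfl fun i _ => ?_
  simp [Matrix.mul_sum, ← Matrix.mul_assoc, conjTranspose_workSlice_mul_workSlice, smul_smul,
    mul_comm]

end LinearCombination

section AmplifiedMultiproduct

variable {M n L nt R : ℕ} {k : Fin M → ℕ} {a : Fin M → ℝ}

lemma phaseStep_zero (Hs : Fin L → QOp n) : (phaseStep Hs fun _ => 0) = 1 := by
  simp [phaseStep]

/-- The time step with code `s`, half a step of the product formula with `s` steps. By the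
convention `x / 0 = 0` the code `0` stands for the step length `0`, which turns a step into the
identity; the shorter product formulas are padded with such steps. -/
def stepDuration {m : ℕ} (t₀ t : ℝ) (s : Fin (2 ^ m)) : ℝ := (t - t₀) / (2 * (s : ℕ))

lemma stepDuration_nonneg_and_le {m : ℕ} {t₀ t : ℝ} (h : t₀ ≤ t) (s : Fin (2 ^ m)) :
    0 ≤ stepDuration t₀ t s ∧ stepDuration t₀ t s ≤ t - t₀ := by
  have nonneg : 0 ≤ t - t₀ := sub_nonneg.2 h
  refine ⟨by rw [stepDuration]; positivity, ?_⟩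
  rcases Nat.eq_zero_or_pos (s : ℕ) with hs | hs
  · simpa [stepDuration, hs] using h
  · have one_le : (1 : ℝ) ≤ (s : ℕ) := Nat.one_le_cast.2 hs
    exact div_le_self nonneg (by linarith)

lemma descProd_phaseStep_eq_meshProduct (Hs : Fin L → QOp n) (α : Fin L → ℝ → ℝ) (t₀ t : ℝ)
    {k : ℕ} (hk : k ≤ R) (q : ℕ → Fin (2 ^ nt)) :
    descProd (fun r => phaseStep Hs fun l => α l (meshPoint t₀ t nt (q r)) *
        stepDuration t₀ t (if r < k then ⟨k, hk.trans_lt Nat.lt_two_pow_self⟩ else 0 : Fin (2 ^ R)))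
      R = meshProduct Hs α t₀ t k q := by
  rw [descProd_eq_of_le hk fun r hr => by
    simpa [stepDuration, hr.not_gt] using phaseStep_zero Hs]
  exact descProd_congr fun r hr => by simp [stepDuration, hr]

lemma l1norm_smul (σ : ℝ) (a : Fin M → ℝ) : l1norm (σ • a) = |σ| * l1norm a := by
  simp only [l1norm, Pi.smul_apply, smul_eq_mul, abs_mul, Finset.mul_sum]

lemma meshMultiproduct_smul (Hs : Fin L → QOp n) (α : Fin L → ℝ → ℝ) (t₀ t σ : ℝ)
    (k : Fin M → ℕ) (a : Fin M → ℝ) (q : Fin M → ℕ → Fin (2 ^ nt)) :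
    meshMultiproduct Hs α t₀ t k (σ • a) q = (σ : ℂ) • meshMultiproduct Hs α t₀ t k a q := by
  simp only [meshMultiproduct, Pi.smul_apply, smul_eq_mul, Complex.ofReal_mul, mul_smul,
    Finset.smul_sum]

lemma exists_amplification_depth {x : ℝ} (hx : 1 ≤ x) :
    ∃ d : ℕ, (3 : ℝ) ^ d ≤ 6 * x ∧ |Real.sin (Real.pi / (2 * 3 ^ d))| * x ≤ 1 := by
  obtain ⟨d, le, lt⟩ := exists_nat_pow_near (by linarith : 1 ≤ 2 * x) (by norm_num : (1 : ℝ) < 3)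
  refine ⟨d + 1, by rw [pow_succ]; linarith, ?_⟩
  calc |Real.sin (Real.pi / (2 * 3 ^ (d + 1)))| * x
      ≤ |Real.pi / (2 * 3 ^ (d + 1))| * x :=
        mul_le_mul_of_nonneg_right Real.abs_sin_le_abs (by linarith)
    _ = Real.pi / (2 * 3 ^ (d + 1)) * x := by rw [abs_of_nonneg (by positivity)]
    _ ≤ 4 / (2 * 3 ^ (d + 1)) * (3 ^ (d + 1) / 2) := by
        gcongr
        · exact Real.pi_le_four
        · linarith
    _ = 1 := by field_simp; norm_num

variable [NeZero L]

lemma exists_circuit_block_eq_meshMultiproduct (hk : ∀ j, k j ≤ R) (ha : l1norm a ≤ 1)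
    (q : Fin M → ℕ → Fin (2 ^ nt)) (t₀ t : ℝ) (b n : ℕ) :
    ∃ c : Circuit (M + 2) L nt R b n, c.queries = 6 * R * L ∧
      ∀ (Hs : Fin L → QOp n) (α : Fin L → ℝ → ℝ) (val : Fin (2 ^ b) → ℝ)
        (enc : Fin L → Fin (2 ^ nt) → Fin (2 ^ R) → Fin (2 ^ b))
        (Uα : Matrix (CoeffIdx L nt R b) (CoeffIdx L nt R b) ℂ)
        (UH : Matrix (HamIdx L b n) (HamIdx L b n) ℂ),
        IsEncoding α t₀ t (stepDuration t₀ t) val enc → IsCoeffOracle enc Uα →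
        IsHamOracle Hs val enc UH →
        block (c.eval Uα UH) = meshMultiproduct Hs α t₀ t k a q := by
  have lt_two_pow : M + 2 < 2 ^ (M + 2) := Nat.lt_two_pow_self
  let e : Fin M → Fin (2 ^ (M + 2)) := Fin.castLE (by lia)
  have e_injective : Function.Injective e := Fin.castLE_injective _
  have extend_eq_zero (i : ℕ) (hi : M ≤ i) (hi' : i < 2 ^ (M + 2)) :
      Function.extend e a 0 ⟨i, hi'⟩ = 0 := Function.extend_apply' _ _ _ fun ⟨j, hj⟩ => by
    have := congrArg Fin.val hj
    simp only [e, Fin.val_castLE] at this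
    lia
  have sum_le : ∑ i, |Function.extend e a 0 i| ≤ 1 := by
    rwa [← Fintype.sum_of_injective e e_injective (fun j => |a j|) _
      (fun i hi => by rw [Function.extend_apply' _ _ _ hi, Pi.zero_apply, abs_zero])
      fun j => by rw [e_injective.extend_apply]]
  have ne : (⟨M, by lia⟩ : Fin (2 ^ (M + 2))) ≠ ⟨M + 1, by lia⟩ := by simp
  obtain ⟨F, G, hFG⟩ := exists_unitary_star_mul_eq 0 ne (extend_eq_zero _ le_rfl _)
    (extend_eq_zero _ (by lia) _) sum_le
  let Q := Function.extend e q 0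
  let S := Function.extend e (fun j r => if r < k j then
    ⟨k j, (hk j).trans_lt Nat.lt_two_pow_self⟩ else (0 : Fin (2 ^ R))) 0
  refine ⟨lcuCircuit F (selectCircuit b n Q S R) G,
    by rw [queries_lcuCircuit, queries_selectCircuit]; ring,
    fun Hs α val enc Uα UH henc hα hH => ?_⟩
  rw [block_lcuCircuit (acts_selectCircuit hα hH henc Q S R), meshMultiproduct]
  refine (Fintype.sum_of_injective e e_injective _ _ (fun i hi => ?_) fun j => ?_).symm
  · rw [hFG, Function.extend_apply' _ _ _ hi, Pi.zero_apply, Complex.ofReal_zero, zero_smul]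
  · simp only [hFG, Q, S, e_injective.extend_apply]
    rw [descProd_phaseStep_eq_meshProduct Hs α t₀ t (hk j)]

lemma exists_circuit_norm_block_sub_le (hk : ∀ j, k j ≤ R) {d : ℕ}
    (hd : |Real.sin (Real.pi / (2 * 3 ^ d))| * l1norm a ≤ 1) (q : Fin M → ℕ → Fin (2 ^ nt))
    (t₀ t : ℝ) (b n : ℕ) :
    ∃ c : Circuit (M + 2) L nt R b n, c.queries = 3 ^ d * (6 * R * L) ∧
      ∀ (Hs : Fin L → QOp n) (α : Fin L → ℝ → ℝ) (val : Fin (2 ^ b) → ℝ)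
        (enc : Fin L → Fin (2 ^ nt) → Fin (2 ^ R) → Fin (2 ^ b))
        (Uα : Matrix (CoeffIdx L nt R b) (CoeffIdx L nt R b) ℂ)
        (UH : Matrix (HamIdx L b n) (HamIdx L b n) ℂ) (U : QOp n),
        IsEncoding α t₀ t (stepDuration t₀ t) val enc → IsCoeffOracle enc Uα →
        IsHamOracle Hs val enc UH → star U * U = 1 →
        ‖block (c.eval Uα UH) - U‖ ≤ 15 ^ d * ‖meshMultiproduct Hs α t₀ t k a q - U‖ := by
  obtain ⟨c, queries_eq, block_eq⟩ := exists_circuit_block_eq_meshMultiproduct (L := L) hk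
    ((l1norm_smul _ a).trans_le hd) q t₀ t b n
  refine ⟨amplify^[d] c, by rw [queries_iterate_amplify, queries_eq],
    fun Hs α val enc Uα UH U henc hα hH hU =>
      norm_block_eval_iterate_amplify_sub_le hα hH.1 c hU ?_⟩
  rw [block_eq Hs α val enc Uα UH henc hα hH, meshMultiproduct_smul, ← smul_sub, norm_smul,
    Complex.norm_real, Real.norm_eq_abs]
  exact mul_le_of_le_one_left (norm_nonneg _) (Real.abs_sin_le_one _)

end AmplifiedMultiproduct

section Error

lemma norm_sub_le_two_mul_two_pow_mul {V : Type*} [SeminormedAddCommGroup V] {A U : V}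
    (hA : ‖A‖ ≤ 1) (hU : ‖U‖ ≤ 1) {x : ℝ} (hx : 1 / 2 ≤ x) {y : ℝ} (hy : 1 ≤ y) (p : ℕ) :
    ‖A - U‖ ≤ 2 * 2 ^ p * (y * x ^ p) := by
  have one_le : 1 ≤ y * (2 * x) ^ p := one_le_mul_of_one_le_of_one_le hy
    (one_le_pow₀ (by linarith))
  calc ‖A - U‖ ≤ 1 + 1 := (norm_sub_le _ _).trans (add_le_add hA hU)
    _ ≤ 2 * (y * (2 * x) ^ p) := by linarith
    _ = 2 * 2 ^ p * (y * x ^ p) := by rw [mul_pow]; ring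

variable {M R : ℕ} {k : Fin M → ℕ} {a : Fin M → ℝ} {t₀ t : ℝ}

-- For large `κ * max Λ * (t - t₀)` both operators being contractions suffices.
theorem exists_circuit_norm_block_sub_propagator_le (hM : 0 < M) (ha : IsMPF k a)
    (hk : ∀ j, k j ≤ R) {d : ℕ} (hd : |Real.sin (Real.pi / (2 * 3 ^ d))| * l1norm a ≤ 1)
    (h : t₀ < t) (n L nt b : ℕ) [NeZero L] :
    ∃ c : Circuit (M + 2) L nt R b n, c.queries = 3 ^ d * (6 * R * L) ∧
      ∀ (Hs : Fin L → QOp n) (α : Fin L → ℝ → ℝ) (Λ : ℝ → ℝ) (κ : ℝ) (val : Fin (2 ^ b) → ℝ)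
        (enc : Fin L → Fin (2 ^ nt) → Fin (2 ^ R) → Fin (2 ^ b))
        (Uα : Matrix (CoeffIdx L nt R b) (CoeffIdx L nt R b) ℂ)
        (UH : Matrix (HamIdx L b n) (HamIdx L b n) ℂ) (U : ℝ → QOp n),
        (∀ j, (Hs j).IsHermitian) →
        (∀ j, ContDiffOn ℝ (2 * M : ℕ) (α j) (Set.Icc t₀ t)) →
        0 < lambdaMax Λ t₀ t →
        IsTermRatio M Hs α Λ t₀ t κ →
        IsEncoding α t₀ t (stepDuration t₀ t) val enc →
        IsCoeffOracle enc Uα →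
        IsHamOracle Hs val enc UH →
        IsPropagator (hamiltonian Hs α) t₀ t U →
        Real.logb 2 (10 * (M : ℝ) ^ 2 * L * maxDeriv α t₀ t * (t - t₀) ^ 2 /
          (41 * lambdaMax Λ t₀ t * (t - t₀)) ^ (2 * M + 1)) ≤ nt →
        ‖block (c.eval Uα UH) - U t‖ ≤ (15 ^ d * mpfConst M + 2 * 2 ^ (2 * M + 1)) *
          (l1norm a * (κ * lambdaMax Λ t₀ t * (t - t₀)) ^ (2 * M + 1)) := by
  obtain ⟨q, hq⟩ := exists_isMidpointRounding h k nt
  obtain ⟨c, queries_eq, norm_le⟩ := exists_circuit_norm_block_sub_le (L := L) hk hd q t₀ t b n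
  refine ⟨c, queries_eq,
    fun Hs α Λ κ val enc Uα UH U hHs hα hlam hκ henc hUα hUH hU hnt => ?_⟩
  have isometry := hU.star_mul_self h (isHermitian_hamiltonian hHs α)
  have one_le := ha.one_le_l1norm hM
  have pos : 0 < κ * lambdaMax Λ t₀ t * (t - t₀) :=
    mul_pos (mul_pos (zero_lt_one.trans_le hκ.1) hlam) (sub_pos.2 h)
  have mpfConst_nonneg := mpfConst_nonneg M
  rw [add_mul]
  rcases le_total (κ * lambdaMax Λ t₀ t * (t - t₀)) (1 / 2) with small | large
  · refine le_add_of_le_of_nonneg ?_ (by positivity)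
    rw [mul_assoc]
    exact (norm_le Hs α val enc Uα UH (U t) henc hUα hUH isometry).trans <|
      mul_le_mul_of_nonneg_left (hκ.norm_meshMultiproduct_sub_propagator_le hM h ha hHs hα hlam
        hnt hq hU small) (by positivity)
  · exact le_add_of_nonneg_of_le (by positivity) <| norm_sub_le_two_mul_two_pow_mul
      (norm_block_eval_le_one hUα.1 hUH.1 c) (norm_le_one_of_star_mul_self_eq_one isometry)
      large one_le _

lemma three_pow_mul_queries_le {L d : ℕ} (hM : 0 < M) (hL : 0 < L) {x C : ℝ}
    (hd : (3 : ℝ) ^ d ≤ 6 * x) (hx : x ≤ C * (1 + Real.log M)) (hC : 0 ≤ C) :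
    ((3 ^ d * (6 * (3 * M ^ 2) * L) : ℕ) : ℝ)
      ≤ 108 * C * ((M : ℝ) ^ 2 * L) * (1 + Real.log ((M : ℝ) ^ 2 * L)) := by
  have one_le_M : (1 : ℝ) ≤ M := Nat.one_le_cast.2 hM
  have one_le_L : (1 : ℝ) ≤ L := Nat.one_le_cast.2 hL
  have log_le : Real.log M ≤ Real.log ((M : ℝ) ^ 2 * L) :=
    Real.log_le_log (by linarith) (by nlinarith [sq_nonneg (M : ℝ)])
  push_cast
  calc (3 : ℝ) ^ d * (6 * (3 * M ^ 2) * L)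
      ≤ 6 * (C * (1 + Real.log ((M : ℝ) ^ 2 * L))) * (6 * (3 * M ^ 2) * L) := by
        gcongr
        exact hd.trans (by gcongr; exact hx.trans (by gcongr))
    _ = _ := by ring

end Error

end TDMPF

end

theorem mainTheorem7_general :
    ∃ (c₁ c₂ : ℝ) (e : ℕ), ∀ M : ℕ, 1 ≤ M →
      ∃ (k : Fin M → ℕ) (a : Fin M → ℝ) (C : ℝ),
        TDMPF.IsMPF k a ∧ (∀ j, k j ≤ 3 * M ^ 2) ∧
        TDMPF.l1norm a ≤ c₁ * (1 + Real.log M) ∧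
        ∀ (n L nt : ℕ) [NeZero L] (t₀ t : ℝ), t₀ < t →
          ∃ (m : ℕ) (dur : Fin (2 ^ m) → ℝ), (∀ s, 0 ≤ dur s ∧ dur s ≤ t - t₀) ∧
          ∀ b : ℕ,
            ∃ (w : ℕ) (circ : TDMPF.Circuit w L nt m b n),
              (circ.queries : ℝ)
                ≤ c₂ * ((M : ℝ) ^ 2 * L) * (1 + Real.log ((M : ℝ) ^ 2 * L)) ^ e ∧
              ∀ (Hs : Fin L → TDMPF.QOp n) (α : Fin L → ℝ → ℝ) (Λ : ℝ → ℝ) (κ : ℝ)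
                (val : Fin (2 ^ b) → ℝ)
                (enc : Fin L → Fin (2 ^ nt) → Fin (2 ^ m) → Fin (2 ^ b))
                (Uα : Matrix (TDMPF.CoeffIdx L nt m b) (TDMPF.CoeffIdx L nt m b) ℂ)
                (UH : Matrix (TDMPF.HamIdx L b n) (TDMPF.HamIdx L b n) ℂ)
                (U : ℝ → TDMPF.QOp n),
                (∀ j, (Hs j).IsHermitian) →
                (∀ j, ContDiffOn ℝ (2 * M + 1 : ℕ) (α j) (Set.Icc t₀ t)) →
                0 < TDMPF.lambdaMax Λ t₀ t →
                TDMPF.IsTermRatio M Hs α Λ t₀ t κ →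
                TDMPF.IsEncoding α t₀ t dur val enc →
                TDMPF.IsCoeffOracle enc Uα →
                TDMPF.IsHamOracle Hs val enc UH →
                TDMPF.IsPropagator (TDMPF.hamiltonian Hs α) t₀ t U →
                Real.logb 2
                    (10 * (M : ℝ) ^ 2 * L * TDMPF.maxDeriv α t₀ t * (t - t₀) ^ 2 /
                      (41 * TDMPF.lambdaMax Λ t₀ t * (t - t₀)) ^ (2 * M + 1)) ≤ (nt : ℝ) →
                ‖TDMPF.block (circ.eval Uα UH) - U t‖
                  ≤ C * (TDMPF.l1norm a *
                      (κ * TDMPF.lambdaMax Λ t₀ t * (t - t₀)) ^ (2 * M + 1)) := by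
  refine ⟨2 * Real.exp 312, 108 * (2 * Real.exp 312), 1, fun M hM => ?_⟩
  have hmpf := TDMPF.isMPF_mpfWeight M
  have l1norm_le := TDMPF.l1norm_mpfWeight_le M
  obtain ⟨d, three_pow_le, sin_mul_le⟩ :=
    TDMPF.exists_amplification_depth (hmpf.one_le_l1norm hM)
  refine ⟨fun j => TDMPF.mpfStep M j, TDMPF.mpfWeight M,
    15 ^ d * TDMPF.mpfConst M + 2 * 2 ^ (2 * M + 1), hmpf, fun j => TDMPF.mpfStep_le M j,
    l1norm_le, fun n L nt _ t₀ t h => ⟨3 * M ^ 2, TDMPF.stepDuration t₀ t,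
      TDMPF.stepDuration_nonneg_and_le h.le, fun b => ?_⟩⟩
  obtain ⟨circ, queries_eq, norm_le⟩ := TDMPF.exists_circuit_norm_block_sub_propagator_le hM hmpf
    (fun j => TDMPF.mpfStep_le M j) sin_mul_le h n L nt b
  refine ⟨M + 2, circ, ?_, fun Hs α Λ κ val enc Uα UH U hHs hα =>
    norm_le Hs α Λ κ val enc Uα UH U hHs fun j => (hα j).of_le (by exact_mod_cast (2 * M).le_succ)⟩
  rw [queries_eq, pow_one]
  exact TDMPF.three_pow_mul_queries_le hM (NeZero.pos L) three_pow_le l1norm_le (by positivity)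

theorem mainTheorem7 :
    -- absolute constants
    ∃ (c₁ c₂ : ℝ) (e : ℕ), ∀ M : ℕ, 1 ≤ M →
      -- coefficients and the error constant depend on `M` only
      ∃ (k : Fin M → ℕ) (a : Fin M → ℝ) (C : ℝ),
        TDMPF.IsMPF k a ∧ (∀ j, k j ≤ 3 * M ^ 2) ∧
        TDMPF.l1norm a ≤ c₁ * (1 + Real.log M) ∧
        ∀ (n L nt : ℕ) [NeZero L] (t₀ t : ℝ), t₀ < t →
          -- the encoded time steps used by the circuit
          ∃ (m : ℕ) (dur : Fin (2 ^ m) → ℝ), (∀ s, 0 ≤ dur s ∧ dur s ≤ t - t₀) ∧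
          ∀ b : ℕ,
            -- the circuit, fixed before the Hamiltonian and its oracles
            ∃ (w : ℕ) (circ : TDMPF.Circuit w L nt m b n),
              (circ.queries : ℝ)
                ≤ c₂ * ((M : ℝ) ^ 2 * L) * (1 + Real.log ((M : ℝ) ^ 2 * L)) ^ e ∧
              ∀ (Hs : Fin L → TDMPF.QOp n) (α : Fin L → ℝ → ℝ) (Λ : ℝ → ℝ) (κ : ℝ)
                (val : Fin (2 ^ b) → ℝ)
                (enc : Fin L → Fin (2 ^ nt) → Fin (2 ^ m) → Fin (2 ^ b))
                (Uα : Matrix (TDMPF.CoeffIdx L nt m b) (TDMPF.CoeffIdx L nt m b) ℂ)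
                (UH : Matrix (TDMPF.HamIdx L b n) (TDMPF.HamIdx L b n) ℂ)
                (U : ℝ → TDMPF.QOp n),
                (∀ j, (Hs j).IsHermitian) →
                (∀ j, ContDiffOn ℝ ∞ (α j) (Set.Icc t₀ t)) →
                TDMPF.IsLambdaBound (TDMPF.hamiltonian Hs α) t₀ t Λ →
                TDMPF.IsTermRatio M Hs α Λ t₀ t κ →
                TDMPF.IsEncoding α t₀ t dur val enc →
                TDMPF.IsCoeffOracle enc Uα →
                TDMPF.IsHamOracle Hs val enc UH →
                TDMPF.IsPropagator (TDMPF.hamiltonian Hs α) t₀ t U →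
                Real.logb 2
                    (10 * (M : ℝ) ^ 2 * L * TDMPF.maxDeriv α t₀ t * (t - t₀) ^ 2 /
                      (41 * TDMPF.lambdaMax Λ t₀ t * (t - t₀)) ^ (2 * M + 1)) ≤ (nt : ℝ) →
                ‖TDMPF.block (circ.eval Uα UH) - U t‖
                  ≤ C * (TDMPF.l1norm a *
                      (κ * TDMPF.lambdaMax Λ t₀ t * (t - t₀)) ^ (2 * M + 1)) := by
  obtain ⟨c₁, c₂, e, hgen⟩ := mainTheorem7_general
  refine ⟨c₁, c₂, e, fun M hM => ?_⟩
  obtain ⟨k, a, C, hmpf, hk, ha, hcirc⟩ := hgen M hM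
  refine ⟨k, a, C, hmpf, hk, ha, fun n L nt _ t₀ t h => ?_⟩
  obtain ⟨m, dur, hdur, hcirc⟩ := hcirc n L nt t₀ t h
  refine ⟨m, dur, hdur, fun b => ?_⟩
  obtain ⟨w, circ, hqueries, norm_le⟩ := hcirc b
  exact ⟨w, circ, hqueries, fun Hs α Λ κ val enc Uα UH U hHs hα hΛ =>
    norm_le Hs α Λ κ val enc Uα UH U hHs
      (fun j => contDiffOn_infty.1 (hα j) _) (hΛ.lambdaMax_pos h.le)⟩
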